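/- **Model.** Fix $0<p\le 1/2$ and $\lambda>1$. For every real $d>0$ let $a,b,c$ (depending on $d$) satisfy $pa+(1-p)b=pb+(1-p)c=1$ and $d(1-b)^2=\lambda$. The stochastic block model on the vertices $\{1,\dots,n\}$ has independent labels $X_i\in\{1,2\}$ with $\mathbb P(X_i=1)=p$; given the labels, the pairs $\{i,j\}$ are joined by an edge independently, with probability $M_{X_iX_j}$, where $M=\frac dn\begin{pmatrix}a&b\\ b&c\end{pmatrix}$. (For fixed large $d$ and then all large $n$ the entries of $M$ lie in $[0,1]$.) Let $\mathcal G$ be the resulting graph. For an estimator $T=(T_1,\dots,T_n)$ of the labels put $$P_{succ}(T)=\frac1n\sum_{i=1}^n\Big(\mathbb P(T_i=1\mid X_i=1)+\mathbb P(T_i=2\mid X_i=2)-1\Big).$$ Let $T^{opt}$ be the test with $T^{opt}_i=1$ if $\log\frac{\mathbb P(X_i=1\mid \mathcal G)}{\mathbb P(X_i=2\mid \mathcal G)}\ge\log\frac p{1-p}$ and $T_i^{opt}=2$ otherwise. For $0<q<1$ let $T^{opt}(q)$ be the test defined in the same way, but with the conditioning on $\mathcal G$, the set of revealed vertices and their labels,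 where each vertex has its label revealed with probability $q$, independently of everything else. For $\mu\ge 0$ let $$G(\mu)=\frac{\lambda}{(1-p)^2}\,\mathbb E\Big[\frac1{p+(1-p)\exp(\sqrt\mu Z-\mu/2)}-1\Big],\qquad Z\sim\mathcal N(0,1).$$ **Proposition.** (i) If $\alpha>0$ and the fixed points of $G$ on $[0,\infty)$ are exactly $0$ and $\alpha$, then $$\limsup_{d\to\infty}\limsup_{n\to\infty}P_{succ}(T^{opt})\le 2\,\mathbb P(\mathcal N(\alpha/2,\alpha)>0)-1, \qquad (\mathrm U_\alpha)$$ and $$\liminf_{d\to\infty}\liminf_{n\to\infty}P_{succ}(T^{opt}(q))\ge 2\,\mathbb P(\mathcal N(\alpha/2,\alpha)>0)-1\quad\text{for all } 0<q<1. \qquad (\mathrm L_\alpha)$$ (ii) Without any assumption on the number of fixed points of $G$: $G$ has a smallest positive fixed point $\alpha_{\min}$ and a largest one $\alpha_{\max}$, and $(\mathrm U_{\alpha_{\max}})$ and $(\mathrm L_{\alpha_{\min}})$ hold. -/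

import Mathlib

open Filter

noncomputable section

/-- Probability of the event `A` on a finite sample space in which `ω` has probability `w ω`. -/
def prob {Ω : Type*} [Fintype Ω] (w : Ω → ℝ) (A : Set Ω) : ℝ :=
  ∑ ω, A.indicator w ω

/-- Conditional probability of `A` given `B`. -/
def condProb {Ω : Type*} [Fintype Ω] (w : Ω → ℝ) (A B : Set Ω) : ℝ :=
  prob w (A ∩ B) / prob w B

/-- Communities are indexed by `Fin 2`: `0` is community 1, which has probability `p`, and `1` is
community 2, which has probability `1 - p`. -/
def labelProb (p : ℝ) : Fin 2 → ℝ := ![p, 1 - p]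

/-- Connectivity matrix `(d / n) * (a, b; b, c)`. -/
def connectivity (d a b c : ℝ) (n : ℕ) : Matrix (Fin 2) (Fin 2) ℝ :=
  (d / n) • !![a, b; b, c]

open scoped Classical in
/-- Stochastic block model with parameters `(M, n, p)`: the probability of the labels `ω.1` and the
graph `ω.2`. The labels are independent and, given the labels, the pairs `i < j` are joined
independently with probability `M (x i) (x j)`. -/
def sbm (n : ℕ) (p : ℝ) (M : Matrix (Fin 2) (Fin 2) ℝ) :
    (Fin n → Fin 2) × SimpleGraph (Fin n) → ℝ :=
  fun ω =>
    (∏ i, labelProb p (ω.1 i)) *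
      ∏ i, ∏ j ∈ Finset.Ioi i,
        if ω.2.Adj i j then M (ω.1 i) (ω.1 j) else 1 - M (ω.1 i) (ω.1 j)

/-- The stochastic block model together with the random set of the vertices whose label is
revealed; every vertex belongs to it with probability `q`, independently of everything else. -/
def sbmReveal (n : ℕ) (p : ℝ) (M : Matrix (Fin 2) (Fin 2) ℝ) (q : ℝ) :
    ((Fin n → Fin 2) × SimpleGraph (Fin n)) × Finset (Fin n) → ℝ :=
  fun ω => sbm n p M ω.1 * (q ^ ω.2.card * (1 - q) ^ (n - ω.2.card))

/-- What is observed with side information: the graph, and for every vertex its label if it is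
revealed and `none` if it is not. -/
def observeReveal {n : ℕ} (ω : ((Fin n → Fin 2) × SimpleGraph (Fin n)) × Finset (Fin n)) :
    SimpleGraph (Fin n) × (Fin n → Option (Fin 2)) :=
  (ω.1.2, fun v => if v ∈ ω.2 then some (ω.1.1 v) else none)

/-- Rescaled average success probability of an estimator `T` of the labels `X` that is a function of
the observation `obs`:
`(1 / n) * ∑ i, (ℙ (T i = 1 | X i = 1) + ℙ (T i = 2 | X i = 2) - 1)`. -/
def successProb {Ω O : Type*} [Fintype Ω] {n : ℕ} (w : Ω → ℝ) (X : Ω → Fin n → Fin 2)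
    (obs : Ω → O) (T : O → Fin n → Fin 2) : ℝ :=
  (1 / (n : ℝ)) * ∑ i : Fin n,
    (condProb w {ω | T (obs ω) i = 0} {ω | X ω i = 0} +
      condProb w {ω | T (obs ω) i = 1} {ω | X ω i = 1} - 1)

open scoped Classical in
/-- The optimal test: it chooses community 1 for the vertex `i` exactly if
`log (ℙ (X i = 1 | obs) / ℙ (X i = 2 | obs)) ≥ log (p / (1 - p))`. The logarithm takes values in
the extended reals, with `log (x / 0) = ⊤` for `x > 0` and `log 0 = ⊥`. -/
def optTest {Ω O : Type*} [Fintype Ω] {n : ℕ} (w : Ω → ℝ) (p : ℝ) (X : Ω → Fin n → Fin 2)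
    (obs : Ω → O) : O → Fin n → Fin 2 :=
  fun o i =>
    if ENNReal.log (ENNReal.ofReal p / ENNReal.ofReal (1 - p)) ≤
        ENNReal.log (ENNReal.ofReal (condProb w {ω | X ω i = 0} {ω | obs ω = o}) /
          ENNReal.ofReal (condProb w {ω | X ω i = 1} {ω | obs ω = o}))
    then 0 else 1

open scoped Classical in
/-- Success probability of the optimal test that observes the graph only. -/
def optSuccess (n : ℕ) (p : ℝ) (M : Matrix (Fin 2) (Fin 2) ℝ) : ℝ :=
  successProb (sbm n p M) (fun ω => ω.1) (fun ω => ω.2)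
    (optTest (sbm n p M) p (fun ω => ω.1) (fun ω => ω.2))

open scoped Classical in
/-- Success probability of the optimal test that observes the graph and the revealed labels. -/
def optSuccessReveal (n : ℕ) (p : ℝ) (M : Matrix (Fin 2) (Fin 2) ℝ) (q : ℝ) : ℝ :=
  successProb (sbmReveal n p M q) (fun ω => ω.1.1) observeReveal
    (optTest (sbmReveal n p M q) p (fun ω => ω.1.1) observeReveal)

/-- The function
`G μ = lam / (1 - p) ^ 2 * 𝔼 [1 / (p + (1 - p) * exp (√μ * Z - μ / 2)) - 1]`, `Z` standard normal. -/
def cavityG (p lam μ : ℝ) : ℝ :=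
  lam / (1 - p) ^ 2 *
    ∫ z, (1 / (p + (1 - p) * Real.exp (√μ * z - μ / 2)) - 1)
      ∂(ProbabilityTheory.gaussianReal 0 1)

/-- `2 * ℙ (𝒩(α / 2, α) > 0) - 1`; the second parameter `α` is the variance. -/
def gaussianSuccess (α : ℝ) : ℝ :=
  2 * (ProbabilityTheory.gaussianReal (α / 2) α.toNNReal).real (Set.Ioi 0) - 1

/-- `limsup_{d → ∞} limsup_{n → ∞}` of the optimal success probability without side information is
at most `2 * ℙ (𝒩(α / 2, α) > 0) - 1`. All limits are taken in the extended reals. -/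
def UpperBound (p : ℝ) (a b c : ℝ → ℝ) (α : ℝ) : Prop :=
  limsup (fun d : ℝ => limsup (fun n : ℕ =>
      ((optSuccess n p (connectivity d (a d) (b d) (c d) n) : ℝ) : EReal)) atTop) atTop
    ≤ ((gaussianSuccess α : ℝ) : EReal)

/-- For all `0 < q < 1`, `liminf_{d → ∞} liminf_{n → ∞}` of the optimal success probability with
labels revealed with probability `q` is at least `2 * ℙ (𝒩(α / 2, α) > 0) - 1`. -/
def LowerBound (p : ℝ) (a b c : ℝ → ℝ) (α : ℝ) : Prop :=
  ∀ q : ℝ, 0 < q → q < 1 →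
    ((gaussianSuccess α : ℝ) : EReal) ≤
      liminf (fun d : ℝ => liminf (fun n : ℕ =>
        ((optSuccessReveal n p (connectivity d (a d) (b d) (c d) n) q : ℝ) : EReal)) atTop) atTop

end

/-! The optimal test compares a likelihood ratio with 1, so its contribution at a vertex is the
total variation distance between the two laws of the observation given the label of that vertex
(`successProb_optTest`). The task is to compute this distance; `n → ∞` and `d → ∞` are taken at a
fixed depth `t`, and `t → ∞` at the very end.

Local structure. Experiments are compared through Markov kernels: `Sim P Q ε` says that `Q` is a
randomization of `P` up to an `ℓ¹` error `ε`, and randomization cannot increase distances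
(`Sim.l1_le`). As `n → ∞`, the graph with labels at distance `t` revealed with probability `q`
simulates a branching tree of depth `t` with leaves revealed with probability `q`. For `q = 1` the
tree also simulates the graph, because the rest of the graph can be sampled once the boundary labels
are known. Both statements follow by peeling off one generation (`sim_succ`). The cost of a
generation is bounded by a chi-square computation (`l1_exploreLaw_le`) whose first-order terms
cancel, since both communities have the same mean degree. Ignoring revealed labels away from
distance `t` gives the lower bound; giving away all labels at distance `t` gives the upper bound.

Large degree. A child shifts the log-likelihood ratio of community 2 against community 1 by an
amount of order `d ^ (-1/2)`. Given community 1, the sum over the children is close to a normal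
variable with mean `-μ / 2` and variance `μ`, where `μ` is `λ` times the chi-square information of
one child (`tendsto_mean_sub_gaussMean`, uniform in the experiment observed at the child). Hence one
level sends `μ` to approximately `G μ`, and the total variation distance is approximately `gaussMean
hinge μ`, which is the Gaussian expression of the theorem. The starting value at the leaves is `λ q
/ (p (1 - p))`.

Fixed points. `G` is continuous, nondecreasing by Jensen's inequality, bounded by `λ / (p (1 - p))`,
and lies above the identity near `0` because `λ > 1`. For `q = 1` the iteration starts at this upper
bound and decreases to the largest fixed point. For `q > 0` it dominates a sequence converging to
the smallest positive fixed point. If there is only one positive fixed point, the two bounds concern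
the same value. -/

open Topology

noncomputable section

namespace SBM

/-! ### Comparison of finite experiments by Markov kernels -/

section Simulation

open scoped Classical

set_option linter.unusedSectionVars false

variable {X Y I A B C : Type*} [Fintype Y] [Fintype I] [Fintype A] [Fintype B] [Fintype C]

/-- Markov kernels between finite sets. -/
def IsKernel {A B : Type*} [Fintype B] (κ : A → B → ℝ) : Prop :=
  (∀ a b, 0 ≤ κ a b) ∧ ∀ a, ∑ b, κ a b = 1

/-- The image of a measure under a kernel. -/
def push {A B : Type*} [Fintype A] (P : A → ℝ) (κ : A → B → ℝ) : B → ℝ :=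
  fun b => ∑ a, P a * κ a b

/-- The `ℓ¹` distance. -/
def l1 {A : Type*} [Fintype A] (P Q : A → ℝ) : ℝ := ∑ a, |P a - Q a|

/-- The experiment `Q` can be simulated from the experiment `P` with error `ε`. -/
def Sim {X A B : Type*} [Fintype A] [Fintype B] (P : X → A → ℝ) (Q : X → B → ℝ) (ε : ℝ) : Prop :=
  ∃ κ : A → B → ℝ, IsKernel κ ∧ ∀ x, l1 (push (P x) κ) (Q x) ≤ ε

/-- The joint law of an index `i` and an observation from the `i`-th experiment. -/
def mixLaw {I Y A : Type*} [Fintype Y] (w : I → Y → ℝ) (P : I → Y → A → ℝ) : I × A → ℝ :=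
  fun q => ∑ y, w q.1 y * P q.1 y q.2

lemma l1_comm (P Q : A → ℝ) : l1 P Q = l1 Q P :=
  Finset.sum_congr rfl fun _ _ => abs_sub_comm _ _

lemma l1_self (P : A → ℝ) : l1 P P = 0 := by simp [l1]

lemma l1_triangle (P Q R : A → ℝ) : l1 P R ≤ l1 P Q + l1 Q R := by
  unfold l1
  rw [← Finset.sum_add_distrib]
  exact Finset.sum_le_sum fun _ _ => abs_sub_le _ _ _

lemma l1_push_le {κ : A → B → ℝ} (h : IsKernel κ) (P Q : A → ℝ) :
    l1 (push P κ) (push Q κ) ≤ l1 P Q := by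
  unfold l1 push
  calc ∑ b, |∑ a, P a * κ a b - ∑ a, Q a * κ a b|
      ≤ ∑ b, ∑ a, |P a - Q a| * κ a b := by
        refine Finset.sum_le_sum fun b _ => ?_
        rw [← Finset.sum_sub_distrib]
        refine (Finset.abs_sum_le_sum_abs _ _).trans (Finset.sum_le_sum fun a _ => ?_)
        rw [← sub_mul, abs_mul, abs_of_nonneg (h.1 a b)]
    _ = ∑ a, |P a - Q a| := by
        rw [Finset.sum_comm]
        simp [← Finset.mul_sum, h.2]

lemma push_push (P : A → ℝ) (κ : A → B → ℝ) (η : B → C → ℝ) :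
    push (push P κ) η = push P (fun a => push (κ a) η) := by
  funext c
  simp only [push, Finset.sum_mul, Finset.mul_sum]
  rw [Finset.sum_comm]
  simp [mul_assoc]

lemma sum_push {κ : A → B → ℝ} (h : IsKernel κ) (P : A → ℝ) : ∑ b, push P κ b = ∑ a, P a := by
  unfold push
  rw [Finset.sum_comm]
  simp [← Finset.mul_sum, h.2]

lemma push_nonneg {κ : A → B → ℝ} (h : IsKernel κ) {P : A → ℝ} (hP : ∀ a, 0 ≤ P a) (b : B) :
    0 ≤ push P κ b := Finset.sum_nonneg fun a _ => mul_nonneg (hP a) (h.1 a b)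

lemma IsKernel.comp {κ : A → B → ℝ} {η : B → C → ℝ} (h : IsKernel κ) (h' : IsKernel η) :
    IsKernel (fun a => push (κ a) η) :=
  ⟨fun a c => push_nonneg h' (h.1 a) c, fun a => by rw [sum_push h', h.2]⟩

lemma isKernel_map [DecidableEq B] (f : A → B) : IsKernel (fun a b => if f a = b then (1 : ℝ) else 0) :=
  ⟨fun a b => by dsimp only; split_ifs <;> norm_num, fun a => by simp⟩

lemma Sim.mono {P : X → A → ℝ} {Q : X → B → ℝ} {ε ε' : ℝ} (h : Sim P Q ε) (hε : ε ≤ ε') :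
    Sim P Q ε' :=
  let ⟨κ, hκ, hb⟩ := h
  ⟨κ, hκ, fun x => (hb x).trans hε⟩

lemma Sim.trans {P : X → A → ℝ} {Q : X → B → ℝ} {R : X → C → ℝ} {ε ε' : ℝ} (h : Sim P Q ε)
    (h' : Sim Q R ε') : Sim P R (ε + ε') := by
  obtain ⟨κ, hκ, hb⟩ := h
  obtain ⟨η, hη, hb'⟩ := h'
  refine ⟨_, hκ.comp hη, fun x => ?_⟩
  rw [← push_push]
  exact (l1_triangle _ (push (Q x) η) _).trans
    (add_le_add ((l1_push_le hη _ _).trans (hb x)) (hb' x))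

lemma Sim.of_l1 {P Q : X → A → ℝ} {ε : ℝ} (h : ∀ x, l1 (P x) (Q x) ≤ ε) : Sim P Q ε := by
  refine ⟨_, isKernel_map id, fun x => ?_⟩
  convert h x using 2
  funext b
  simp [push]

lemma Sim.of_map [DecidableEq B] {P : X → A → ℝ} {Q : X → B → ℝ} {ε : ℝ} (f : A → B)
    (h : ∀ x, l1 (fun b => ∑ a, if f a = b then P x a else 0) (Q x) ≤ ε) : Sim P Q ε := by
  refine ⟨_, isKernel_map f, fun x => ?_⟩
  convert h x using 2
  funext b
  simp [push]

lemma Sim.of_map_eq [DecidableEq B] {P : X → A → ℝ} {Q : X → B → ℝ} (f : A → B)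
    (h : ∀ x b, (∑ a, if f a = b then P x a else 0) = Q x b) : Sim P Q 0 :=
  Sim.of_map f fun x => by rw [funext (h x), l1_self]

/-- Data processing: a kernel contracts the `ℓ¹` distance, and the error is paid once for each of
the two parameters. -/
lemma Sim.l1_le {P : X → A → ℝ} {Q : X → B → ℝ} {ε : ℝ} (h : Sim P Q ε) (x y : X) :
    l1 (Q x) (Q y) ≤ l1 (P x) (P y) + 2 * ε := by
  obtain ⟨κ, hκ, hb⟩ := h
  have h1 := l1_triangle (Q x) (push (P x) κ) (Q y)
  have h2 := l1_triangle (push (P x) κ) (push (P y) κ) (Q y)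
  have h3 := l1_push_le hκ (P x) (P y)
  have h4 := hb x
  have h5 := hb y
  rw [l1_comm] at h4
  linarith

lemma l1_le_add {P Q : A → ℝ} (hP : ∀ a, 0 ≤ P a) (hQ : ∀ a, 0 ≤ Q a) :
    l1 P Q ≤ ∑ a, P a + ∑ a, Q a := by
  unfold l1
  rw [← Finset.sum_add_distrib]
  refine Finset.sum_le_sum fun a _ => abs_le.2 ⟨?_, ?_⟩ <;> linarith [hP a, hQ a]

/-- The trivial comparison by a constant kernel. It is the price of the rare explorations that meet
too many neighbours. -/
lemma Sim.two [Nonempty B] {P : X → A → ℝ} {Q : X → B → ℝ} (hP : ∀ x a, 0 ≤ P x a)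
    (hP1 : ∀ x, ∑ a, P x a = 1) (hQ : ∀ x a, 0 ≤ Q x a) (hQ1 : ∀ x, ∑ a, Q x a = 1) :
    Sim P Q 2 := by
  have hκ := isKernel_map (fun _ : A => Classical.arbitrary B)
  refine ⟨_, hκ, fun x => ?_⟩
  have := l1_le_add (push_nonneg hκ (hP x)) (hQ x)
  rw [sum_push hκ, hP1, hQ1] at this
  linarith

/-- The index is part of the observation, so a separate kernel can be used for every `i`, and the
errors are averaged. The kernel knows neither `x` nor `y`. The weights need not have total mass 1.
-/
lemma Sim.mix {w : X → I → Y → ℝ} (hw : ∀ x i y, 0 ≤ w x i y) {P : I → Y → A → ℝ}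
    {Q : I → Y → B → ℝ} {δ : I → ℝ} (h : ∀ i, Sim (P i) (Q i) (δ i)) {ε : ℝ}
    (hε : ∀ x, ∑ i, ∑ y, w x i y * δ i ≤ ε) :
    Sim (fun x => mixLaw (w x) P) (fun x => mixLaw (w x) Q) ε := by
  choose κ hκ hb using h
  refine ⟨fun q r => if q.1 = r.1 then κ q.1 q.2 r.2 else 0, ⟨fun q r => ?_, fun q => ?_⟩,
    fun x => le_trans ?_ (hε x)⟩
  · dsimp only
    split_ifs
    exacts [(hκ _).1 _ _, le_rfl]
  · rw [Fintype.sum_prod_type, Finset.sum_eq_single q.1]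
    · simp [(hκ _).2]
    · intro i _ hi
      simp [hi.symm]
    · simp
  · unfold l1
    rw [Fintype.sum_prod_type]
    refine Finset.sum_le_sum fun i _ => ?_
    calc ∑ b, |push (mixLaw (w x) P) (fun q r => if q.1 = r.1 then κ q.1 q.2 r.2 else 0) (i, b)
            - mixLaw (w x) Q (i, b)|
        = ∑ b, |∑ y, w x i y * (push (P i y) (κ i) b - Q i y b)| := by
          refine Finset.sum_congr rfl fun b _ => ?_
          congr 1
          simp only [push, mixLaw, Fintype.sum_prod_type]
          rw [Finset.sum_eq_single i]
          · simp only [mul_sub, Finset.sum_sub_distrib, if_true]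
            congr 1
            simp only [Finset.sum_mul, Finset.mul_sum]
            rw [Finset.sum_comm]
            simp only [mul_assoc]
          · intro j _ hj
            simp [hj]
          · simp
      _ ≤ ∑ b, ∑ y, w x i y * |push (P i y) (κ i) b - Q i y b| := by
          refine Finset.sum_le_sum fun b _ => (Finset.abs_sum_le_sum_abs _ _).trans
            (Finset.sum_le_sum fun y _ => ?_)
          rw [abs_mul, abs_of_nonneg (hw x i y)]
      _ = ∑ y, w x i y * l1 (push (P i y) (κ i)) (Q i y) := by
          rw [Finset.sum_comm]
          simp [l1, Finset.mul_sum]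
      _ ≤ _ := Finset.sum_le_sum fun y _ => mul_le_mul_of_nonneg_left (hb i y) (hw x i y)

/-- Forgetting the index. -/
lemma Sim.mix_snd {w : X → I → Y → ℝ} {P : I → Y → A → ℝ} :
    Sim (fun x => mixLaw (w x) P) (fun x a => ∑ i, ∑ y, w x i y * P i y a) 0 :=
  Sim.of_map_eq Prod.snd fun x b => by
    rw [Fintype.sum_prod_type]
    simp [mixLaw]

/-- Recovering the index from the observation. -/
lemma Sim.mix_of_snd {w : X → I → Y → ℝ} {P : I → Y → A → ℝ} (mask : A → I)
    (h : ∀ x i y a, w x i y * P i y a ≠ 0 → mask a = i) :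
    Sim (fun x a => ∑ i, ∑ y, w x i y * P i y a) (fun x => mixLaw (w x) P) 0 := by
  refine Sim.of_map_eq (fun a => (mask a, a)) fun x b => ?_
  obtain ⟨i, a⟩ := b
  rw [Finset.sum_eq_single a]
  · by_cases hi : mask a = i
    · subst hi
      simp only [if_true, mixLaw]
      refine Finset.sum_eq_single (mask a) (fun j _ hj => Finset.sum_eq_zero fun y _ => ?_) (by simp)
      by_contra hne
      exact hj (h x j y a hne).symm
    · simp only [Prod.mk.injEq, hi, false_and, if_false, mixLaw]
      symm
      refine Finset.sum_eq_zero fun y _ => ?_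
      by_contra hne
      exact hi (h x i y a hne)
  · intro a' _ ha'
    simp [ha']
  · simp

/-- The image of a mixture under an injective encoding. -/
lemma Sim.mix_encode {w : X → I → Y → ℝ} (hw : ∀ x i y, 0 ≤ w x i y) {P : I → Y → A → ℝ}
    (hP : ∀ i y a, 0 ≤ P i y a) (hP1 : ∀ i y, ∑ a, P i y a = 1) {F : X → B → ℝ}
    (hF : ∀ x b, 0 ≤ F x b) (hF1 : ∀ x, ∑ b, F x b = 1) (enc : I × A → B) (Z : Set (I × A))
    (hinj : Set.InjOn enc Z) (hZ : ∀ x i y a, w x i y * P i y a ≠ 0 → (i, a) ∈ Z)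
    (henc : ∀ x, ∀ q ∈ Z, F x (enc q) = mixLaw (w x) P q) {ε : ℝ}
    (hε : ∀ x, 1 - ∑ i, ∑ y, w x i y ≤ ε) (hne : Nonempty (I × A)) :
    Sim (fun x => mixLaw (w x) P) F ε ∧ Sim F (fun x => mixLaw (w x) P) ε := by
  have hmix0 : ∀ x q, 0 ≤ mixLaw (w x) P q := fun x q =>
    Finset.sum_nonneg fun y _ => mul_nonneg (hw _ _ _) (hP _ _ _)
  have hmixZ : ∀ x q, q ∉ Z → mixLaw (w x) P q = 0 := fun x q hq =>
    Finset.sum_eq_zero fun y _ => by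
      by_contra h
      exact hq (hZ x _ _ _ h)
  have hmix1 : ∀ x, ∑ q, mixLaw (w x) P q = ∑ i, ∑ y, w x i y := fun x => by
    simp only [mixLaw, Fintype.sum_prod_type]
    refine Finset.sum_congr rfl fun i _ => ?_
    rw [Finset.sum_comm]
    simp [← Finset.mul_sum, hP1]
  -- The encoded mixture is `F` cut off outside `enc '' Z`, so the error is the mass of `F` outside
  -- this image, which is at most `ε`.
  have hpush : ∀ x b, (∑ q, if enc q = b then mixLaw (w x) P q else 0) =
      if b ∈ enc '' Z then F x b else 0 := by
    intro x b
    split_ifs with hb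
    · obtain ⟨q, hq, rfl⟩ := hb
      rw [Finset.sum_eq_single q]
      · simp [henc x q hq]
      · intro q' _ hne
        split_ifs with h
        · exact hmixZ x q' fun hq' => hne (hinj hq' hq h)
        · rfl
      · simp
    · refine Finset.sum_eq_zero fun q _ => ?_
      split_ifs with h
      · exact hmixZ x q fun hq => hb ⟨q, hq, h⟩
      · rfl
  have hmass : ∀ x, (∑ b, if b ∈ enc '' Z then F x b else 0) = ∑ i, ∑ y, w x i y := by
    intro x
    rw [← hmix1]
    simp_rw [← hpush]
    rw [Finset.sum_comm]
    simp
  have hdef : ∀ x, ∑ b, (F x b - if b ∈ enc '' Z then F x b else 0) ≤ ε := by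
    intro x
    rw [Finset.sum_sub_distrib, hF1, hmass]
    exact hε x
  have hpos : ∀ x b, 0 ≤ F x b - if b ∈ enc '' Z then F x b else 0 := by
    intro x b
    split_ifs <;> simp [hF]
  constructor
  · refine Sim.of_map enc fun x => ?_
    rw [funext (hpush x), l1_comm]
    unfold l1
    simp_rw [abs_of_nonneg (hpos x _)]
    exact hdef x
  -- Outside the image of `Z` the decoder takes arbitrary values, which is harmless because `F` has
  -- mass at most `ε` there.
  · set dec : B → I × A := Function.invFunOn enc Z with hdec
    refine Sim.of_map dec fun x => ?_
    have hq0 : ∀ q, (∑ b, if dec b = q then (if b ∈ enc '' Z then F x b else 0) else 0) =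
        mixLaw (w x) P q := by
      intro q
      by_cases hq : q ∈ Z
      · have hdq : dec (enc q) = q := hinj.leftInvOn_invFunOn hq
        rw [Finset.sum_eq_single (enc q)]
        · simp [hdq, henc x q hq, Set.mem_image_of_mem enc hq]
        · intro b _ hb
          split_ifs with h1 h2
          · exfalso
            obtain ⟨q', hq', rfl⟩ := h2
            rw [hdec, hinj.leftInvOn_invFunOn hq'] at h1
            exact hb (by rw [h1])
          · rfl
          · rfl
        · simp
      · rw [hmixZ x q hq]
        refine Finset.sum_eq_zero fun b _ => ?_
        split_ifs with h1 h2
        · exfalso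
          obtain ⟨q', hq', rfl⟩ := h2
          rw [hdec, hinj.leftInvOn_invFunOn hq'] at h1
          exact hq (h1 ▸ hq')
        · rfl
        · rfl
    unfold l1
    simp_rw [← hq0, ← Finset.sum_sub_distrib]
    calc ∑ q, |∑ b, ((if dec b = q then F x b else 0) -
            if dec b = q then (if b ∈ enc '' Z then F x b else 0) else 0)|
        = ∑ q, ∑ b, if dec b = q then (F x b - if b ∈ enc '' Z then F x b else 0) else 0 := by
          refine Finset.sum_congr rfl fun q _ => ?_
          rw [abs_of_nonneg]
          · refine Finset.sum_congr rfl fun b _ => ?_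
            split_ifs <;> simp
          · refine Finset.sum_nonneg fun b _ => ?_
            have := hpos x b
            split_ifs at this ⊢ <;> simp [hF]
      _ = ∑ b, (F x b - if b ∈ enc '' Z then F x b else 0) := by
          rw [Finset.sum_comm]
          simp
      _ ≤ ε := hdef x

end Simulation

end SBM

namespace SBM

/-! ### Laws of trees, forests and partially explored graphs -/

section Models

set_option linter.unusedSectionVars false

/-- Observations of a tree of depth `t` with `V` slots for children at every node: at depth `0` the
possibly revealed label, at depth `t + 1` one observation of depth `t` for every used slot. -/
def Obs (V : Type) : ℕ → Type
  | 0 => Option (Fin 2)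
  | t + 1 => V → Option (Obs V t)

noncomputable instance instFintypeObs (V : Type) [Fintype V] [DecidableEq V] :
    ∀ t, Fintype (Obs V t)
  | 0 => inferInstanceAs (Fintype (Option (Fin 2)))
  | t + 1 =>
    haveI := instFintypeObs V t
    inferInstanceAs (Fintype (V → Option (Obs V t)))

instance instNonemptyObs (V : Type) : ∀ t, Nonempty (Obs V t)
  | 0 => ⟨(none : Option (Fin 2))⟩
  | t + 1 => ⟨(fun _ => none : V → Option (Obs V t))⟩

/-- The label `x` is revealed with probability `q`. -/
def revealLaw (q : ℝ) (x : Fin 2) : Option (Fin 2) → ℝ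
  | none => 1 - q
  | some y => if y = x then q else 0

/-- Law of the content of a slot of a node with label `x`: the slot is unused with probability
`1 - r`, and holds a child with label `y` with probability `ρ y * k s(x, y)`. -/
def slotLaw (ρ : Fin 2 → ℝ) (k : Sym2 (Fin 2) → ℝ) (r : ℝ) {A : Type*} (P : Fin 2 → A → ℝ)
    (x : Fin 2) : Option A → ℝ
  | none => 1 - r
  | some o => ∑ y, ρ y * k s(x, y) * P y o

/-- The slots keep their names in `V`. When trees are compared with graphs these are the names of
vertices, so that both laws can be compared configuration by configuration. -/
def stepLaw (ρ : Fin 2 → ℝ) (k : Sym2 (Fin 2) → ℝ) (r : ℝ) {V A : Type*} [Fintype V]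
    (P : Fin 2 → A → ℝ) (x : Fin 2) (f : V → Option A) : ℝ :=
  ∏ j, slotLaw ρ k r P x (f j)

/-- Nodes of every generation have all of `V` as slots, whereas the exploration of a graph uses up
vertices. The discrepancy is the factor `deficit` below. -/
def treeLaw (ρ : Fin 2 → ℝ) (k : Sym2 (Fin 2) → ℝ) (r q : ℝ) (V : Type) [Fintype V] :
    ∀ t, Fin 2 → Obs V t → ℝ
  | 0 => revealLaw q
  | t + 1 => stepLaw (V := V) ρ k r (treeLaw ρ k r q V t)

/-- Independent observations from the experiment `P` at the vertices of `U`. -/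
def forestLaw {V A : Type*} [Fintype V] [DecidableEq V] (P : Fin 2 → A → ℝ) (U : Finset V)
    (X : V → Fin 2) (τ : V → Option A) : ℝ :=
  ∏ j, if j ∈ U then (τ j).elim 0 (P (X j)) else (τ j).elim 1 fun _ => 0

def bern (a : ℝ) (b : Bool) : ℝ := cond b a (1 - a)

/-- Product weight on the coordinates in `D`; the other coordinates are those of `e₀`. -/
def pinLaw {E : Type*} [Fintype E] [DecidableEq E] (D : Finset E) (w : E → Bool → ℝ)
    (e₀ e : E → Bool) : ℝ :=
  ∏ z, if z ∈ D then w z (e z) else if e z = e₀ z then 1 else 0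

variable {V : Type} [Fintype V] [DecidableEq V]

/-- The pairs of distinct elements of `W`. -/
def pairs (W : Finset V) : Finset (Sym2 V) := W.sym2.filter fun z => ¬ z.IsDiag

/-- The pairs of distinct elements of `W` that meet `U`. -/
def touching (W U : Finset V) : Finset (Sym2 V) := pairs W \ pairs (W \ U)

/-- The vertices of `W \ U` with a neighbour in `U`. -/
def nbrs (W U : Finset V) (e : Sym2 V → Bool) : Finset V :=
  (W \ U).filter fun j => ∃ i ∈ U, e s(i, j) = true

/-- The vertices of `W` at distance `t` from `U`. -/
def ring : ℕ → Finset V → Finset V → (Sym2 V → Bool) → Finset V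
  | 0, _, U, _ => U
  | t + 1, W, U, e => ring t (W \ U) (nbrs W U e) e

/-- Law of the graph on `W` and the revealed labels at distance `t` from `U`, given all labels. -/
def graphLaw (k : Sym2 (Fin 2) → ℝ) (q : ℝ) (t : ℕ) (W U : Finset V) (e₀ : Sym2 V → Bool)
    (X : V → Fin 2) (o : (Sym2 V → Bool) × (V → Option (Option (Fin 2)))) : ℝ :=
  pinLaw (pairs W) (fun z => bern (k (z.map X))) e₀ o.1 *
    forestLaw (revealLaw q) (ring t W U o.1) X o.2

/-- The same law, given the labels on `U` only. -/
def avgLaw (ρ : Fin 2 → ℝ) (k : Sym2 (Fin 2) → ℝ) (q : ℝ) (t : ℕ) (W U : Finset V)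
    (e₀ : Sym2 V → Bool) (x : V → Fin 2) (o : (Sym2 V → Bool) × (V → Option (Option (Fin 2)))) :
    ℝ :=
  ∑ X : V → Fin 2, (∏ j, ρ (X j)) * graphLaw k q t W U e₀ (U.piecewise x X) o

/-- Joint law of the pairs meeting `U` and of the labels in the graph. -/
def exploreLaw (ρ : Fin 2 → ℝ) (k : Sym2 (Fin 2) → ℝ) (W U : Finset V) (e₀ : Sym2 V → Bool)
    (x : V → Fin 2) (e : Sym2 V → Bool) (X : V → Fin 2) : ℝ :=
  (∏ j, ρ (X j)) * pinLaw (touching W U) (fun z => bern (k (z.map (U.piecewise x X)))) e₀ e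

/-- No edges inside `U`, and no vertex outside of `U` with two neighbours in `U`. -/
def Good (W U : Finset V) (e₀ e : Sym2 V → Bool) : Prop :=
  (∀ z ∉ touching W U, e z = e₀ z) ∧ (∀ i ∈ U, ∀ j ∈ U, i ≠ j → e s(i, j) = false) ∧
    ∀ j ∈ W \ U, ∀ i ∈ U, ∀ i' ∈ U, e s(i, j) = true → e s(i', j) = true → i = i'

open scoped Classical in
/-- The part of the joint law for independent trees that corresponds to `Good` configurations. -/
def treeExploreLaw (ρ : Fin 2 → ℝ) (k : Sym2 (Fin 2) → ℝ) (r : ℝ) (W U : Finset V)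
    (e₀ : Sym2 V → Bool) (x : V → Fin 2) (e : Sym2 V → Bool) (X : V → Fin 2) : ℝ :=
  if Good W U e₀ e then
    (∏ j, ρ (X j)) * ∏ i ∈ U, ∏ j,
      if j ∈ W \ U ∧ e s(i, j) = true then k s(x i, X j) else 1 - r
  else 0

/-- The trees at the vertices of `U` assembled from the subtrees at their neighbours. -/
def splitForest {A : Type*} (W U : Finset V) (e : Sym2 V → Bool) (σ : V → Option A) :
    V → Option (V → Option A) :=
  fun i => if i ∈ U then some fun j => if j ∈ W \ U ∧ e s(i, j) = true then σ j else none else none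

lemma sum_pi_prod {ι A : Type*} [Fintype ι] [DecidableEq ι] [Fintype A] (g : ι → A → ℝ) :
    ∑ f : ι → A, ∏ j, g j (f j) = ∏ j, ∑ a, g j a := by
  rw [Finset.prod_univ_sum]
  simp

lemma sum_forestLaw {A : Type*} [Fintype A] {P : Fin 2 → A → ℝ} (hP : ∀ x, ∑ a, P x a = 1)
    (U : Finset V) (X : V → Fin 2) : ∑ τ, forestLaw P U X τ = 1 := by
  unfold forestLaw
  rw [sum_pi_prod fun j (a : Option A) =>
    if j ∈ U then a.elim 0 (P (X j)) else a.elim 1 fun _ => 0]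
  refine Finset.prod_eq_one fun j _ => ?_
  split_ifs <;> simp [Fintype.sum_option, hP]

lemma forestLaw_nonneg {A : Type*} {P : Fin 2 → A → ℝ} (hP : ∀ x a, 0 ≤ P x a)
    (U : Finset V) (X : V → Fin 2) (τ : V → Option A) : 0 ≤ forestLaw P U X τ := by
  refine Finset.prod_nonneg fun j _ => ?_
  split_ifs <;> cases τ j <;> simp [hP]

lemma forestLaw_ne_zero {A : Type*} {P : Fin 2 → A → ℝ} {U : Finset V} {X : V → Fin 2}
    {τ : V → Option A} (h : forestLaw P U X τ ≠ 0) (j : V) : τ j ≠ none ↔ j ∈ U := by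
  have := Finset.prod_ne_zero_iff.1 h j (Finset.mem_univ j)
  split_ifs at this with hj <;> cases hτ : τ j <;> simp_all

lemma forestLaw_congr {A : Type*} (P : Fin 2 → A → ℝ) {U : Finset V} {X X' : V → Fin 2}
    (h : ∀ j ∈ U, X j = X' j) (τ : V → Option A) : forestLaw P U X τ = forestLaw P U X' τ := by
  refine Finset.prod_congr rfl fun j _ => ?_
  split_ifs with hj
  · rw [h j hj]
  · rfl

lemma sum_revealLaw (q : ℝ) (x : Fin 2) : ∑ o, revealLaw q x o = 1 := by
  simp [Fintype.sum_option, revealLaw]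

lemma revealLaw_nonneg {q : ℝ} (h0 : 0 ≤ q) (h1 : q ≤ 1) (x : Fin 2) (o : Option (Fin 2)) :
    0 ≤ revealLaw q x o := by
  cases o with
  | none => exact sub_nonneg.2 h1
  | some y => simp only [revealLaw]; split_ifs <;> simp [h0]

lemma sum_pinLaw {E : Type*} [Fintype E] [DecidableEq E] (D : Finset E) (w : E → Bool → ℝ)
    (e₀ : E → Bool) : ∑ e, pinLaw D w e₀ e = ∏ z ∈ D, (w z true + w z false) := by
  unfold pinLaw
  rw [sum_pi_prod fun z b => if z ∈ D then w z b else if b = e₀ z then 1 else 0,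
    ← Finset.prod_subset (Finset.subset_univ D)]
  · exact Finset.prod_congr rfl fun z hz => by simp [hz]
  · intro z _ hz
    simp [hz]

lemma pinLaw_nonneg {E : Type*} [Fintype E] [DecidableEq E] (D : Finset E) {w : E → Bool → ℝ}
    (hw : ∀ z b, 0 ≤ w z b) (e₀ e : E → Bool) : 0 ≤ pinLaw D w e₀ e := by
  refine Finset.prod_nonneg fun j _ => ?_
  split_ifs <;> simp [hw]

lemma pinLaw_ne_zero {E : Type*} [Fintype E] [DecidableEq E] {D : Finset E} {w : E → Bool → ℝ}
    {e₀ e : E → Bool} (h : pinLaw D w e₀ e ≠ 0) {z : E} (hz : z ∉ D) : e z = e₀ z := by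
  have := Finset.prod_ne_zero_iff.1 h z (Finset.mem_univ z)
  simp_all

lemma pinLaw_congr {E : Type*} [Fintype E] [DecidableEq E] {D : Finset E} {w w' : E → Bool → ℝ}
    (h : ∀ z ∈ D, w z = w' z) (e₀ e : E → Bool) : pinLaw D w e₀ e = pinLaw D w' e₀ e := by
  refine Finset.prod_congr rfl fun z _ => ?_
  split_ifs with hz
  · rw [h z hz]
  all_goals rfl

/-- The coordinates can be sampled in two steps. -/
lemma sum_pinLaw_mul {E : Type*} [Fintype E] [DecidableEq E] {D D' : Finset E} (hD : D' ⊆ D)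
    (w : E → Bool → ℝ) (e₀ e : E → Bool) (F : (E → Bool) → ℝ) :
    ∑ e₁, pinLaw (D \ D') w e₀ e₁ * (pinLaw D' w e₁ e * F e₁) =
      pinLaw D w e₀ e * F (D'.piecewise e₀ e) := by
  rw [Finset.sum_eq_single (D'.piecewise e₀ e)]
  · rw [← mul_assoc]
    congr 1
    unfold pinLaw
    rw [← Finset.prod_mul_distrib]
    refine Finset.prod_congr rfl fun z _ => ?_
    by_cases h1 : z ∈ D'
    · simp [h1, hD h1]
    · by_cases h2 : z ∈ D <;> simp [h1, h2]
  · intro e₁ _ hne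
    by_contra h
    apply hne
    have h1 := left_ne_zero_of_mul h
    have h2 := left_ne_zero_of_mul (right_ne_zero_of_mul h)
    funext z
    by_cases hz : z ∈ D'
    · rw [Finset.piecewise_eq_of_mem _ _ _ hz]
      exact pinLaw_ne_zero h1 (by simp [hz])
    · rw [Finset.piecewise_eq_of_notMem _ _ _ hz]
      exact (pinLaw_ne_zero h2 hz).symm
  · simp

lemma mem_pairs {W : Finset V} {i j : V} : s(i, j) ∈ pairs W ↔ i ∈ W ∧ j ∈ W ∧ i ≠ j := by
  simp [pairs, and_assoc]

lemma pairs_subset {W W' : Finset V} (h : W ⊆ W') : pairs W ⊆ pairs W' :=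
  Finset.filter_subset_filter _ (Finset.sym2_mono h)

lemma map_congr_of_mem_pairs {W : Finset V} {X X' : V → Fin 2} (h : ∀ j ∈ W, X j = X' j)
    {z : Sym2 V} (hz : z ∈ pairs W) : z.map X = z.map X' := by
  induction z with
  | _ i j =>
    obtain ⟨hi, hj, -⟩ := mem_pairs.1 hz
    simp [h i hi, h j hj]

lemma nbrs_congr {W U : Finset V} {e e' : Sym2 V → Bool}
    (h : ∀ z ∉ pairs (W \ U), e z = e' z) : nbrs W U e = nbrs W U e' := by
  refine Finset.filter_congr fun j _ => ?_
  refine exists_congr fun i => and_congr_right fun hi => ?_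
  rw [h]
  simp [mem_pairs, hi]

lemma nbrs_subset (W U : Finset V) (e : Sym2 V → Bool) : nbrs W U e ⊆ W \ U :=
  Finset.filter_subset _ _

lemma ring_subset (t : ℕ) : ∀ {W U : Finset V} (e : Sym2 V → Bool), U ⊆ W → ring t W U e ⊆ W := by
  induction t with
  | zero => exact fun _ h => h
  | succ t ih => exact fun e _ => (ih e (nbrs_subset _ _ _)).trans Finset.sdiff_subset

lemma graphLaw_congr (k : Sym2 (Fin 2) → ℝ) (q : ℝ) (t : ℕ) {W U : Finset V} (hU : U ⊆ W)
    (e₀ : Sym2 V → Bool) {X X' : V → Fin 2} (h : ∀ j ∈ W, X j = X' j) :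
    graphLaw k q t W U e₀ X = graphLaw k q t W U e₀ X' := by
  funext o
  unfold graphLaw
  rw [forestLaw_congr _ fun j hj => h j (ring_subset t o.1 hU hj),
    pinLaw_congr fun z hz => by rw [map_congr_of_mem_pairs h hz]]

/-- The pairs that meet `U` are sampled first and then pinned. Since the set of neighbours of `U`
does not involve pairs inside `W \ U`, what remains is the same model on `W \ U`, explored from
these neighbours to depth `t`. -/
lemma graphLaw_succ (k : Sym2 (Fin 2) → ℝ) (q : ℝ) (t : ℕ) (W U : Finset V)
    (e₀ : Sym2 V → Bool) (X : V → Fin 2) (o : (Sym2 V → Bool) × (V → Option (Option (Fin 2)))) :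
    graphLaw k q (t + 1) W U e₀ X o =
      ∑ e₁, pinLaw (touching W U) (fun z => bern (k (z.map X))) e₀ e₁ *
        graphLaw k q t (W \ U) (nbrs W U e₁) e₁ X o := by
  unfold graphLaw
  unfold touching
  rw [sum_pinLaw_mul (pairs_subset Finset.sdiff_subset) _ e₀ o.1 fun e₁ =>
    forestLaw (revealLaw q) (ring t (W \ U) (nbrs W U e₁) o.1) X o.2]
  rw [nbrs_congr (e' := o.1) fun z hz => Finset.piecewise_eq_of_notMem _ _ _ hz]
  rfl

lemma avgLaw_succ (ρ : Fin 2 → ℝ) (k : Sym2 (Fin 2) → ℝ) (q : ℝ) (t : ℕ) (W U : Finset V)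
    (e₀ : Sym2 V → Bool) (x : V → Fin 2) (o : (Sym2 V → Bool) × (V → Option (Option (Fin 2)))) :
    avgLaw ρ k q (t + 1) W U e₀ x o =
      ∑ e, ∑ X, exploreLaw ρ k W U e₀ x e X * graphLaw k q t (W \ U) (nbrs W U e) e X o := by
  unfold avgLaw exploreLaw
  rw [Finset.sum_comm]
  refine Finset.sum_congr rfl fun X _ => ?_
  rw [graphLaw_succ, Finset.mul_sum]
  refine Finset.sum_congr rfl fun e _ => ?_
  rw [graphLaw_congr k q t (nbrs_subset W U e) e (X := U.piecewise x X) (X' := X), mul_assoc]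
  intro j hj
  exact Finset.piecewise_eq_of_notMem _ _ _ (Finset.mem_sdiff.1 hj).2

/-- Resampling the labels outside of `N`. -/
lemma sum_resample {ρ : Fin 2 → ℝ} (hρ : ∑ y, ρ y = 1) (N : Finset V) {g : (V → Fin 2) → ℝ}
    (hg : ∀ X X', (∀ j ∈ N, X j = X' j) → g X = g X') (S : (V → Fin 2) → ℝ) :
    ∑ X, (∏ j, ρ (X j)) * g X * S X =
      ∑ X, (∏ j, ρ (X j)) * g X * ∑ X', (∏ j, ρ (X' j)) * S (N.piecewise X X') := by
  have h1 : ∑ X : V → Fin 2, ∏ j, ρ (X j) = 1 := by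
    rw [sum_pi_prod fun _ => ρ]
    simp [hρ]
  have h2 : ∑ X, (∏ j, ρ (X j)) * g X * S X =
      ∑ q : (V → Fin 2) × (V → Fin 2),
        (∏ j, ρ (q.1 j)) * (∏ j, ρ (q.2 j)) * (g q.1 * S q.1) := by
    rw [Fintype.sum_prod_type]
    refine Finset.sum_congr rfl fun X _ => ?_
    simp only [mul_right_comm _ (∏ j, ρ (_ : Fin 2)) _]
    rw [← Finset.mul_sum, h1]
    ring
  have h3 : ∀ X X' : V → Fin 2, N.piecewise (N.piecewise X X') (N.piecewise X' X) = X := by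
    intro X X'
    funext j
    by_cases hj : j ∈ N <;> simp [hj]
  rw [h2]
  -- Two independent labellings exchange their coordinates outside of `N`; this preserves the
  -- product measure and does not affect `g`.
  let swap : ((V → Fin 2) × (V → Fin 2)) → (V → Fin 2) × (V → Fin 2) :=
    fun q => (N.piecewise q.1 q.2, N.piecewise q.2 q.1)
  have hswap : Function.Involutive swap := fun q => Prod.ext (h3 _ _) (h3 _ _)
  rw [← Equiv.sum_comp hswap.toPerm, Fintype.sum_prod_type]
  refine Finset.sum_congr rfl fun X _ => ?_
  rw [Finset.mul_sum]
  refine Finset.sum_congr rfl fun X' _ => ?_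
  have h4 : (∏ j, ρ (N.piecewise X X' j)) * ∏ j, ρ (N.piecewise X' X j) =
      (∏ j, ρ (X j)) * ∏ j, ρ (X' j) := by
    rw [← Finset.prod_mul_distrib, ← Finset.prod_mul_distrib]
    refine Finset.prod_congr rfl fun j _ => ?_
    by_cases hj : j ∈ N <;> simp [hj, mul_comm]
  simp only [Function.Involutive.coe_toPerm, swap]
  rw [h4, hg (N.piecewise X X') X fun j hj => Finset.piecewise_eq_of_mem _ _ _ hj]
  ring

/-- Apart from the prior, the tree weight depends only on the labels of the new neighbours. All
other labels can be resampled, and the continuation becomes an experiment parametrized by the labels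
of the new frontier alone, which is the form needed for the induction. -/
lemma sum_treeExploreLaw_mul {ρ : Fin 2 → ℝ} (hρ : ∑ y, ρ y = 1) (k : Sym2 (Fin 2) → ℝ)
    (r q : ℝ) (t : ℕ) (W U : Finset V) (e₀ : Sym2 V → Bool) (x : V → Fin 2) (e : Sym2 V → Bool)
    (o : (Sym2 V → Bool) × (V → Option (Option (Fin 2)))) :
    ∑ X, treeExploreLaw ρ k r W U e₀ x e X * graphLaw k q t (W \ U) (nbrs W U e) e X o =
      ∑ X, treeExploreLaw ρ k r W U e₀ x e X *
        avgLaw ρ k q t (W \ U) (nbrs W U e) e X o := by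
  by_cases h : Good W U e₀ e
  · simp only [treeExploreLaw, h, if_true]
    refine sum_resample hρ (nbrs W U e) (fun X X' hX => ?_) _
    refine Finset.prod_congr rfl fun i hi => Finset.prod_congr rfl fun j _ => ?_
    split_ifs with hj
    · rw [hX j (Finset.mem_filter.2 ⟨hj.1, i, hi, hj.2⟩)]
    · rfl
  · simp [treeExploreLaw, h]

/-- Both sides factor over the vertices `j`. A neighbour `j` has exactly one parent in a good
configuration: summing over its label gives the law of the used slot of this parent, and the other
members of `U` contribute `1 - r`. If `j` is not a neighbour, every factor is `1 - r` and its label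
sums out. -/
lemma forestLaw_splitForest {A : Type*} (ρ : Fin 2 → ℝ) (hρ : ∑ y, ρ y = 1)
    (k : Sym2 (Fin 2) → ℝ) (r : ℝ) (P : Fin 2 → A → ℝ) {W U : Finset V} {e₀ e : Sym2 V → Bool}
    (x : V → Fin 2) (he : Good W U e₀ e) {σ : V → Option A}
    (hσ : ∀ j, σ j ≠ none ↔ j ∈ nbrs W U e) :
    forestLaw (stepLaw ρ k r P) U x (splitForest W U e σ) =
      ∑ X, treeExploreLaw ρ k r W U e₀ x e X * forestLaw P (nbrs W U e) X σ := by
  have hL : forestLaw (stepLaw ρ k r P) U x (splitForest W U e σ) =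
      ∏ j, ∏ i ∈ U, slotLaw ρ k r P (x i)
        (if j ∈ W \ U ∧ e s(i, j) = true then σ j else none) := by
    rw [Finset.prod_comm]
    unfold forestLaw
    rw [← Finset.prod_subset (Finset.subset_univ U)]
    · exact Finset.prod_congr rfl fun i hi => by simp [hi, splitForest, stepLaw]
    · intro i _ hi
      simp [hi, splitForest]
  have hR : ∀ X, treeExploreLaw ρ k r W U e₀ x e X * forestLaw P (nbrs W U e) X σ =
      ∏ j, ρ (X j) * (∏ i ∈ U, if j ∈ W \ U ∧ e s(i, j) = true then k s(x i, X j) else 1 - r) *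
        (if j ∈ nbrs W U e then (σ j).elim 0 (P (X j)) else (σ j).elim 1 fun _ => 0) := by
    intro X
    simp only [treeExploreLaw, he, if_true, forestLaw]
    rw [Finset.prod_mul_distrib, Finset.prod_mul_distrib,
      Finset.prod_comm (s := U) (t := Finset.univ)]
  rw [hL, Finset.sum_congr rfl fun X _ => hR X, sum_pi_prod fun j y => ρ y *
    (∏ i ∈ U, if j ∈ W \ U ∧ e s(i, j) = true then k s(x i, y) else 1 - r) *
    (if j ∈ nbrs W U e then (σ j).elim 0 (P y) else (σ j).elim 1 fun _ => 0)]
  refine Finset.prod_congr rfl fun j _ => ?_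
  by_cases hj : j ∈ nbrs W U e
  · obtain ⟨hjW, i₀, hi₀, hij⟩ := Finset.mem_filter.1 hj
    obtain ⟨o, ho⟩ := Option.ne_none_iff_exists'.1 ((hσ j).2 hj)
    have hne : ∀ i ∈ U.erase i₀, ¬ (j ∈ W \ U ∧ e s(i, j) = true) := fun i hi h =>
      Finset.ne_of_mem_erase hi (he.2.2 j hjW i (Finset.mem_of_mem_erase hi) i₀ hi₀ h.2 hij)
    have key : ∀ F : V → ℝ, (∏ i ∈ U, if j ∈ W \ U ∧ e s(i, j) = true then F i else 1 - r) =
        F i₀ * ∏ i ∈ U.erase i₀, (1 - r) := by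
      intro F
      rw [← Finset.mul_prod_erase _ _ hi₀, if_pos ⟨hjW, hij⟩]
      congr 1
      exact Finset.prod_congr rfl fun i hi => if_neg (hne i hi)
    simp only [key, hj, if_true, ho, Option.elim_some, apply_ite (slotLaw ρ k r P _)]
    rw [show (∏ i ∈ U, if j ∈ W \ U ∧ e s(i, j) = true then slotLaw ρ k r P (x i) (some o)
        else slotLaw ρ k r P (x i) none) = _ from key _]
    simp only [slotLaw]
    rw [Finset.sum_mul]
    refine Finset.sum_congr rfl fun y _ => ?_
    ring
  · have hne : ∀ i ∈ U, ¬ (j ∈ W \ U ∧ e s(i, j) = true) := fun i hi h =>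
      hj (Finset.mem_filter.2 ⟨h.1, i, hi, h.2⟩)
    have ho : σ j = none := by
      by_contra h
      exact hj ((hσ j).1 h)
    have key : ∀ F : V → ℝ, (∏ i ∈ U, if j ∈ W \ U ∧ e s(i, j) = true then F i else 1 - r) =
        ∏ i ∈ U, (1 - r) := fun F => Finset.prod_congr rfl fun i hi => if_neg (hne i hi)
    simp only [key, hj, if_false, ho, Option.elim_none, mul_one, ← Finset.sum_mul, hρ, one_mul,
      ite_self, slotLaw]

/-- The used slots show which edges join `U` to `W \ U`, since `σ` is nonempty at neighbours. The
definition of `Good` determines all other coordinates of `e`, and every subtree is found in the slot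
of its parent. -/
lemma splitForest_injOn {A : Type*} (W U : Finset V) (e₀ : Sym2 V → Bool) :
    Set.InjOn (fun q : (Sym2 V → Bool) × (V → Option A) => splitForest W U q.1 q.2)
      {q | Good W U e₀ q.1 ∧ ∀ j, q.2 j ≠ none ↔ j ∈ nbrs W U q.1} := by
  rintro ⟨e, σ⟩ ⟨he, hσ⟩ ⟨e', σ'⟩ ⟨he', hσ'⟩ h
  dsimp only at he hσ he' hσ' h
  have h1 : ∀ i ∈ U, ∀ j, (if j ∈ W \ U ∧ e s(i, j) = true then σ j else none) =
      if j ∈ W \ U ∧ e' s(i, j) = true then σ' j else none := by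
    intro i hi j
    have := congrFun h i
    simp only [splitForest, hi, if_true, Option.some.injEq] at this
    exact congrFun this j
  have h2 : ∀ i ∈ U, ∀ j ∈ W \ U, e s(i, j) = true → e' s(i, j) = true ∧ σ' j = σ j := by
    intro i hi j hj hij
    have h3 := h1 i hi j
    rw [if_pos ⟨hj, hij⟩] at h3
    have h4 := (hσ j).2 (Finset.mem_filter.2 ⟨hj, i, hi, hij⟩)
    split_ifs at h3 with h5
    · exact ⟨h5.2, h3.symm⟩
    · exact absurd h3 h4
  have h2' : ∀ i ∈ U, ∀ j ∈ W \ U, e' s(i, j) = true → e s(i, j) = true := by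
    intro i hi j hj hij
    have h3 := h1 i hi j
    rw [if_pos (⟨hj, hij⟩ : j ∈ W \ U ∧ e' s(i, j) = true)] at h3
    have h4 := (hσ' j).2 (Finset.mem_filter.2 ⟨hj, i, hi, hij⟩)
    split_ifs at h3 with h5
    · exact h5.2
    · exact absurd h3.symm h4
  have h6 : ∀ i ∈ U, ∀ j ∈ W \ U, e s(i, j) = e' s(i, j) := fun i hi j hj =>
    Bool.eq_iff_iff.2 ⟨fun h => (h2 i hi j hj h).1, h2' i hi j hj⟩
  have hee : e = e' := by
    funext z
    by_cases hz : z ∈ touching W U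
    · induction z with
      | _ i j =>
        simp only [touching, Finset.mem_sdiff, mem_pairs] at hz
        obtain ⟨⟨hi, hj, hij⟩, hz⟩ := hz
        by_cases hiU : i ∈ U
        · by_cases hjU : j ∈ U
          · rw [he.2.1 i hiU j hjU hij, he'.2.1 i hiU j hjU hij]
          · exact h6 i hiU j (Finset.mem_sdiff.2 ⟨hj, hjU⟩)
        · by_cases hjU : j ∈ U
          · rw [Sym2.eq_swap]
            exact h6 j hjU i (Finset.mem_sdiff.2 ⟨hi, hiU⟩)
          · exact absurd ⟨⟨hi, hiU⟩, ⟨hj, hjU⟩, hij⟩ hz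
    · rw [he.1 z hz, he'.1 z hz]
  subst hee
  refine Prod.ext rfl (funext fun j => ?_)
  by_cases hj : j ∈ nbrs W U e
  · obtain ⟨hjW, i, hi, hij⟩ := Finset.mem_filter.1 hj
    exact (h2 i hi j hjW hij).2.symm
  · have h3 : σ j = none := by
      by_contra h
      exact hj ((hσ j).1 h)
    have h4 : σ' j = none := by
      by_contra h
      exact hj ((hσ' j).1 h)
    exact h3.trans h4.symm

end Models

end SBM

namespace SBM

/-! ### One generation: reduction of graph and forest to their exploration laws -/

section Exploration

set_option linter.unusedSectionVars false

/-- The label distribution `ρ` and the connection probabilities `k` give every vertex the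
connection probability `r`. -/
structure Balanced (ρ : Fin 2 → ℝ) (k : Sym2 (Fin 2) → ℝ) (r : ℝ) : Prop where
  nonneg : ∀ y, 0 ≤ ρ y
  sum : ∑ y, ρ y = 1
  k_nonneg : ∀ z, 0 ≤ k z
  k_le : ∀ z, k z ≤ 1
  mean : ∀ x, ∑ y, ρ y * k s(x, y) = r

lemma Balanced.r_nonneg {ρ : Fin 2 → ℝ} {k : Sym2 (Fin 2) → ℝ} {r : ℝ} (h : Balanced ρ k r) :
    0 ≤ r := by
  rw [← h.mean 0]
  exact Finset.sum_nonneg fun y _ => mul_nonneg (h.nonneg y) (h.k_nonneg _)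

lemma Balanced.r_le {ρ : Fin 2 → ℝ} {k : Sym2 (Fin 2) → ℝ} {r : ℝ} (h : Balanced ρ k r) :
    r ≤ 1 := by
  rw [← h.mean 0, ← h.sum]
  exact Finset.sum_le_sum fun y _ => mul_le_of_le_one_right (h.nonneg y) (h.k_le _)

lemma bern_nonneg {a : ℝ} (h0 : 0 ≤ a) (h1 : a ≤ 1) (b : Bool) : 0 ≤ bern a b := by
  cases b <;> simp [bern, h0, h1]

variable {ρ : Fin 2 → ℝ} {k : Sym2 (Fin 2) → ℝ} {r q : ℝ}
variable {V : Type} [Fintype V] [DecidableEq V]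

lemma sum_labels (hρ : ∑ y, ρ y = 1) : ∑ X : V → Fin 2, ∏ j, ρ (X j) = 1 := by
  rw [sum_pi_prod fun _ => ρ]
  simp [hρ]

lemma stepLaw_nonneg (h : Balanced ρ k r) {A : Type*} {P : Fin 2 → A → ℝ}
    (hP : ∀ x a, 0 ≤ P x a) (x : Fin 2) (f : V → Option A) : 0 ≤ stepLaw ρ k r P x f := by
  refine Finset.prod_nonneg fun j _ => ?_
  cases f j with
  | none => exact sub_nonneg.2 h.r_le
  | some o =>
    exact Finset.sum_nonneg fun y _ => mul_nonneg (mul_nonneg (h.nonneg y) (h.k_nonneg _)) (hP _ _)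

lemma sum_slotLaw (h : Balanced ρ k r) {A : Type*} [Fintype A] {P : Fin 2 → A → ℝ}
    (hP : ∀ x, ∑ a, P x a = 1) (x : Fin 2) : ∑ o, slotLaw ρ k r P x o = 1 := by
  simp only [Fintype.sum_option, slotLaw]
  rw [Finset.sum_comm]
  simp [← Finset.mul_sum, hP, h.mean]

lemma sum_stepLaw (h : Balanced ρ k r) {A : Type*} [Fintype A] {P : Fin 2 → A → ℝ}
    (hP : ∀ x, ∑ a, P x a = 1) (x : Fin 2) : ∑ f : V → Option A, stepLaw ρ k r P x f = 1 := by
  unfold stepLaw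
  rw [sum_pi_prod fun _ => slotLaw ρ k r P x]
  simp [sum_slotLaw h hP]

lemma treeLaw_nonneg (h : Balanced ρ k r) (h0 : 0 ≤ q) (h1 : q ≤ 1) (t : ℕ) :
    ∀ x o, 0 ≤ treeLaw ρ k r q V t x o := by
  induction t with
  | zero => exact revealLaw_nonneg h0 h1
  | succ t ih => exact stepLaw_nonneg h ih

lemma sum_treeLaw (h : Balanced ρ k r) (t : ℕ) : ∀ x, ∑ o, treeLaw ρ k r q V t x o = 1 := by
  induction t with
  | zero => exact sum_revealLaw q
  | succ t ih => exact sum_stepLaw h ih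

lemma graphLaw_nonneg (h : Balanced ρ k r) (h0 : 0 ≤ q) (h1 : q ≤ 1) (t : ℕ) (W U : Finset V)
    (e₀ : Sym2 V → Bool) (X : V → Fin 2) (o) : 0 ≤ graphLaw k q t W U e₀ X o :=
  mul_nonneg (pinLaw_nonneg _ (fun _ => bern_nonneg (h.k_nonneg _) (h.k_le _)) _ _)
    (forestLaw_nonneg (revealLaw_nonneg h0 h1) _ _ _)

lemma sum_graphLaw (t : ℕ) (W U : Finset V) (e₀ : Sym2 V → Bool) (X : V → Fin 2) :
    ∑ o, graphLaw k q t W U e₀ X o = 1 := by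
  unfold graphLaw
  rw [Fintype.sum_prod_type]
  simp only [← Finset.mul_sum, sum_forestLaw (sum_revealLaw q), mul_one]
  rw [sum_pinLaw]
  simp [bern]

lemma avgLaw_nonneg (h : Balanced ρ k r) (h0 : 0 ≤ q) (h1 : q ≤ 1) (t : ℕ) (W U : Finset V)
    (e₀ : Sym2 V → Bool) (x : V → Fin 2) (o) : 0 ≤ avgLaw ρ k q t W U e₀ x o :=
  Finset.sum_nonneg fun _ _ => mul_nonneg (Finset.prod_nonneg fun _ _ => h.nonneg _)
    (graphLaw_nonneg h h0 h1 _ _ _ _ _ _)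

lemma sum_avgLaw (hρ : ∑ y, ρ y = 1) (t : ℕ) (W U : Finset V) (e₀ : Sym2 V → Bool)
    (x : V → Fin 2) : ∑ o, avgLaw ρ k q t W U e₀ x o = 1 := by
  unfold avgLaw
  rw [Finset.sum_comm]
  simp only [← Finset.mul_sum, sum_graphLaw, mul_one, sum_labels hρ]

lemma exploreLaw_nonneg (h : Balanced ρ k r) (W U : Finset V) (e₀ : Sym2 V → Bool)
    (x : V → Fin 2) (e : Sym2 V → Bool) (X : V → Fin 2) : 0 ≤ exploreLaw ρ k W U e₀ x e X :=
  mul_nonneg (Finset.prod_nonneg fun _ _ => h.nonneg _)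
    (pinLaw_nonneg _ (fun _ => bern_nonneg (h.k_nonneg _) (h.k_le _)) _ _)

lemma sum_exploreLaw (hρ : ∑ y, ρ y = 1) (W U : Finset V) (e₀ : Sym2 V → Bool) (x : V → Fin 2) :
    ∑ e, ∑ X, exploreLaw ρ k W U e₀ x e X = 1 := by
  unfold exploreLaw
  rw [Finset.sum_comm]
  simp only [← Finset.mul_sum, sum_pinLaw]
  simp [bern, sum_labels hρ]

lemma treeExploreLaw_nonneg (h : Balanced ρ k r) (W U : Finset V) (e₀ : Sym2 V → Bool)
    (x : V → Fin 2) (e : Sym2 V → Bool) (X : V → Fin 2) :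
    0 ≤ treeExploreLaw ρ k r W U e₀ x e X := by
  unfold treeExploreLaw
  split_ifs
  · refine mul_nonneg (Finset.prod_nonneg fun _ _ => h.nonneg _)
      (Finset.prod_nonneg fun i _ => Finset.prod_nonneg fun j _ => ?_)
    split_ifs
    exacts [h.k_nonneg _, sub_nonneg.2 h.r_le]
  · exact le_rfl

/-- One generation of the comparison of graph and forest. -/
lemma sim_succ (h : Balanced ρ k r) (h0 : 0 ≤ q) (h1 : q ≤ 1) (t : ℕ) {W U : Finset V}
    {e₀ : Sym2 V → Bool} {η : ℝ}
    (hη : ∀ x, ∑ e, ∑ X, |exploreLaw ρ k W U e₀ x e X - treeExploreLaw ρ k r W U e₀ x e X| ≤ η)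
    {δ : (Sym2 V → Bool) → ℝ} {ε : ℝ}
    (hε : ∀ x, ∑ e, ∑ X, treeExploreLaw ρ k r W U e₀ x e X * δ e ≤ ε) :
    ((∀ e, Sim (avgLaw ρ k q t (W \ U) (nbrs W U e) e)
        (forestLaw (treeLaw ρ k r q V t) (nbrs W U e)) (δ e)) →
      Sim (avgLaw ρ k q (t + 1) W U e₀) (forestLaw (treeLaw ρ k r q V (t + 1)) U) (2 * η + ε)) ∧
    ((∀ e, Sim (forestLaw (treeLaw ρ k r q V t) (nbrs W U e))
        (avgLaw ρ k q t (W \ U) (nbrs W U e) e) (δ e)) →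
      Sim (forestLaw (treeLaw ρ k r q V (t + 1)) U) (avgLaw ρ k q (t + 1) W U e₀)
        (2 * η + ε)) := by
  set w := treeExploreLaw ρ k r W U e₀ with hw
  -- The intermediate law: one generation is explored with the tree weights and then continued as a
  -- graph. One error `η` comes from replacing the graph weights, a second one from the mass missing
  -- in the encoding of forests.
  set R : (V → Fin 2) → (Sym2 V → Bool) × (V → Option (Option (Fin 2))) → ℝ := fun x o =>
    ∑ e, ∑ X, w x e X * avgLaw ρ k q t (W \ U) (nbrs W U e) e X o with hR
  have hw0 : ∀ x e X, 0 ≤ w x e X := treeExploreLaw_nonneg h W U e₀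
  have hl1 : ∀ x, l1 (avgLaw ρ k q (t + 1) W U e₀ x) (R x) ≤ η := by
    intro x
    refine le_trans ?_ (hη x)
    calc l1 (avgLaw ρ k q (t + 1) W U e₀ x) (R x)
        = ∑ o, |∑ e, ∑ X, (exploreLaw ρ k W U e₀ x e X - w x e X) *
            graphLaw k q t (W \ U) (nbrs W U e) e X o| := by
          refine Finset.sum_congr rfl fun o _ => ?_
          rw [avgLaw_succ, hR]
          simp only [hw, ← sum_treeExploreLaw_mul h.sum, ← Finset.sum_sub_distrib, ← sub_mul]
      _ ≤ ∑ o, ∑ e, ∑ X, |exploreLaw ρ k W U e₀ x e X - w x e X| *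
            graphLaw k q t (W \ U) (nbrs W U e) e X o := by
          refine Finset.sum_le_sum fun o _ => (Finset.abs_sum_le_sum_abs _ _).trans
            (Finset.sum_le_sum fun e _ => (Finset.abs_sum_le_sum_abs _ _).trans
            (Finset.sum_le_sum fun X _ => ?_))
          rw [abs_mul, abs_of_nonneg (graphLaw_nonneg h h0 h1 _ _ _ _ _ _)]
      _ = ∑ e, ∑ X, |exploreLaw ρ k W U e₀ x e X - w x e X| := by
          rw [Finset.sum_comm]
          refine Finset.sum_congr rfl fun e _ => ?_
          rw [Finset.sum_comm]
          simp only [← Finset.mul_sum, sum_graphLaw, mul_one]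
  have hmass : ∀ x, 1 - ∑ e, ∑ X, w x e X ≤ η := by
    intro x
    refine le_trans ?_ (hη x)
    rw [← sum_exploreLaw (k := k) h.sum W U e₀ x, ← Finset.sum_sub_distrib]
    simp only [← Finset.sum_sub_distrib]
    exact Finset.sum_le_sum fun e _ => Finset.sum_le_sum fun X _ => le_abs_self _
  have henc := Sim.mix_encode (w := w) hw0
    (P := fun e => forestLaw (treeLaw ρ k r q V t) (nbrs W U e))
    (fun e y a => forestLaw_nonneg (treeLaw_nonneg h h0 h1 t) _ _ _)
    (fun e y => sum_forestLaw (sum_treeLaw h t) _ _)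
    (F := forestLaw (treeLaw ρ k r q V (t + 1)) U)
    (fun x b => forestLaw_nonneg (treeLaw_nonneg h h0 h1 (t + 1)) _ _ _)
    (fun x => sum_forestLaw (sum_treeLaw h (t + 1)) _ _)
    (fun p => splitForest W U p.1 p.2)
    {p | Good W U e₀ p.1 ∧ ∀ j, p.2 j ≠ none ↔ j ∈ nbrs W U p.1}
    (splitForest_injOn W U e₀)
    (fun x e y a hne => by
      refine ⟨?_, forestLaw_ne_zero (right_ne_zero_of_mul hne)⟩
      by_contra hg
      exact left_ne_zero_of_mul hne (by simp [hw, treeExploreLaw, hg]))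
    (fun x p hp => forestLaw_splitForest ρ h.sum k r _ x hp.1 hp.2)
    hmass ⟨(fun _ => true, fun _ => none)⟩
  constructor
  · intro hS
    have s1 : Sim (avgLaw ρ k q (t + 1) W U e₀) R η := Sim.of_l1 hl1
    -- The explored edges can be read off the final graph: outside `pairs (W \ U)` the continuation
    -- leaves `e` unchanged, and inside a good `e` equals `e₀`.
    have s2 : Sim R (fun x => mixLaw (w x) fun e => avgLaw ρ k q t (W \ U) (nbrs W U e) e) 0 := by
      refine Sim.mix_of_snd (fun o => (pairs (W \ U)).piecewise e₀ o.1) fun x e y o hne => ?_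
      have hg : Good W U e₀ e := by
        by_contra hg
        exact left_ne_zero_of_mul hne (by simp [hw, treeExploreLaw, hg])
      obtain ⟨X, -, hX⟩ := Finset.exists_ne_zero_of_sum_ne_zero (right_ne_zero_of_mul hne)
      have hpin := left_ne_zero_of_mul (right_ne_zero_of_mul hX)
      funext z
      by_cases hz : z ∈ pairs (W \ U)
      · rw [Finset.piecewise_eq_of_mem _ _ _ hz, hg.1 z (by simp [touching, hz])]
      · rw [Finset.piecewise_eq_of_notMem _ _ _ hz, pinLaw_ne_zero hpin hz]
    exact (((s1.trans s2).trans (Sim.mix hw0 hS hε)).trans henc.1).mono (by linarith)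
  · intro hS
    have s1 : Sim R (avgLaw ρ k q (t + 1) W U e₀) η :=
      Sim.of_l1 fun x => by rw [l1_comm]; exact hl1 x
    have s2 : Sim (fun x => mixLaw (w x) fun e => avgLaw ρ k q t (W \ U) (nbrs W U e) e) R 0 :=
      Sim.mix_snd
    exact (((henc.2.trans (Sim.mix hw0 hS hε)).trans s2).trans s1).mono (by linarith)

/-- Law of the graph given the labels on `U`. -/
def edgeLaw (ρ : Fin 2 → ℝ) (k : Sym2 (Fin 2) → ℝ) (W U : Finset V) (e₀ : Sym2 V → Bool)
    (x : V → Fin 2) (e : Sym2 V → Bool) : ℝ :=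
  ∑ X : V → Fin 2, (∏ j, ρ (X j)) *
    pinLaw (pairs W) (fun z => bern (k (z.map (U.piecewise x X)))) e₀ e

lemma avgLaw_zero (W U : Finset V) (e₀ : Sym2 V → Bool) (x : V → Fin 2) (e : Sym2 V → Bool)
    (τ : V → Option (Option (Fin 2))) :
    avgLaw ρ k q 0 W U e₀ x (e, τ) =
      edgeLaw ρ k W U e₀ x e * forestLaw (revealLaw q) U x τ := by
  unfold avgLaw graphLaw edgeLaw
  rw [Finset.sum_mul]
  refine Finset.sum_congr rfl fun X _ => ?_
  rw [mul_assoc]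
  dsimp only [ring]
  rw [forestLaw_congr (X := U.piecewise x X) (X' := x) _ fun j hj =>
    Finset.piecewise_eq_of_mem _ _ _ hj]

lemma edgeLaw_congr (W U : Finset V) (e₀ : Sym2 V → Bool) {x x' : V → Fin 2}
    (h : ∀ j ∈ U, x j = x' j) : edgeLaw ρ k W U e₀ x = edgeLaw ρ k W U e₀ x' := by
  funext e
  unfold edgeLaw
  have : ∀ X : V → Fin 2, U.piecewise x X = U.piecewise x' X := fun X => by
    funext j
    by_cases hj : j ∈ U <;> simp [hj, h]
  simp only [this]

lemma sum_edgeLaw (hρ : ∑ y, ρ y = 1) (W U : Finset V) (e₀ : Sym2 V → Bool)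
    (x : V → Fin 2) : ∑ e, edgeLaw ρ k W U e₀ x e = 1 := by
  unfold edgeLaw
  rw [Finset.sum_comm]
  simp only [← Finset.mul_sum, sum_pinLaw]
  simp [bern, sum_labels hρ]

/-- At depth `0` the forest consists of the revealed labels. -/
lemma sim_zero (hρ : ∑ y, ρ y = 1) (W U : Finset V) (e₀ : Sym2 V → Bool) :
    Sim (avgLaw ρ k q 0 W U e₀) (forestLaw (treeLaw ρ k r q V 0) U) 0 := by
  refine Sim.of_map_eq (B := V → Option (Option (Fin 2))) Prod.snd fun x τ => ?_
  rw [Fintype.sum_prod_type]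
  simp only [avgLaw_zero, Finset.sum_ite_eq', Finset.mem_univ, if_true, ← Finset.sum_mul,
    sum_edgeLaw hρ, one_mul]
  rfl

/-- With `q = 1` the observation at depth `0` contains all labels on `U`, so a kernel can sample the
graph from its conditional law given these labels. This is the only place where full revelation is
needed. -/
lemma sim_zero_reverse (h : Balanced ρ k r) (W U : Finset V) (e₀ : Sym2 V → Bool) :
    Sim (forestLaw (treeLaw ρ k r 1 V 0) U) (avgLaw ρ k 1 0 W U e₀) 0 := by
  -- The default label `0` is only used outside of `U`, where `edgeLaw` ignores it, or on
  -- observations of probability zero.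
  let lab : (V → Option (Option (Fin 2))) → V → Fin 2 := fun τ j => ((τ j).getD none).getD 0
  change Sim (forestLaw (revealLaw 1) U) (avgLaw ρ k 1 0 W U e₀) 0
  refine ⟨fun τ o =>
    if o.2 = τ then edgeLaw ρ k W U e₀ (lab τ) o.1 else 0, ⟨fun τ o => ?_, fun τ => ?_⟩,
    fun x => ?_⟩
  · dsimp only
    split_ifs
    · exact Finset.sum_nonneg fun X _ => mul_nonneg (Finset.prod_nonneg fun _ _ => h.nonneg _)
        (pinLaw_nonneg _ (fun _ => bern_nonneg (h.k_nonneg _) (h.k_le _)) _ _)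
    · exact le_rfl
  · rw [Fintype.sum_prod_type]
    simp [sum_edgeLaw h.sum]
  · suffices hpush : push (forestLaw (revealLaw 1) U x) (fun τ o =>
        if o.2 = τ then edgeLaw ρ k W U e₀ (lab τ) o.1 else 0) = avgLaw ρ k 1 0 W U e₀ x by
      rw [hpush, l1_self]
    funext ⟨e, τ⟩
    rw [avgLaw_zero]
    simp only [push, mul_ite, mul_zero, Finset.sum_ite_eq, Finset.mem_univ, if_true]
    by_cases h0 : forestLaw (revealLaw 1) U x τ = 0
    · simp [h0]
    · rw [mul_comm, edgeLaw_congr W U e₀ (x' := x)]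
      intro j hj
      have := Finset.prod_ne_zero_iff.1 h0 j (Finset.mem_univ j)
      rw [if_pos hj] at this
      rcases hτ : τ j with _ | _ | y
      · simp [hτ] at this
      · simp [hτ, revealLaw] at this
      · simp only [hτ, Option.elim_some, revealLaw, ne_eq, ite_eq_right_iff, one_ne_zero,
          imp_false, not_not] at this
        simp [lab, hτ, this]

end Exploration

end SBM

namespace SBM

/-! ### Second-order estimates for products and total masses -/

section Estimates

set_option linter.unusedSectionVars false

lemma abs_prod_one_add_sub_le {ι : Type*} (s : Finset ι) (f : ι → ℝ) :
    |∏ i ∈ s, (1 + f i) - 1| ≤ Real.exp (∑ i ∈ s, |f i|) - 1 := by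
  simpa using Finset.norm_prod_one_add_sub_one_le s f

/-- The monomials of degree at least two in the product are dominated by those of the exponential
series. -/
lemma abs_prod_one_add_sub_sum_le {ι : Type*} (s : Finset ι) (f : ι → ℝ) :
    |∏ i ∈ s, (1 + f i) - 1 - ∑ i ∈ s, f i| ≤
      Real.exp (∑ i ∈ s, |f i|) - 1 - ∑ i ∈ s, |f i| := by
  classical
  induction s using Finset.induction_on with
  | empty => simp
  | insert a s ha ih =>
    rw [Finset.prod_insert ha, Finset.sum_insert ha, Finset.sum_insert ha, Real.exp_add]
    have h1 := abs_prod_one_add_sub_le s f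
    set p := ∏ i ∈ s, (1 + f i)
    set S := ∑ i ∈ s, |f i|
    have h2 : (1 + f a) * p - 1 - (f a + ∑ i ∈ s, f i) =
        (p - 1 - ∑ i ∈ s, f i) + f a * (p - 1) := by ring
    rw [h2]
    have h3 := abs_add_le (p - 1 - ∑ i ∈ s, f i) (f a * (p - 1))
    rw [abs_mul] at h3
    have h4 : |f a| * |p - 1| ≤ |f a| * (Real.exp S - 1) :=
      mul_le_mul_of_nonneg_left h1 (abs_nonneg _)
    have h5 : (|f a| + 1) * Real.exp S ≤ Real.exp |f a| * Real.exp S :=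
      mul_le_mul_of_nonneg_right (Real.add_one_le_exp _) (Real.exp_pos _).le
    linarith

lemma abs_mul_sub_one_le {x y u v : ℝ} (hx : |x - 1| ≤ Real.exp u - 1)
    (hy : |y - 1| ≤ Real.exp v - 1) : |x * y - 1| ≤ Real.exp (u + v) - 1 := by
  have h : x * y - 1 = (x - 1) * (y - 1) + (x - 1) + (y - 1) := by ring
  have h1 := abs_add_le ((x - 1) * (y - 1) + (x - 1)) (y - 1)
  have h2 := abs_add_le ((x - 1) * (y - 1)) (x - 1)
  rw [abs_mul] at h2
  have h3 := mul_le_mul hx hy (abs_nonneg _) ((abs_nonneg _).trans hx)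
  rw [h, Real.exp_add]
  linarith

/-- The chi-square bound for the `ℓ¹` distance, with `c` in the role of `b ^ 2 / a`. Since `(a - b)
^ 2 = a * (a - 2 * b + c)`, this is the Cauchy–Schwarz inequality. It only requires the total masses
of `a`, `b` and `c`, which are explicit for product weights. -/
lemma sum_abs_sub_le_sqrt {ι : Type*} (s : Finset ι) {a b c : ι → ℝ} (ha : ∀ i, 0 ≤ a i)
    (hc : ∀ i, 0 ≤ c i) (hb : ∀ i, b i ^ 2 = a i * c i) :
    ∑ i ∈ s, |a i - b i| ≤ √(∑ i ∈ s, a i) * √(∑ i ∈ s, (a i - 2 * b i + c i)) := by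
  have hpos : ∀ i, 0 ≤ a i - 2 * b i + c i := by
    intro i
    have h1 : (2 * b i) ^ 2 ≤ (a i + c i) ^ 2 := by nlinarith [sq_nonneg (a i - c i), hb i]
    have := abs_le_of_sq_le_sq h1 (add_nonneg (ha i) (hc i))
    linarith [le_abs_self (2 * b i)]
  refine le_trans (Finset.sum_le_sum fun i _ => ?_)
    (Real.sum_sqrt_mul_sqrt_le s ha hpos)
  rw [← Real.sqrt_mul (ha i), ← Real.sqrt_sq_eq_abs]
  refine Real.sqrt_le_sqrt (le_of_eq ?_)
  linear_combination hb i

variable {V : Type} [Fintype V] [DecidableEq V]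

lemma prod_touching {W U : Finset V} (hU : U ⊆ W) (f : Sym2 V → ℝ) :
    ∏ z ∈ touching W U, f z = (∏ z ∈ pairs U, f z) * ∏ i ∈ U, ∏ j ∈ W \ U, f s(i, j) := by
  have hinj : Set.InjOn (fun p : V × V => s(p.1, p.2)) (U ×ˢ (W \ U) : Finset (V × V)) := by
    rintro ⟨i, j⟩ h ⟨i', j'⟩ h' heq
    simp only [Finset.coe_product, Set.mem_prod, Finset.mem_coe, Finset.mem_sdiff] at h h'
    rcases Sym2.eq_iff.1 heq with h1 | h1
    · exact Prod.ext h1.1 h1.2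
    · have h2 : i = j' := h1.1
      subst h2
      exact absurd h.1 h'.2.2
  have hdisj : Disjoint (pairs U) ((U ×ˢ (W \ U)).image fun p : V × V => s(p.1, p.2)) := by
    refine Finset.disjoint_left.2 fun z hz hz' => ?_
    obtain ⟨⟨i, j⟩, hij, rfl⟩ := Finset.mem_image.1 hz'
    exact (Finset.mem_sdiff.1 (Finset.mem_product.1 hij).2).2 (mem_pairs.1 hz).2.1
  have hunion : touching W U =
      pairs U ∪ (U ×ˢ (W \ U)).image fun p : V × V => s(p.1, p.2) := by
    ext z
    induction z with
    | _ i j =>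
      simp only [touching, Finset.mem_sdiff, mem_pairs, Finset.mem_union, Finset.mem_image,
        Finset.mem_product, Prod.exists]
      constructor
      · rintro ⟨⟨hi, hj, hij⟩, h⟩
        by_cases hiU : i ∈ U
        · by_cases hjU : j ∈ U
          · exact Or.inl ⟨hiU, hjU, hij⟩
          · exact Or.inr ⟨i, j, ⟨hiU, hj, hjU⟩, rfl⟩
        · by_cases hjU : j ∈ U
          · exact Or.inr ⟨j, i, ⟨hjU, hi, hiU⟩, Sym2.eq_swap⟩
          · exact absurd ⟨⟨hi, hiU⟩, ⟨hj, hjU⟩, hij⟩ h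
      · rintro (⟨hi, hj, hij⟩ | ⟨a, b, ⟨ha, hb, hbU⟩, hab⟩)
        · exact ⟨⟨hU hi, hU hj, hij⟩, fun h => h.1.2 hi⟩
        · have hne : a ≠ b := fun h => hbU (h ▸ ha)
          rcases Sym2.eq_iff.1 hab with ⟨rfl, rfl⟩ | ⟨rfl, rfl⟩
          · exact ⟨⟨hU ha, hb, hne⟩, fun h => h.1.2 ha⟩
          · exact ⟨⟨hb, hU ha, hne.symm⟩, fun h => h.2.1.2 ha⟩
  rw [hunion, Finset.prod_union hdisj, Finset.prod_image hinj, Finset.prod_product]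

lemma card_pairs_le (U : Finset V) : (pairs U).card ≤ U.card ^ 2 := by
  refine (Finset.card_filter_le _ _).trans ?_
  rw [Finset.card_sym2, Nat.choose_two_right, Nat.add_sub_cancel]
  refine Nat.div_le_of_le_mul ?_
  nlinarith [Nat.le_mul_self U.card]

lemma sum_labels_prod {ρ : Fin 2 → ℝ} (hρ : ∑ y, ρ y = 1) (s : Finset V) (g : V → Fin 2 → ℝ) :
    ∑ X : V → Fin 2, (∏ j, ρ (X j)) * ∏ j ∈ s, g j (X j) = ∏ j ∈ s, ∑ y, ρ y * g j y := by
  have h1 : ∀ X : V → Fin 2, (∏ j, ρ (X j)) * ∏ j ∈ s, g j (X j) =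
      ∏ j, ρ (X j) * (if j ∈ s then g j (X j) else 1) := by
    intro X
    rw [Finset.prod_mul_distrib, Fintype.prod_ite_mem]
  simp only [h1]
  rw [sum_pi_prod fun j y => ρ y * if j ∈ s then g j y else 1,
    ← Finset.prod_subset (Finset.subset_univ s)]
  · exact Finset.prod_congr rfl fun j hj => by simp [hj]
  · intro j _ hj
    simp [hj, hρ]

variable {ρ : Fin 2 → ℝ} {k : Sym2 (Fin 2) → ℝ} {r : ℝ}

/-- Total mass of a product weight on the pairs that meet `U`. -/
lemma sum_weights (hρ : ∑ y, ρ y = 1) {W U : Finset V} (hU : U ⊆ W) (e₀ : Sym2 V → Bool)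
    (x : V → Fin 2) (w : Sym2 V → ℝ → Bool → ℝ) (h hin : ℝ → ℝ)
    (hw : ∀ z ∉ pairs U, ∀ a, w z a true + w z a false = h a)
    (hwin : ∀ z ∈ pairs U, ∀ a, w z a true + w z a false = hin a) :
    ∑ e, ∑ X : V → Fin 2, (∏ j, ρ (X j)) *
        pinLaw (touching W U) (fun z => w z (k (z.map (U.piecewise x X)))) e₀ e =
      (∏ z ∈ pairs U, hin (k (z.map x))) *
        ∏ _j ∈ W \ U, ∑ y, ρ y * ∏ i ∈ U, h (k s(x i, y)) := by
  rw [Finset.sum_comm, ← sum_labels_prod hρ (W \ U) fun j y => ∏ i ∈ U, h (k s(x i, y)),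
    Finset.mul_sum]
  refine Finset.sum_congr rfl fun X _ => ?_
  rw [← Finset.mul_sum, sum_pinLaw, prod_touching hU, mul_left_comm]
  have h1 : ∏ z ∈ pairs U, (w z (k (z.map (U.piecewise x X))) true +
      w z (k (z.map (U.piecewise x X))) false) = ∏ z ∈ pairs U, hin (k (z.map x)) := by
    refine Finset.prod_congr rfl fun z hz => ?_
    rw [hwin z hz, map_congr_of_mem_pairs (X' := x)
      (fun _ hj => Finset.piecewise_eq_of_mem _ _ _ hj) hz]
  have h2 : ∏ i ∈ U, ∏ j ∈ W \ U, (w s(i, j) (k (s(i, j).map (U.piecewise x X))) true +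
      w s(i, j) (k (s(i, j).map (U.piecewise x X))) false) =
      ∏ j ∈ W \ U, ∏ i ∈ U, h (k s(x i, X j)) := by
    rw [Finset.prod_comm]
    refine Finset.prod_congr rfl fun j hj => Finset.prod_congr rfl fun i hi => ?_
    have hjU := (Finset.mem_sdiff.1 hj).2
    rw [hw _ fun hz => hjU (mem_pairs.1 hz).2.1]
    simp [hi, hjU]
  rw [h1, h2]

/-- To first order `g (k z)` is `1 + α * (k z - r)`, and the average of the linear term over the
label `y` vanishes because `k` is balanced. So a vertex outside of `U` changes the mass only to
second order, and in a sparse graph the sum over all vertices is still small. -/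
lemma abs_sum_prod_sub_one_le (h : Balanced ρ k r) (U : Finset V) (x : V → Fin 2) (g : ℝ → ℝ)
    (α m ζ : ℝ) {K : ℝ} (hK : (U.card : ℝ) ≤ K) (hKm : K * m ≤ 1) (hm : ∀ z, |g (k z) - 1| ≤ m)
    (hζ : ∀ z, |g (k z) - 1 - α * (k z - r)| ≤ ζ) :
    |∑ y, ρ y * ∏ i ∈ U, g (k s(x i, y)) - 1| ≤ (K * m) ^ 2 + K * ζ := by
  have hm0 : 0 ≤ m := (abs_nonneg _).trans (hm s(0, 0))
  have hζ0 : 0 ≤ ζ := (abs_nonneg _).trans (hζ s(0, 0))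
  have hlin : ∑ y, ρ y * ∑ i ∈ U, α * (k s(x i, y) - r) = 0 := by
    simp only [Finset.mul_sum]
    rw [Finset.sum_comm]
    refine Finset.sum_eq_zero fun i _ => ?_
    have : ∀ y, ρ y * (α * (k s(x i, y) - r)) = α * (ρ y * k s(x i, y)) - α * r * ρ y :=
      fun y => by ring
    simp only [this, Finset.sum_sub_distrib, ← Finset.mul_sum, h.mean, h.sum]
    ring
  have hsplit : ∑ y, ρ y * ∏ i ∈ U, g (k s(x i, y)) - 1 =
      ∑ y, ρ y * (∏ i ∈ U, g (k s(x i, y)) - 1 - ∑ i ∈ U, α * (k s(x i, y) - r)) := by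
    have : ∀ y, ρ y * (∏ i ∈ U, g (k s(x i, y)) - 1 - ∑ i ∈ U, α * (k s(x i, y) - r)) =
        ρ y * ∏ i ∈ U, g (k s(x i, y)) - ρ y - ρ y * ∑ i ∈ U, α * (k s(x i, y) - r) :=
      fun y => by ring
    rw [Finset.sum_congr rfl fun y _ => this y, Finset.sum_sub_distrib, Finset.sum_sub_distrib,
      hlin, h.sum, sub_zero]
  have hbound : ∀ y, |∏ i ∈ U, g (k s(x i, y)) - 1 - ∑ i ∈ U, α * (k s(x i, y) - r)| ≤
      (K * m) ^ 2 + K * ζ := by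
    intro y
    have h1 := abs_prod_one_add_sub_sum_le U fun i => g (k s(x i, y)) - 1
    simp only [add_sub_cancel] at h1
    set S := ∑ i ∈ U, |g (k s(x i, y)) - 1| with hS
    have hS0 : 0 ≤ S := Finset.sum_nonneg fun _ _ => abs_nonneg _
    have hS1 : S ≤ K * m := by
      refine (Finset.sum_le_card_nsmul U _ m fun i _ => hm _).trans ?_
      rw [nsmul_eq_mul]
      exact mul_le_mul_of_nonneg_right hK hm0
    -- This requires `S ≤ 1`, which is the purpose of `hKm`.
    have h2 : Real.exp S - 1 - S ≤ S ^ 2 :=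
      (le_abs_self _).trans (Real.abs_exp_sub_one_sub_id_le (by rw [abs_of_nonneg hS0]; linarith))
    have h3 : S ^ 2 ≤ (K * m) ^ 2 := pow_le_pow_left₀ hS0 hS1 2
    have h4 : |∑ i ∈ U, (g (k s(x i, y)) - 1) - ∑ i ∈ U, α * (k s(x i, y) - r)| ≤ K * ζ := by
      rw [← Finset.sum_sub_distrib]
      refine (Finset.abs_sum_le_sum_abs _ _).trans
        ((Finset.sum_le_card_nsmul U _ ζ fun i _ => hζ _).trans ?_)
      rw [nsmul_eq_mul]
      exact mul_le_mul_of_nonneg_right hK hζ0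
    have h5 := abs_sub_le (∏ i ∈ U, g (k s(x i, y)) - 1) (∑ i ∈ U, (g (k s(x i, y)) - 1))
      (∑ i ∈ U, α * (k s(x i, y) - r))
    linarith
  rw [hsplit]
  calc
    _ ≤ ∑ y, ρ y * ((K * m) ^ 2 + K * ζ) := by
        refine (Finset.abs_sum_le_sum_abs _ _).trans (Finset.sum_le_sum fun y _ => ?_)
        rw [abs_mul, abs_of_nonneg (h.nonneg y)]
        exact mul_le_mul_of_nonneg_left (hbound y) (h.nonneg y)
    _ = _ := by rw [← Finset.sum_mul, h.sum, one_mul]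

lemma abs_mass_sub_one_le (h : Balanced ρ k r) {W U : Finset V} (x : V → Fin 2) (g gin : ℝ → ℝ)
    (α m ζ : ℝ) {K c : ℝ} (hK : (U.card : ℝ) ≤ K) (hKm : K * m ≤ 1)
    (hm : ∀ z, |g (k z) - 1| ≤ m) (hζ : ∀ z, |g (k z) - 1 - α * (k z - r)| ≤ ζ)
    (hin : ∀ z, |gin (k z) - 1| ≤ c) :
    |(∏ z ∈ pairs U, gin (k (z.map x))) *
        ∏ _j ∈ W \ U, ∑ y, ρ y * ∏ i ∈ U, g (k s(x i, y)) - 1| ≤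
      Real.exp (K ^ 2 * c + Fintype.card V * ((K * m) ^ 2 + K * ζ)) - 1 := by
  have hK0 : 0 ≤ K := (Nat.cast_nonneg _).trans hK
  have hm0 : 0 ≤ m := (abs_nonneg _).trans (hm s(0, 0))
  have hζ0 : 0 ≤ ζ := (abs_nonneg _).trans (hζ s(0, 0))
  have hc0 : 0 ≤ c := (abs_nonneg _).trans (hin s(0, 0))
  refine abs_mul_sub_one_le ?_ ?_
  · have h1 := abs_prod_one_add_sub_le (pairs U) fun z => gin (k (z.map x)) - 1
    simp only [add_sub_cancel] at h1
    refine h1.trans (sub_le_sub_right (Real.exp_le_exp.2 ?_) _)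
    refine (Finset.sum_le_card_nsmul _ _ c fun _ _ => hin _).trans ?_
    rw [nsmul_eq_mul]
    refine mul_le_mul_of_nonneg_right ?_ hc0
    calc ((pairs U).card : ℝ) ≤ (U.card : ℝ) ^ 2 := by exact_mod_cast card_pairs_le U
      _ ≤ K ^ 2 := pow_le_pow_left₀ (Nat.cast_nonneg _) hK 2
  · have h1 := abs_prod_one_add_sub_le (W \ U) fun j => ∑ y, ρ y * ∏ i ∈ U, g (k s(x i, y)) - 1
    simp only [add_sub_cancel] at h1
    refine h1.trans (sub_le_sub_right (Real.exp_le_exp.2 ?_) _)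
    refine (Finset.sum_le_card_nsmul _ _ _ fun _ _ =>
      abs_sum_prod_sub_one_le h U x g α m ζ hK hKm hm hζ).trans ?_
    rw [nsmul_eq_mul]
    refine mul_le_mul_of_nonneg_right ?_ (by positivity)
    exact_mod_cast Finset.card_le_univ _

end Estimates

end SBM

namespace SBM

/-! ### The exploration of the graph against that of independent trees -/

section Exploration

set_option linter.unusedSectionVars false

variable {V : Type} [Fintype V] [DecidableEq V]
variable {ρ : Fin 2 → ℝ} {k : Sym2 (Fin 2) → ℝ} {r : ℝ}

open scoped Classical in
/-- Edge weights of the exploration of independent trees. -/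
def treeWeight (U : Finset V) (r : ℝ) (z : Sym2 V) (a : ℝ) (b : Bool) : ℝ :=
  cond b a (if z ∈ pairs U then 1 else 1 - r)

open scoped Classical in
/-- The weights `treeWeight ^ 2 / bern`. -/
def ratioWeight (U : Finset V) (r : ℝ) (z : Sym2 V) (a : ℝ) (b : Bool) : ℝ :=
  cond b a ((if z ∈ pairs U then 1 else 1 - r) ^ 2 / (1 - a))

/-- In the trees, the slots named after vertices outside of `W \ U` have to be unused; this is the
probability of that event. -/
def deficit (U W : Finset V) (r : ℝ) : ℝ := ∏ _i ∈ U, ∏ _j ∈ (W \ U)ᶜ, (1 - r)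

/-- The right-hand side is a product weight that makes sense for all `e`, so its total mass can be
computed exactly. The restriction to good configurations is dealt with separately. -/
lemma treeExploreLaw_of_good {W U : Finset V} (hU : U ⊆ W) {e₀ e : Sym2 V → Bool}
    (x X : V → Fin 2) (he : Good W U e₀ e) :
    treeExploreLaw ρ k r W U e₀ x e X = deficit U W r * ((∏ j, ρ (X j)) *
      pinLaw (touching W U) (fun z => treeWeight U r z (k (z.map (U.piecewise x X)))) e₀ e) := by
  have h1 : pinLaw (touching W U) (fun z => treeWeight U r z (k (z.map (U.piecewise x X)))) e₀ e =
      ∏ i ∈ U, ∏ j ∈ W \ U, if e s(i, j) = true then k s(x i, X j) else 1 - r := by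
    unfold pinLaw
    rw [← Finset.prod_subset (Finset.subset_univ (touching W U))
      (fun z _ hz => by simp [hz, he.1 z hz]),
      Finset.prod_congr rfl fun z hz => if_pos hz, prod_touching hU]
    rw [Finset.prod_eq_one, one_mul]
    · refine Finset.prod_congr rfl fun i hi => Finset.prod_congr rfl fun j hj => ?_
      have hjU := (Finset.mem_sdiff.1 hj).2
      have hp : s(i, j) ∉ pairs U := fun h => hjU (mem_pairs.1 h).2.1
      cases hij : e s(i, j) <;> simp [treeWeight, hp, hi, hjU]
    · intro z hz
      induction z with
      | _ i j =>
        obtain ⟨hi, hj, hne⟩ := mem_pairs.1 hz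
        simp [treeWeight, he.2.1 i hi j hj hne, hz]
  rw [h1, treeExploreLaw, if_pos he, mul_left_comm, deficit, ← Finset.prod_mul_distrib]
  congr 1
  refine Finset.prod_congr rfl fun i _ => ?_
  rw [← Finset.prod_compl_mul_prod (W \ U)]
  congr 1
  · refine Finset.prod_congr rfl fun j hj => ?_
    rw [if_neg fun h => (Finset.mem_compl.1 hj) h.1]
  · refine Finset.prod_congr rfl fun j hj => ?_
    simp only [hj, true_and]

lemma abs_deficit_sub_one_le {W U : Finset V} {K c : ℝ} (hK : (U.card : ℝ) ≤ K)
    (hW : (Wᶜ.card : ℝ) ≤ K) (hr0 : 0 ≤ r) (hr : r ≤ c) :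
    |deficit U W r - 1| ≤ Real.exp (2 * K ^ 2 * c) - 1 := by
  have hK0 : 0 ≤ K := (Nat.cast_nonneg _).trans hK
  have hc0 : 0 ≤ c := hr0.trans hr
  unfold deficit
  rw [← Finset.prod_product']
  have h1 := abs_prod_one_add_sub_le (U ×ˢ (W \ U)ᶜ) fun _ : V × V => -r
  simp only [← sub_eq_add_neg] at h1
  refine h1.trans (sub_le_sub_right (Real.exp_le_exp.2 ?_) _)
  rw [Finset.sum_const, nsmul_eq_mul, abs_neg, abs_of_nonneg hr0, Finset.card_product]
  have h2 : (((W \ U)ᶜ).card : ℝ) ≤ 2 * K := by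
    have : (W \ U)ᶜ = Wᶜ ∪ U := by
      ext j
      simp only [Finset.mem_compl, Finset.mem_sdiff, Finset.mem_union]
      tauto
    rw [this]
    have h3 : ((Wᶜ ∪ U).card : ℝ) ≤ Wᶜ.card + U.card := by exact_mod_cast Finset.card_union_le _ _
    linarith
  push_cast
  calc (U.card : ℝ) * ((W \ U)ᶜ).card * r ≤ K * (2 * K) * c := by gcongr
    _ = _ := by ring

lemma sum_pinLaw_forall_le (h : Balanced ρ k r) {W U : Finset V} (e₀ : Sym2 V → Bool)
    (x : V → Fin 2) {c : ℝ} (hc : ∀ z, k z ≤ c) (Z : Finset (Sym2 V)) (hZ : Z ⊆ touching W U) :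
    ∑ e, ∑ X, exploreLaw ρ k W U e₀ x e X * (∏ z ∈ Z, if e z = true then 1 else 0) ≤
      c ^ Z.card := by
  have h1 : ∀ e X, exploreLaw ρ k W U e₀ x e X * (∏ z ∈ Z, if e z = true then 1 else 0) =
      (∏ j, ρ (X j)) * pinLaw (touching W U) (fun z b =>
        bern (k (z.map (U.piecewise x X))) b *
          if z ∈ Z then (if b = true then 1 else 0) else 1) e₀ e := by
    intro e X
    rw [exploreLaw, mul_assoc]
    congr 1
    unfold pinLaw
    rw [← Fintype.prod_ite_mem Z, ← Finset.prod_mul_distrib]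
    refine Finset.prod_congr rfl fun z _ => ?_
    by_cases hz : z ∈ touching W U
    · simp [hz]
    · have : z ∉ Z := fun h => hz (hZ h)
      simp [hz, this]
  simp only [h1]
  rw [Finset.sum_comm]
  simp only [← Finset.mul_sum, sum_pinLaw]
  have h2 : c ^ Z.card = ∑ X : V → Fin 2, (∏ j, ρ (X j)) * c ^ Z.card := by
    rw [← Finset.sum_mul, sum_labels h.sum, one_mul]
  rw [h2]
  refine Finset.sum_le_sum fun X _ => mul_le_mul_of_nonneg_left ?_
    (Finset.prod_nonneg fun _ _ => h.nonneg _)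
  rw [← Finset.prod_subset hZ]
  · rw [← Finset.prod_const]
    refine Finset.prod_le_prod (fun z hz => ?_) fun z hz => ?_
    · simp [hz, bern, h.k_nonneg]
    · simpa [hz, bern] using hc _
  · intro z _ hz
    simp [hz, bern]

lemma sum_exploreLaw_edge_le (h : Balanced ρ k r) {W U : Finset V}
    (e₀ : Sym2 V → Bool) (x : V → Fin 2) {c : ℝ} (hc : ∀ z, k z ≤ c) {z : Sym2 V}
    (hz : z ∈ touching W U) :
    ∑ e, ∑ X, exploreLaw ρ k W U e₀ x e X * (if e z = true then 1 else 0) ≤ c := by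
  simpa using sum_pinLaw_forall_le h e₀ x hc {z} (by simpa using hz)

lemma sum_exploreLaw_edges_le (h : Balanced ρ k r) {W U : Finset V}
    (e₀ : Sym2 V → Bool) (x : V → Fin 2) {c : ℝ} (hc : ∀ z, k z ≤ c) {z z' : Sym2 V}
    (hz : z ∈ touching W U) (hz' : z' ∈ touching W U) (hne : z ≠ z') :
    ∑ e, ∑ X, exploreLaw ρ k W U e₀ x e X *
      ((if e z = true then 1 else 0) * (if e z' = true then 1 else 0)) ≤ c ^ 2 := by
  have := sum_pinLaw_forall_le h e₀ x hc {z, z'} (by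
    intro y hy
    rcases Finset.mem_insert.1 hy with rfl | hy
    · exact hz
    · exact Finset.mem_singleton.1 hy ▸ hz')
  rwa [Finset.card_pair hne, Finset.sum_congr rfl fun e _ => Finset.sum_congr rfl fun X _ => by
    rw [Finset.prod_pair hne]] at this

lemma mem_touching_of_mem {W U : Finset V} {i j : V} (hi : i ∈ U) (hiW : i ∈ W) (hj : j ∈ W)
    (hne : i ≠ j) : s(i, j) ∈ touching W U := by
  simp [touching, mem_pairs, hi, hiW, hj, hne]

-- Union bound: at most `K ^ 2` ordered pairs inside `U` can be edges, each with probability at most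
-- `c`, and for each further vertex at most `K ^ 2` pairs of edges lead to it, each with probability
-- at most `c ^ 2`. For `c` of order `1 / n` both terms are of order `1 / n`.
open scoped Classical in
lemma sum_exploreLaw_bad_le (h : Balanced ρ k r) {W U : Finset V} (hU : U ⊆ W)
    (e₀ : Sym2 V → Bool) (x : V → Fin 2) {c : ℝ} (hc : ∀ z, k z ≤ c) {K : ℝ}
    (hK : (U.card : ℝ) ≤ K) :
    ∑ e, ∑ X, exploreLaw ρ k W U e₀ x e X * (if Good W U e₀ e then 0 else 1) ≤
      K ^ 2 * c + Fintype.card V * (K ^ 2 * c ^ 2) := by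
  have hc0 : 0 ≤ c := (h.k_nonneg s(0, 0)).trans (hc _)
  have hK2 : (U.offDiag.card : ℝ) ≤ K ^ 2 := by
    calc (U.offDiag.card : ℝ) ≤ (U.card : ℝ) ^ 2 := by
          rw [pow_two]
          have : U.offDiag.card ≤ U.card * U.card := by
            rw [Finset.offDiag_card]
            exact Nat.sub_le _ _
          exact_mod_cast this
      _ ≤ K ^ 2 := pow_le_pow_left₀ (Nat.cast_nonneg _) hK 2
  have hbound : ∀ e X, exploreLaw ρ k W U e₀ x e X * (if Good W U e₀ e then 0 else 1) ≤
      exploreLaw ρ k W U e₀ x e X * (∑ p ∈ U.offDiag, (if e s(p.1, p.2) = true then 1 else 0) +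
        ∑ j ∈ W \ U, ∑ p ∈ U.offDiag, (if e s(p.1, j) = true then 1 else 0) *
          (if e s(p.2, j) = true then 1 else 0)) := by
    intro e X
    have n1 : ∀ p : V × V, (0 : ℝ) ≤ if e s(p.1, p.2) = true then 1 else 0 := fun p => by
      split_ifs <;> norm_num
    have n2 : ∀ (p : V × V) (j : V), (0 : ℝ) ≤ (if e s(p.1, j) = true then 1 else 0) *
          (if e s(p.2, j) = true then 1 else 0) := fun p j => by
      split_ifs <;> norm_num
    have n3 : (0 : ℝ) ≤ ∑ p ∈ U.offDiag, (if e s(p.1, p.2) = true then 1 else 0) :=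
      Finset.sum_nonneg fun p _ => n1 p
    have n4 : (0 : ℝ) ≤ ∑ j ∈ W \ U, ∑ p ∈ U.offDiag, (if e s(p.1, j) = true then 1 else 0) *
          (if e s(p.2, j) = true then 1 else 0) :=
      Finset.sum_nonneg fun j _ => Finset.sum_nonneg fun p _ => n2 p j
    by_cases h0 : exploreLaw ρ k W U e₀ x e X = 0
    · simp [h0]
    refine mul_le_mul_of_nonneg_left ?_ (exploreLaw_nonneg h _ _ _ _ _ _)
    split_ifs with hg
    · exact add_nonneg n3 n4
    · have hpin : ∀ z ∉ touching W U, e z = e₀ z := fun z hz =>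
        pinLaw_ne_zero (right_ne_zero_of_mul h0) hz
      simp only [Good, not_and_or] at hg
      rcases hg with hg | hg | hg
      · exact absurd hpin hg
      · push Not at hg
        obtain ⟨i, hi, j, hj, hne, he⟩ := hg
        have h5 := Finset.single_le_sum (f := fun p : V × V =>
          if e s(p.1, p.2) = true then (1 : ℝ) else 0) (fun p _ => n1 p)
          (a := (i, j)) (Finset.mem_offDiag.2 ⟨hi, hj, hne⟩)
        simp only [Bool.not_eq_false] at he
        simp only [he, if_true] at h5
        linarith
      · push Not at hg
        obtain ⟨j, hj, i, hi, i', hi', he, he', hne⟩ := hg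
        have h5 := Finset.single_le_sum (f := fun p : V × V =>
          (if e s(p.1, j) = true then (1 : ℝ) else 0) * (if e s(p.2, j) = true then 1 else 0))
          (fun p _ => n2 p j) (a := (i, i')) (Finset.mem_offDiag.2 ⟨hi, hi', hne⟩)
        have h6 := Finset.single_le_sum (f := fun j => ∑ p ∈ U.offDiag,
          (if e s(p.1, j) = true then (1 : ℝ) else 0) * (if e s(p.2, j) = true then 1 else 0))
          (fun j _ => Finset.sum_nonneg fun p _ => n2 p j) hj
        simp only [he, he', if_true, mul_one] at h5
        linarith
  refine (Finset.sum_le_sum fun e _ => Finset.sum_le_sum fun X _ => hbound e X).trans ?_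
  simp only [mul_add, Finset.mul_sum, Finset.sum_add_distrib]
  refine add_le_add ?_ ?_
  · rw [Finset.sum_congr rfl fun e _ => Finset.sum_comm, Finset.sum_comm]
    refine (Finset.sum_le_card_nsmul U.offDiag _ c fun p hp => ?_).trans ?_
    · obtain ⟨h1, h2, h3⟩ := Finset.mem_offDiag.1 hp
      exact sum_exploreLaw_edge_le h e₀ x hc (mem_touching_of_mem h1 (hU h1) (hU h2) h3)
    · rw [nsmul_eq_mul]
      exact mul_le_mul_of_nonneg_right hK2 hc0
  · rw [Finset.sum_congr rfl fun e _ => Finset.sum_comm, Finset.sum_comm]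
    refine (Finset.sum_le_card_nsmul (W \ U) _ (K ^ 2 * c ^ 2) fun j hj => ?_).trans ?_
    · rw [Finset.sum_congr rfl fun e _ => Finset.sum_comm, Finset.sum_comm]
      refine (Finset.sum_le_card_nsmul U.offDiag _ (c ^ 2) fun p hp => ?_).trans ?_
      · obtain ⟨h1, h2, h3⟩ := Finset.mem_offDiag.1 hp
        obtain ⟨hjW, hjU⟩ := Finset.mem_sdiff.1 hj
        have n1 : p.1 ≠ j := fun h => hjU (h ▸ h1)
        have n2 : p.2 ≠ j := fun h => hjU (h ▸ h2)
        refine sum_exploreLaw_edges_le h e₀ x hc (mem_touching_of_mem h1 (hU h1) hjW n1)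
          (mem_touching_of_mem h2 (hU h2) hjW n2) fun heq => ?_
        rcases Sym2.eq_iff.1 heq with h4 | h4
        · exact h3 h4.1
        · exact n1 h4.1
      · rw [nsmul_eq_mul]
        exact mul_le_mul_of_nonneg_right hK2 (sq_nonneg c)
    · rw [nsmul_eq_mul]
      refine mul_le_mul_of_nonneg_right ?_ (by positivity)
      exact_mod_cast Finset.card_le_univ _

lemma sum_exploreLaw_card_nbrs_le (h : Balanced ρ k r) {W U : Finset V} (hU : U ⊆ W)
    (e₀ : Sym2 V → Bool) (x : V → Fin 2) {c : ℝ} (hc : ∀ z, k z ≤ c) {K : ℝ}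
    (hK : (U.card : ℝ) ≤ K) :
    ∑ e, ∑ X, exploreLaw ρ k W U e₀ x e X * ((nbrs W U e).card : ℝ) ≤
      Fintype.card V * (K * c) := by
  have hc0 : 0 ≤ c := (h.k_nonneg s(0, 0)).trans (hc _)
  have hK0 : 0 ≤ K := (Nat.cast_nonneg _).trans hK
  have hcard : ∀ e : Sym2 V → Bool, ((nbrs W U e).card : ℝ) ≤
      ∑ j ∈ W \ U, ∑ i ∈ U, if e s(i, j) = true then 1 else 0 := by
    intro e
    rw [nbrs, Finset.card_filter]
    push_cast
    refine Finset.sum_le_sum fun j _ => ?_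
    have n1 : ∀ i ∈ U, (0 : ℝ) ≤ if e s(i, j) = true then 1 else 0 := fun i _ => by
      split_ifs <;> norm_num
    split_ifs with hj
    · obtain ⟨i, hi, hij⟩ := hj
      have h5 := Finset.single_le_sum n1 hi
      simpa only [hij, if_true] using h5
    · exact Finset.sum_nonneg n1
  refine (Finset.sum_le_sum fun e _ => Finset.sum_le_sum fun X _ =>
    mul_le_mul_of_nonneg_left (hcard e) (exploreLaw_nonneg h _ _ _ _ _ _)).trans ?_
  simp only [Finset.mul_sum]
  rw [Finset.sum_congr rfl fun e _ => Finset.sum_comm, Finset.sum_comm]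
  refine (Finset.sum_le_card_nsmul (W \ U) _ (K * c) fun j hj => ?_).trans ?_
  · rw [Finset.sum_congr rfl fun e _ => Finset.sum_comm, Finset.sum_comm]
    refine (Finset.sum_le_card_nsmul U _ c fun i hi => ?_).trans ?_
    · obtain ⟨hjW, hjU⟩ := Finset.mem_sdiff.1 hj
      exact sum_exploreLaw_edge_le h e₀ x hc
        (mem_touching_of_mem hi (hU hi) hjW fun h => hjU (h ▸ hi))
    · rw [nsmul_eq_mul]
      exact mul_le_mul_of_nonneg_right hK hc0
  · rw [nsmul_eq_mul]
    refine mul_le_mul_of_nonneg_right ?_ (by positivity)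
    exact_mod_cast Finset.card_le_univ _

/-- The exploration of the graph is close to the exploration of independent trees. -/
lemma l1_exploreLaw_le (h : Balanced ρ k r) {W U : Finset V} (hU : U ⊆ W)
    (e₀ : Sym2 V → Bool) (x : V → Fin 2) {c : ℝ} (hc : ∀ z, k z ≤ c) (hrc : r ≤ c)
    (hc2 : c ≤ 1 / 2) {K : ℝ} (hK : (U.card : ℝ) ≤ K) (hW : (Wᶜ.card : ℝ) ≤ K)
    (hKc : K * (3 * c) ≤ 1) :
    ∑ e, ∑ X, |exploreLaw ρ k W U e₀ x e X - treeExploreLaw ρ k r W U e₀ x e X| ≤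
      K ^ 2 * c + Fintype.card V * (K ^ 2 * c ^ 2) +
      √(3 * (Real.exp (7 * K ^ 2 * c + Fintype.card V * ((K * (3 * c)) ^ 2 + K * (2 * c ^ 2)))
        - 1)) := by
  classical
  have hc0 : 0 ≤ c := (h.k_nonneg s(0, 0)).trans (hc _)
  have hK0 : 0 ≤ K := (Nat.cast_nonneg _).trans hK
  have hr0 := h.r_nonneg
  have hr1 := h.r_le
  -- `B` extends the tree weight from good to all configurations, and `C` satisfies `B ^ 2 = A * C`,
  -- where `A` is the exploration law of the graph.
  set B : (Sym2 V → Bool) → (V → Fin 2) → ℝ := fun e X => deficit U W r * ((∏ j, ρ (X j)) *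
      pinLaw (touching W U) (fun z => treeWeight U r z (k (z.map (U.piecewise x X)))) e₀ e) with hB
  set C : (Sym2 V → Bool) → (V → Fin 2) → ℝ := fun e X => deficit U W r ^ 2 *
      ((∏ j, ρ (X j)) * pinLaw (touching W U)
        (fun z => ratioWeight U r z (k (z.map (U.piecewise x X)))) e₀ e) with hC
  -- The exponent is dictated by `C`: the squared deficit contributes `4 * K ^ 2 * c` and the pairs
  -- inside `U` contribute `3 * K ^ 2 * c`. The same exponent is more than enough for `B`.
  set u := 7 * K ^ 2 * c + Fintype.card V * ((K * (3 * c)) ^ 2 + K * (2 * c ^ 2)) with hu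
  have hd := abs_deficit_sub_one_le hK hW hr0 hrc
  have hk1 : ∀ z, k z < 1 := fun z => by linarith [hc z]
  have hdif : ∀ z, |k z - r| ≤ c := fun z => abs_le.2 ⟨by linarith [h.k_nonneg z], by
    linarith [hc z]⟩
  have hquot : ∀ z, (k z - r) ^ 2 / (1 - k z) ≤ 2 * c ^ 2 := fun z => by
    rw [div_le_iff₀ (by linarith [hk1 z])]
    have h1 : (k z - r) ^ 2 ≤ c ^ 2 := sq_le_sq' (abs_le.1 (hdif z)).1 (abs_le.1 (hdif z)).2
    nlinarith [hc z, sq_nonneg c]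
  have hquot0 : ∀ z, 0 ≤ (k z - r) ^ 2 / (1 - k z) := fun z =>
    div_nonneg (sq_nonneg _) (by linarith [hk1 z])
  -- The mass of a ratio weight has linear part `2 * (k z - r)`, which averages to zero, and a
  -- quadratic remainder.
  have hgC : ∀ z, k z + (1 - r) ^ 2 / (1 - k z) - 1 - 2 * (k z - r) =
      (k z - r) ^ 2 / (1 - k z) := fun z => by
    have : 1 - k z ≠ 0 := by linarith [hk1 z]
    field_simp
    ring
  have hsumB : |∑ e, ∑ X, B e X - 1| ≤ Real.exp u - 1 := by
    simp only [hB, ← Finset.mul_sum]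
    rw [sum_weights h.sum hU e₀ x (treeWeight U r) (fun a => a + (1 - r)) (fun a => a + 1)
      (fun z hz a => by simp [treeWeight, hz]) (fun z hz a => by simp [treeWeight, hz])]
    refine (abs_mul_sub_one_le hd (abs_mass_sub_one_le (W := W) h x (fun a => a + (1 - r))
      (fun a => a + 1) 1 c 0 (c := c) hK (by nlinarith)
      (fun z => by rw [show k z + (1 - r) - 1 = k z - r by ring]; exact hdif z)
      (fun z => by rw [show k z + (1 - r) - 1 - 1 * (k z - r) = 0 by ring]; simp)
      (fun z => by rw [add_sub_cancel_right, abs_of_nonneg (h.k_nonneg z)]; exact hc z))).trans ?_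
    refine sub_le_sub_right (Real.exp_le_exp.2 ?_) _
    rw [hu]
    have h1 : (K * c) ^ 2 + K * 0 ≤ (K * (3 * c)) ^ 2 + K * (2 * c ^ 2) := by
      have : 0 ≤ K * c ^ 2 := by positivity
      have : 0 ≤ (K * c) ^ 2 := by positivity
      nlinarith
    have h2 := mul_le_mul_of_nonneg_left h1 (Nat.cast_nonneg (α := ℝ) (Fintype.card V))
    have h3 : 0 ≤ K ^ 2 * c := by positivity
    linarith
  have hsumC : |∑ e, ∑ X, C e X - 1| ≤ Real.exp u - 1 := by
    simp only [hC, ← Finset.mul_sum]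
    rw [sum_weights h.sum hU e₀ x (ratioWeight U r) (fun a => a + (1 - r) ^ 2 / (1 - a))
      (fun a => a + 1 / (1 - a))
      (fun z hz a => by simp [ratioWeight, hz]) (fun z hz a => by simp [ratioWeight, hz])]
    have hd2 := abs_mul_sub_one_le hd hd
    rw [← pow_two] at hd2
    refine (abs_mul_sub_one_le hd2 (abs_mass_sub_one_le (W := W) h x
      (fun a => a + (1 - r) ^ 2 / (1 - a)) (fun a => a + 1 / (1 - a)) 2 (3 * c) (2 * c ^ 2)
      (c := 3 * c)
      hK hKc (fun z => ?_) (fun z => ?_) (fun z => ?_))).trans ?_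
    · have h1 : k z + (1 - r) ^ 2 / (1 - k z) - 1 = 2 * (k z - r) + (k z - r) ^ 2 / (1 - k z) := by
        rw [← hgC]
        ring
      rw [h1]
      refine (abs_add_le _ _).trans ?_
      rw [abs_mul, abs_of_nonneg (hquot0 z), abs_two]
      nlinarith [hquot z, hdif z]
    · rw [hgC, abs_of_nonneg (hquot0 z)]
      exact hquot z
    · have hz := hk1 z
      have h1 : k z + 1 / (1 - k z) - 1 = k z + k z / (1 - k z) := by
        have : 1 - k z ≠ 0 := by linarith
        field_simp
        ring
      have h2 : k z / (1 - k z) ≤ 2 * k z := by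
        rw [div_le_iff₀ (by linarith)]
        nlinarith [h.k_nonneg z, hc z]
      have h3 : 0 ≤ k z / (1 - k z) := div_nonneg (h.k_nonneg z) (by linarith)
      rw [h1, abs_of_nonneg (add_nonneg (h.k_nonneg z) h3)]
      linarith [hc z]
    · refine sub_le_sub_right (Real.exp_le_exp.2 (le_of_eq ?_)) _
      rw [hu]
      ring
  have hA0 : ∀ e X, 0 ≤ exploreLaw ρ k W U e₀ x e X := exploreLaw_nonneg h W U e₀ x
  have hC0 : ∀ e X, 0 ≤ C e X := fun e X => by
    refine mul_nonneg (sq_nonneg _) (mul_nonneg (Finset.prod_nonneg fun _ _ => h.nonneg _)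
      (Finset.prod_nonneg fun z _ => ?_))
    split_ifs
    · cases e z
      · exact div_nonneg (sq_nonneg _) (by linarith [hk1 (z.map (U.piecewise x X))])
      · exact h.k_nonneg _
    · exact zero_le_one
    · exact le_rfl
  have hAC : ∀ e X, B e X ^ 2 = exploreLaw ρ k W U e₀ x e X * C e X := by
    intro e X
    simp only [hB, hC, exploreLaw, mul_pow]
    have : pinLaw (touching W U) (fun z => treeWeight U r z (k (z.map (U.piecewise x X)))) e₀ e ^ 2
        = pinLaw (touching W U) (fun z => bern (k (z.map (U.piecewise x X)))) e₀ e *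
          pinLaw (touching W U)
            (fun z => ratioWeight U r z (k (z.map (U.piecewise x X)))) e₀ e := by
      unfold pinLaw
      rw [← Finset.prod_pow, ← Finset.prod_mul_distrib]
      refine Finset.prod_congr rfl fun z _ => ?_
      have : 1 - k (z.map (U.piecewise x X)) ≠ 0 := by
        linarith [hk1 (z.map (U.piecewise x X))]
      split_ifs
      · cases e z
        · simp only [treeWeight, bern, ratioWeight, cond_false]
          field_simp
        · simp only [treeWeight, bern, ratioWeight, cond_true]
          ring
      · simp
      · simp
    rw [this]
    ring
  -- The masses of `B` and `C` differ from 1 by at most `exp u - 1`, so `1 - 2 * ∑ B + ∑ C` is at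
  -- most three times this quantity.
  have hCS : ∑ e, ∑ X, |exploreLaw ρ k W U e₀ x e X - B e X| ≤ √(3 * (Real.exp u - 1)) := by
    have h1 := sum_abs_sub_le_sqrt (Finset.univ : Finset ((Sym2 V → Bool) × (V → Fin 2)))
      (a := fun p => exploreLaw ρ k W U e₀ x p.1 p.2) (b := fun p => B p.1 p.2)
      (c := fun p => C p.1 p.2) (fun p => hA0 _ _) (fun p => hC0 _ _) (fun p => hAC _ _)
    simp only [Fintype.sum_prod_type, Finset.sum_add_distrib, Finset.sum_sub_distrib,
      sum_exploreLaw h.sum, Real.sqrt_one, one_mul, ← Finset.mul_sum] at h1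
    refine h1.trans (Real.sqrt_le_sqrt ?_)
    have h2 := abs_le.1 hsumB
    have h3 := abs_le.1 hsumC
    linarith [h2.1, h3.2]
  calc ∑ e, ∑ X, |exploreLaw ρ k W U e₀ x e X - treeExploreLaw ρ k r W U e₀ x e X|
      ≤ ∑ e, ∑ X, (exploreLaw ρ k W U e₀ x e X * (if Good W U e₀ e then 0 else 1) +
          |exploreLaw ρ k W U e₀ x e X - B e X|) := by
        refine Finset.sum_le_sum fun e _ => Finset.sum_le_sum fun X _ => ?_
        by_cases hg : Good W U e₀ e
        · rw [treeExploreLaw_of_good hU x X hg, if_pos hg, mul_zero, zero_add]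
        · rw [treeExploreLaw, if_neg hg, if_neg hg, sub_zero, abs_of_nonneg (hA0 e X), mul_one]
          linarith [abs_nonneg (exploreLaw ρ k W U e₀ x e X - B e X)]
    _ ≤ _ := by
        simp only [Finset.sum_add_distrib]
        exact add_le_add (sum_exploreLaw_bad_le h hU e₀ x hc hK) hCS

end Exploration

end SBM

namespace SBM

/-! ### Induction over the generations as the number of vertices grows -/

section Convergence

set_option linter.unusedSectionVars false

variable {ρ : Fin 2 → ℝ} {k : ℕ → Sym2 (Fin 2) → ℝ} {r : ℕ → ℝ} {C q : ℝ}

/-- The error of one exploration step vanishes as the number of vertices grows. -/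
lemma eventually_explore (hbal : ∀ᶠ n in atTop, Balanced ρ (k n) (r n))
    (hk : ∀ n z, k n z ≤ C / n) (hr : ∀ n, r n ≤ C / n) (K : ℕ) {δ : ℝ} (hδ : 0 < δ) :
    ∃ K' : ℕ, ∀ᶠ n in atTop, ∀ (W U : Finset (Fin n)) (e₀ : Sym2 (Fin n) → Bool), U ⊆ W →
      U.card ≤ K → Wᶜ.card ≤ K → ∀ x,
        ∑ e, ∑ X, |exploreLaw ρ (k n) W U e₀ x e X - treeExploreLaw ρ (k n) (r n) W U e₀ x e X| ≤ δ ∧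
        ∑ e, ∑ X, treeExploreLaw ρ (k n) (r n) W U e₀ x e X *
          (if (nbrs W U e).card ≤ K' then 0 else 1) ≤ 2 * δ := by
  -- Markov's inequality: the expected number of neighbours of `U` is at most `K * C`, so it exceeds
  -- `K'` with probability at most `δ`. A second `δ` is the cost of passing to the tree weights.
  obtain ⟨K', hK'⟩ := exists_nat_gt (K * C / δ)
  refine ⟨K', ?_⟩
  have hc : Tendsto (fun n : ℕ => C / n) atTop (𝓝 0) := tendsto_const_div_atTop_nhds_zero_nat C
  have hnc : Tendsto (fun n : ℕ => (n : ℝ) * (C / n)) atTop (𝓝 C) := by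
    refine tendsto_const_nhds.congr' ?_
    filter_upwards [eventually_ne_atTop 0] with n hn
    field_simp
  have hnc2 : Tendsto (fun n : ℕ => (n : ℝ) * (C / n) ^ 2) atTop (𝓝 0) := by
    have := hnc.mul hc
    rw [mul_zero] at this
    exact this.congr fun n => by ring
  set err : ℕ → ℝ := fun n => (K : ℝ) ^ 2 * (C / n) + n * ((K : ℝ) ^ 2 * (C / n) ^ 2) +
      √(3 * (Real.exp (7 * (K : ℝ) ^ 2 * (C / n) +
        n * ((K * (3 * (C / n))) ^ 2 + K * (2 * (C / n) ^ 2))) - 1)) with herr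
  have herr0 : Tendsto err atTop (𝓝 0) := by
    have h1 : Tendsto (fun n : ℕ => 7 * (K : ℝ) ^ 2 * (C / n) +
        n * ((K * (3 * (C / n))) ^ 2 + K * (2 * (C / n) ^ 2))) atTop (𝓝 0) := by
      have := (hc.const_mul (7 * (K : ℝ) ^ 2)).add (hnc2.const_mul (9 * (K : ℝ) ^ 2 + 2 * K))
      simp only [mul_zero, add_zero] at this
      exact this.congr fun n => by ring
    have h2 : Tendsto (fun n : ℕ => (K : ℝ) ^ 2 * (C / n) + n * ((K : ℝ) ^ 2 * (C / n) ^ 2)) atTop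
        (𝓝 0) := by
      have := (hc.const_mul ((K : ℝ) ^ 2)).add (hnc2.const_mul ((K : ℝ) ^ 2))
      simp only [mul_zero, add_zero] at this
      exact this.congr fun n => by ring
    have h3 := (Real.continuous_sqrt.tendsto _).comp
      ((((Real.continuous_exp.tendsto _).comp h1).sub_const 1).const_mul 3)
    rw [show (0 : ℝ) = 0 + √(3 * (Real.exp 0 - 1)) by simp]
    exact h2.add h3
  filter_upwards [hbal, herr0.eventually_le_const hδ,
    hc.eventually_le_const (by norm_num : (0 : ℝ) < 1 / 2),
    (hc.const_mul (3 * (K : ℝ))).eventually_le_const (by norm_num : 3 * (K : ℝ) * 0 < 1),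
    eventually_ne_atTop 0] with n h herrn hcn hKn hn0 W U e₀ hU hUK hWK x
  have hUK' : (U.card : ℝ) ≤ K := by exact_mod_cast hUK
  have hWK' : (Wᶜ.card : ℝ) ≤ K := by exact_mod_cast hWK
  have h1 := (l1_exploreLaw_le h hU e₀ x (hk n) (hr n) hcn hUK' hWK' (by linarith)).trans
    (by simpa [herr, Fintype.card_fin] using herrn)
  refine ⟨h1, ?_⟩
  have h2 := sum_exploreLaw_card_nbrs_le h hU e₀ x (hk n) hUK'
  have hnK : (Fintype.card (Fin n) : ℝ) * (K * (C / n)) = K * C := by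
    rw [Fintype.card_fin]
    field_simp
  rw [hnK] at h2
  have hC0 : 0 ≤ C := by
    have h3 : 0 ≤ C / n := (h.k_nonneg s(0, 0)).trans (hk n _)
    have hn : (0 : ℝ) < n := by positivity
    by_contra hneg
    exact absurd h3 (not_le.2 (div_neg_of_neg_of_pos (not_le.1 hneg) hn))
  have hK'0 : (0 : ℝ) < K' := lt_of_le_of_lt (by positivity) hK'
  have h3 : ∑ e, ∑ X, exploreLaw ρ (k n) W U e₀ x e X *
      (if (nbrs W U e).card ≤ K' then 0 else 1) ≤ δ := by
    have h4 : ∑ e, ∑ X, exploreLaw ρ (k n) W U e₀ x e X *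
        (if (nbrs W U e).card ≤ K' then 0 else 1) ≤
        ∑ e, ∑ X, exploreLaw ρ (k n) W U e₀ x e X * ((nbrs W U e).card : ℝ) / K' := by
      refine Finset.sum_le_sum fun e _ => Finset.sum_le_sum fun X _ => ?_
      rw [mul_div_assoc]
      refine mul_le_mul_of_nonneg_left ?_ (exploreLaw_nonneg h _ _ _ _ _ _)
      split_ifs with hcard
      · positivity
      · rw [le_div_iff₀ hK'0, one_mul]
        exact_mod_cast (not_le.1 hcard).le
    refine h4.trans ?_
    simp only [← Finset.sum_div]
    rw [div_le_iff₀ hK'0]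
    rw [div_lt_iff₀ hδ] at hK'
    linarith
  calc _ ≤ ∑ e, ∑ X, (exploreLaw ρ (k n) W U e₀ x e X *
        (if (nbrs W U e).card ≤ K' then 0 else 1) +
        |exploreLaw ρ (k n) W U e₀ x e X - treeExploreLaw ρ (k n) (r n) W U e₀ x e X|) := by
        refine Finset.sum_le_sum fun e _ => Finset.sum_le_sum fun X _ => ?_
        have h5 := neg_abs_le
          (exploreLaw ρ (k n) W U e₀ x e X - treeExploreLaw ρ (k n) (r n) W U e₀ x e X)
        split_ifs
        · simp
        · linarith
    _ ≤ 2 * δ := by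
        simp only [Finset.sum_add_distrib]
        linarith

lemma sum_treeExploreLaw_le {V : Type} [Fintype V] [DecidableEq V] {k : Sym2 (Fin 2) → ℝ} {r : ℝ}
    (hρ : ∑ y, ρ y = 1) {W U : Finset V} {e₀ : Sym2 V → Bool} {x : V → Fin 2} {δ : ℝ}
    (hδ : ∑ e, ∑ X, |exploreLaw ρ k W U e₀ x e X - treeExploreLaw ρ k r W U e₀ x e X| ≤ δ) :
    ∑ e, ∑ X, treeExploreLaw ρ k r W U e₀ x e X ≤ 1 + δ := by
  have h1 : ∑ e, ∑ X, treeExploreLaw ρ k r W U e₀ x e X ≤ ∑ e, ∑ X, (exploreLaw ρ k W U e₀ x e X +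
      |exploreLaw ρ k W U e₀ x e X - treeExploreLaw ρ k r W U e₀ x e X|) := by
    refine Finset.sum_le_sum fun e _ => Finset.sum_le_sum fun X _ => ?_
    have h5 := neg_abs_le (exploreLaw ρ k W U e₀ x e X - treeExploreLaw ρ k r W U e₀ x e X)
    linarith
  simp only [Finset.sum_add_distrib, sum_exploreLaw hρ] at h1
  linarith

lemma card_compl_sdiff_le {n K : ℕ} {W U : Finset (Fin n)} (hU : U.card ≤ K) (hW : Wᶜ.card ≤ K) :
    (W \ U)ᶜ.card ≤ 2 * K := by
  have : (W \ U)ᶜ = Wᶜ ∪ U := by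
    ext j
    simp only [Finset.mem_compl, Finset.mem_sdiff, Finset.mem_union]
    tauto
  rw [this]
  have := Finset.card_union_le Wᶜ U
  omega

/-- Induction over the generations, for any comparison of graphs and forests. -/
lemma eventually_sim_aux (hbal : ∀ᶠ n in atTop, Balanced ρ (k n) (r n))
    (hk : ∀ n z, k n z ≤ C / n) (hr : ∀ n, r n ≤ C / n)
    (S : ∀ n : ℕ, ℕ → Finset (Fin n) → Finset (Fin n) → (Sym2 (Fin n) → Bool) → ℝ → Prop)
    (hmono : ∀ n t W U e₀ δ δ', S n t W U e₀ δ → δ ≤ δ' → S n t W U e₀ δ')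
    (htwo : ∀ᶠ n in atTop, ∀ t W U e₀, S n t W U e₀ 2)
    (hzero : ∀ᶠ n in atTop, ∀ W U e₀, S n 0 W U e₀ 0)
    (hsucc : ∀ᶠ n in atTop, ∀ (t : ℕ) (W U : Finset (Fin n)) (e₀ : Sym2 (Fin n) → Bool) (η : ℝ)
      (δ : (Sym2 (Fin n) → Bool) → ℝ) (ε : ℝ),
      (∀ x, ∑ e, ∑ X,
        |exploreLaw ρ (k n) W U e₀ x e X - treeExploreLaw ρ (k n) (r n) W U e₀ x e X| ≤ η) →
      (∀ x, ∑ e, ∑ X, treeExploreLaw ρ (k n) (r n) W U e₀ x e X * δ e ≤ ε) →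
      (∀ e, S n t (W \ U) (nbrs W U e) e (δ e)) → S n (t + 1) W U e₀ (2 * η + ε)) (t : ℕ) :
    ∀ (K : ℕ) (δ : ℝ), 0 < δ → ∀ᶠ n in atTop, ∀ (W U : Finset (Fin n))
      (e₀ : Sym2 (Fin n) → Bool), U ⊆ W → U.card ≤ K → Wᶜ.card ≤ K → S n t W U e₀ δ := by
  induction t with
  | zero =>
    intro K δ hδ
    filter_upwards [hzero] with n hn W U e₀ _ _ _
    exact hmono _ _ _ _ _ _ _ (hn W U e₀) hδ.le
  | succ t ih =>
    intro K δ hδ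
    -- The mixture error is at most `η * (1 + η) + 2 * (2 * η)`, hence at most `6 * η` by `η ≤ 1`;
    -- together with `2 * η` this gives `8 * η ≤ δ`.
    set η := min (δ / 12) 1 with hη
    have hη0 : 0 < η := by positivity
    have hη1 : η ≤ 1 := min_le_right _ _
    have hηδ : η ≤ δ / 12 := min_le_left _ _
    obtain ⟨K', hK'⟩ := eventually_explore hbal hk hr K hη0
    -- After one step the frontier has at most `K'` vertices, except on an event of small mass where
    -- the trivial error 2 is used, and at most `2 * K` vertices are used up.
    filter_upwards [hbal, hK', htwo, hsucc, ih (max K' (2 * K)) η hη0] with n h hex h2 hs hi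
      W U e₀ hU hUK hWK
    refine hmono _ _ _ _ _ _ _ (hs t W U e₀ η
      (fun e => if (nbrs W U e).card ≤ K' then η else 2) (6 * η)
      (fun x => (hex W U e₀ hU hUK hWK x).1) (fun x => ?_) (fun e => ?_)) (by linarith)
    · obtain ⟨ha, hb⟩ := hex W U e₀ hU hUK hWK x
      have hm := sum_treeExploreLaw_le h.sum ha
      calc _ ≤ ∑ e, ∑ X, (η * treeExploreLaw ρ (k n) (r n) W U e₀ x e X +
            2 * (treeExploreLaw ρ (k n) (r n) W U e₀ x e X *
              (if (nbrs W U e).card ≤ K' then 0 else 1))) := by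
            refine Finset.sum_le_sum fun e _ => Finset.sum_le_sum fun X _ => ?_
            have h0 := treeExploreLaw_nonneg h W U e₀ x e X
            split_ifs <;> nlinarith
        _ ≤ η * (1 + η) + 2 * (2 * η) := by
            simp only [Finset.sum_add_distrib, ← Finset.mul_sum]
            exact add_le_add (mul_le_mul_of_nonneg_left hm hη0.le) (by linarith)
        _ ≤ 6 * η := by nlinarith
    · split_ifs with hcard
      · exact hi _ _ _ (nbrs_subset W U e) (hcard.trans (le_max_left _ _))
          ((card_compl_sdiff_le hUK hWK).trans (le_max_right _ _))
      · exact h2 _ _ _ _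

/-- The forest is asymptotically at most as informative as the graph. -/
lemma eventually_sim_graph_forest (hbal : ∀ᶠ n in atTop, Balanced ρ (k n) (r n))
    (hk : ∀ n z, k n z ≤ C / n) (hr : ∀ n, r n ≤ C / n) (h0 : 0 ≤ q) (h1 : q ≤ 1) (t K : ℕ)
    {δ : ℝ} (hδ : 0 < δ) :
    ∀ᶠ n in atTop, ∀ (W U : Finset (Fin n)) (e₀ : Sym2 (Fin n) → Bool), U ⊆ W → U.card ≤ K →
      Wᶜ.card ≤ K → Sim (avgLaw ρ (k n) q t W U e₀)
        (forestLaw (treeLaw ρ (k n) (r n) q (Fin n) t) U) δ := by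
  refine eventually_sim_aux hbal hk hr (fun n t W U e₀ δ => Sim (avgLaw ρ (k n) q t W U e₀)
        (forestLaw (treeLaw ρ (k n) (r n) q (Fin n) t) U) δ)
    (fun n t W U e₀ δ δ' hS hle => hS.mono hle) ?_ ?_ ?_ t K δ hδ
  · filter_upwards [hbal] with n h t W U e₀
    exact Sim.two (avgLaw_nonneg h h0 h1 t W U e₀) (sum_avgLaw h.sum t W U e₀)
      (forestLaw_nonneg (treeLaw_nonneg h h0 h1 t) U) (sum_forestLaw (sum_treeLaw h t) U)
  · filter_upwards [hbal] with n h W U e₀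
    exact sim_zero h.sum W U e₀
  · filter_upwards [hbal] with n h t W U e₀ η δ ε hη hε
    exact (sim_succ h h0 h1 t hη hε).1

/-- If all labels at distance `t` are revealed, then the graph is asymptotically at most as
informative as the forest. -/
lemma eventually_sim_forest_graph (hbal : ∀ᶠ n in atTop, Balanced ρ (k n) (r n))
    (hk : ∀ n z, k n z ≤ C / n) (hr : ∀ n, r n ≤ C / n) (t K : ℕ) {δ : ℝ} (hδ : 0 < δ) :
    ∀ᶠ n in atTop, ∀ (W U : Finset (Fin n)) (e₀ : Sym2 (Fin n) → Bool), U ⊆ W → U.card ≤ K →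
      Wᶜ.card ≤ K → Sim (forestLaw (treeLaw ρ (k n) (r n) 1 (Fin n) t) U)
        (avgLaw ρ (k n) 1 t W U e₀) δ := by
  refine eventually_sim_aux hbal hk hr (fun n t W U e₀ δ =>
      Sim (forestLaw (treeLaw ρ (k n) (r n) 1 (Fin n) t) U) (avgLaw ρ (k n) 1 t W U e₀) δ)
    (fun n t W U e₀ δ δ' hS hle => hS.mono hle) ?_ ?_ ?_ t K δ hδ
  · filter_upwards [hbal] with n h t W U e₀
    exact Sim.two (forestLaw_nonneg (treeLaw_nonneg h zero_le_one le_rfl t) U)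
      (sum_forestLaw (sum_treeLaw h t) U) (avgLaw_nonneg h zero_le_one le_rfl t W U e₀)
      (sum_avgLaw h.sum t W U e₀)
  · filter_upwards [hbal] with n h W U e₀
    exact sim_zero_reverse h W U e₀
  · filter_upwards [hbal] with n h t W U e₀ η δ ε hη hε
    exact (sim_succ h zero_le_one le_rfl t hη hε).2

end Convergence

end SBM

namespace SBM

/-! ### Success probability of the optimal test as a total variation distance -/

section OptimalTest

set_option linter.unusedSectionVars false

/-- Conditional law of the observation, given the label of `v`. -/
def condLaw {Ω O : Type*} [Fintype Ω] {n : ℕ} (w : Ω → ℝ) (X : Ω → Fin n → Fin 2) (obs : Ω → O)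
    (v : Fin n) (x : Fin 2) (o : O) : ℝ :=
  condProb w {ω | obs ω = o} {ω | X ω v = x}

variable {Ω O : Type*} [Fintype Ω] [Fintype O]

lemma prob_eq_sum (w : Ω → ℝ) (S : Ω → Prop) [DecidablePred S] :
    prob w {ω | S ω} = ∑ ω, if S ω then w ω else 0 := by
  unfold prob
  refine Finset.sum_congr rfl fun ω _ => ?_
  by_cases h : S ω <;> simp [Set.indicator, h]

lemma prob_inter_eq_sum (w : Ω → ℝ) (S S' : Ω → Prop) [DecidablePred S] [DecidablePred S'] :
    prob w ({ω | S ω} ∩ {ω | S' ω}) = ∑ ω, if S ω ∧ S' ω then w ω else 0 :=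
  prob_eq_sum w fun ω => S ω ∧ S' ω

lemma prob_nonneg {w : Ω → ℝ} (hw : ∀ ω, 0 ≤ w ω) (A : Set Ω) : 0 ≤ prob w A :=
  Finset.sum_nonneg fun ω _ => Set.indicator_nonneg (fun ω _ => hw ω) ω

/-- Decomposition according to the value of the observation. -/
lemma prob_preimage_inter (w : Ω → ℝ) (obs : Ω → O) (S : O → Prop) (B : Ω → Prop)
    [DecidablePred S] : prob w ({ω | S (obs ω)} ∩ {ω | B ω}) =
      ∑ o, if S o then prob w ({ω | obs ω = o} ∩ {ω | B ω}) else 0 := by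
  classical
  simp only [prob_inter_eq_sum]
  calc _ = ∑ ω, ∑ o, if S o then (if obs ω = o ∧ B ω then w ω else 0) else 0 := by
        refine Finset.sum_congr rfl fun ω _ => ?_
        rw [Finset.sum_eq_single (obs ω)]
        · by_cases h1 : S (obs ω) <;> simp [h1]
        · intro o _ ho
          simp [ho.symm]
        · simp
    _ = _ := by
        rw [Finset.sum_comm]
        refine Finset.sum_congr rfl fun o _ => ?_
        by_cases h1 : S o <;> simp [h1]

/-- With posterior probabilities `a` and `b`, Bayes' formula turns this threshold into a comparison
of the likelihoods. The case `b = 0` relies on the convention `log (x / 0) = ⊤`. -/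
lemma log_ratio_le_iff {p a b : ℝ} (hp1 : p < 1) (ha : 0 ≤ a) (hb : 0 ≤ b)
    (hab : 0 < a + b) :
    ENNReal.log (ENNReal.ofReal p / ENNReal.ofReal (1 - p)) ≤
      ENNReal.log (ENNReal.ofReal a / ENNReal.ofReal b) ↔ p * b ≤ (1 - p) * a := by
  have hp' : 0 < 1 - p := by linarith
  rw [ENNReal.log_le_log_iff, ← ENNReal.ofReal_div_of_pos hp']
  rcases hb.eq_or_lt with rfl | hb
  · have ha' : 0 < a := by linarith
    rw [ENNReal.ofReal_zero, ENNReal.div_zero (by simpa using ha')]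
    simp only [le_top, mul_zero, true_iff]
    positivity
  · rw [← ENNReal.ofReal_div_of_pos hb, ENNReal.ofReal_le_ofReal_iff (by positivity),
      div_le_div_iff₀ hp' hb, mul_comm a]

/-- The test picks the label with the larger likelihood, so at `v` it achieves the sum of `P 0 o - P
1 o` over the observations with `P 1 o ≤ P 0 o`. This is half of the `ℓ¹` distance, as the
differences have total sum zero. -/
lemma successProb_optTest {n : ℕ} {w : Ω → ℝ} (hw : ∀ ω, 0 ≤ w ω) (X : Ω → Fin n → Fin 2)
    (obs : Ω → O) {p : ℝ} (hp0 : 0 < p) (hp1 : p < 1)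
    (hX : ∀ v x, prob w {ω | X ω v = x} = labelProb p x) :
    successProb w X obs (optTest w p X obs) =
      1 / (n : ℝ) * ∑ v, l1 (condLaw w X obs v 0) (condLaw w X obs v 1) / 2 := by
  classical
  unfold successProb
  congr 1
  refine Finset.sum_congr rfl fun v _ => ?_
  set P := condLaw w X obs v with hP
  set T := optTest w p X obs with hT
  have hπ : ∀ x, 0 < labelProb p x := fun x => by
    fin_cases x
    · simpa [labelProb] using hp0
    · simpa [labelProb] using hp1
  have hjoint : ∀ x o, prob w ({ω | obs ω = o} ∩ {ω | X ω v = x}) = labelProb p x * P x o := by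
    intro x o
    rw [hP, condLaw, condProb, hX, mul_div_cancel₀ _ (hπ x).ne']
  have hP0 : ∀ x o, 0 ≤ P x o := fun x o => by
    rw [hP, condLaw, condProb, hX]
    exact div_nonneg (prob_nonneg hw _) (hπ x).le
  have hset : ∀ (x : Fin 2) (S : O → Prop) [DecidablePred S],
      condProb w {ω | S (obs ω)} {ω | X ω v = x} = ∑ o, if S o then P x o else 0 := by
    intro x S _
    rw [condProb, prob_preimage_inter, hX, Finset.sum_div]
    refine Finset.sum_congr rfl fun o _ => ?_
    split_ifs
    · rw [hjoint, mul_div_cancel_left₀ _ (hπ x).ne']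
    · simp
  have hP1 : ∀ x, ∑ o, P x o = 1 := by
    intro x
    have h1 := hset x fun _ => True
    simp only [if_true] at h1
    rw [← h1, condProb, hX, Set.ofPred_true, Set.univ_inter, hX, div_self (hπ x).ne']
  -- Observations of probability zero are excluded: the decision there follows from conventions and
  -- does not contribute.
  have hdec : ∀ o, P 0 o + P 1 o ≠ 0 → (T o v = 0 ↔ P 1 o ≤ P 0 o) := by
    intro o ho
    have h2 : ∀ x, condProb w {ω | X ω v = x} {ω | obs ω = o} =
        labelProb p x * P x o / prob w {ω | obs ω = o} := fun x => by
      rw [condProb, Set.inter_comm, hjoint]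
    have h3 : prob w {ω | obs ω = o} = p * P 0 o + (1 - p) * P 1 o := by
      have h4 := hjoint 0 o
      have h5 := hjoint 1 o
      simp only [labelProb, Matrix.cons_val_zero, Matrix.cons_val_one] at h4 h5
      rw [← h4, ← h5]
      simp only [prob_eq_sum, prob_inter_eq_sum, ← Finset.sum_add_distrib]
      refine Finset.sum_congr rfl fun ω _ => ?_
      generalize X ω v = y
      fin_cases y <;> simp
    have h6 : 0 < P 0 o + P 1 o :=
      lt_of_le_of_ne (add_nonneg (hP0 0 o) (hP0 1 o)) ho.symm
    have hp' : 0 < 1 - p := by linarith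
    have h7 : 0 < p * P 0 o + (1 - p) * P 1 o := by
      rcases (hP0 0 o).eq_or_lt with h | h
      · rw [← h] at h6 ⊢
        have : 0 < P 1 o := by linarith
        positivity
      · have := hP0 1 o
        positivity
    have h8 : T o v = 0 ↔ ENNReal.log (ENNReal.ofReal p / ENNReal.ofReal (1 - p)) ≤
        ENNReal.log (ENNReal.ofReal (condProb w {ω | X ω v = 0} {ω | obs ω = o}) /
          ENNReal.ofReal (condProb w {ω | X ω v = 1} {ω | obs ω = o})) := by
      rw [hT, optTest]
      split_ifs with h <;> simp [h]
    rw [h8, h2, h2, h3]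
    simp only [labelProb, Matrix.cons_val_zero, Matrix.cons_val_one]
    have a0 := hP0 0 o
    have a1 := hP0 1 o
    rw [log_ratio_le_iff hp1 (by positivity) (by positivity)
      (by rw [← add_div, div_self h7.ne']; norm_num),
      ← mul_div_assoc, ← mul_div_assoc, div_le_div_iff_of_pos_right h7]
    constructor
    · intro h
      have : p * (1 - p) * P 1 o ≤ p * (1 - p) * P 0 o := by linarith
      exact le_of_mul_le_mul_left this (by positivity)
    · intro h
      have := mul_le_mul_of_nonneg_left h (show 0 ≤ p * (1 - p) by positivity)
      linarith
  rw [hset 0 fun o => T o v = 0, hset 1 fun o => T o v = 1]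
  have e2 : ∑ o, (if T o v = 1 then P 1 o else 0) - 1 =
      -∑ o, if T o v = 0 then P 1 o else 0 := by
    rw [← hP1 1, ← Finset.sum_sub_distrib, ← Finset.sum_neg_distrib]
    refine Finset.sum_congr rfl fun o _ => ?_
    generalize T o v = y
    fin_cases y <;> simp
  rw [add_sub_assoc, e2, ← sub_eq_add_neg, ← Finset.sum_sub_distrib]
  have e3 : ∑ o, (P 0 o - P 1 o) = 0 := by rw [Finset.sum_sub_distrib, hP1, hP1, sub_self]
  have e4 : ∀ o, (if T o v = 0 then P 0 o else 0) - (if T o v = 0 then P 1 o else 0) =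
      |P 0 o - P 1 o| / 2 + (P 0 o - P 1 o) / 2 := by
    intro o
    by_cases h : P 0 o + P 1 o = 0
    · have h0 : P 0 o = 0 := by linarith [hP0 0 o, hP0 1 o]
      have h1 : P 1 o = 0 := by linarith [hP0 0 o, hP0 1 o]
      simp [h0, h1]
    · have := hdec o h
      split_ifs with hT0
      · rw [abs_of_nonneg (sub_nonneg.2 (this.1 hT0))]
        ring
      · have h9 : P 0 o < P 1 o := not_le.1 fun hle => hT0 (this.2 hle)
        rw [abs_of_neg (sub_neg.2 h9)]
        ring
  rw [Finset.sum_congr rfl fun o _ => e4 o, Finset.sum_add_distrib, ← Finset.sum_div,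
    ← Finset.sum_div, e3, l1]
  ring

end OptimalTest

/-! ### Graphs as functions on pairs, and conditioning on one label -/

section Link

set_option linter.unusedSectionVars false

variable {n : ℕ} {p : ℝ} {k : Sym2 (Fin 2) → ℝ} {r : ℝ}

/-- The indicator of the edges. -/
def edgeFun (G : SimpleGraph (Fin n)) (z : Sym2 (Fin n)) : Bool :=
  open scoped Classical in decide (z ∈ G.edgeSet)

lemma edgeFun_eq_true {G : SimpleGraph (Fin n)} {z : Sym2 (Fin n)} :
    edgeFun G z = true ↔ z ∈ G.edgeSet := by
  simp [edgeFun]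

lemma edgeFun_injective : Function.Injective (edgeFun (n := n)) := by
  intro G H h
  rw [← SimpleGraph.edgeSet_inj]
  ext z
  rw [← edgeFun_eq_true, h, edgeFun_eq_true]

lemma edgeFun_diag (G : SimpleGraph (Fin n)) {z : Sym2 (Fin n)} (hz : z.IsDiag) :
    edgeFun G z = false := by
  rw [Bool.eq_false_iff, ne_eq, edgeFun_eq_true]
  exact fun h => G.not_isDiag_of_mem_edgeSet h hz

lemma mem_range_edgeFun {e : Sym2 (Fin n) → Bool} (he : ∀ z ∉ pairs Finset.univ, e z = false) :
    e ∈ Set.range (edgeFun (n := n)) := by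
  refine ⟨SimpleGraph.fromEdgeSet {z | e z = true}, ?_⟩
  funext z
  rw [Bool.eq_iff_iff, edgeFun_eq_true, SimpleGraph.edgeSet_fromEdgeSet]
  constructor
  · exact fun h => h.1
  · refine fun h => ⟨h, fun hd => ?_⟩
    rw [he z (by simp_all [pairs])] at h
    cases h

/-- Graphs correspond to the functions that vanish on the diagonal, and the other functions do not
contribute by assumption. -/
lemma sum_edgeFun (F : (Sym2 (Fin n) → Bool) → ℝ)
    (hF : ∀ e, (∃ z ∉ pairs Finset.univ, e z ≠ false) → F e = 0) :
    ∑ G : SimpleGraph (Fin n), F (edgeFun G) = ∑ e, F e := by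
  refine Fintype.sum_of_injective edgeFun edgeFun_injective _ _ (fun e he => ?_) fun _ => rfl
  by_contra h
  refine he (mem_range_edgeFun fun z hz => ?_)
  by_contra hne
  exact h (hF e ⟨z, hz, hne⟩)

lemma prod_pairs_univ (f : Sym2 (Fin n) → ℝ) :
    ∏ z ∈ pairs (Finset.univ : Finset (Fin n)), f z = ∏ i, ∏ j ∈ Finset.Ioi i, f s(i, j) := by
  rw [Finset.prod_sigma']
  symm
  refine Finset.prod_nbij (fun a => s(a.1, a.2)) ?_ ?_ ?_ fun _ _ => rfl
  · rintro ⟨i, j⟩ h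
    simp only [Finset.mem_sigma, Finset.mem_univ, Finset.mem_Ioi, true_and] at h
    simp [mem_pairs, h.ne]
  · rintro ⟨i, j⟩ h ⟨i', j'⟩ h' heq
    simp only [Finset.coe_sigma, Set.mem_sigma_iff, Finset.mem_coe, Finset.mem_univ,
      Finset.mem_Ioi, true_and] at h h'
    rcases Sym2.eq_iff.1 heq with ⟨h1, h2⟩ | ⟨h1, h2⟩
    · dsimp only at h1 h2
      subst h1 h2
      rfl
    · dsimp only at h1 h2
      subst h1 h2
      exact absurd h (lt_asymm h')
  · intro z hz
    induction z with
    | _ i j =>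
      obtain ⟨-, -, hne⟩ := mem_pairs.1 hz
      rcases lt_or_gt_of_ne hne with h | h
      · exact ⟨⟨i, j⟩, by simp [h], rfl⟩
      · exact ⟨⟨j, i⟩, by simp [h], Sym2.eq_swap⟩

/-- Law of the edges given the labels. -/
def edgeWeight (k : Sym2 (Fin 2) → ℝ) (X : Fin n → Fin 2) : (Sym2 (Fin n) → Bool) → ℝ :=
  pinLaw (pairs Finset.univ) (fun z => bern (k (z.map X))) fun _ => false

lemma edgeWeight_eq_zero (X : Fin n → Fin 2) (e : Sym2 (Fin n) → Bool)
    (h : ∃ z ∉ pairs Finset.univ, e z ≠ false) : edgeWeight k X e = 0 := by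
  obtain ⟨z, hz, hne⟩ := h
  by_contra h0
  exact hne (pinLaw_ne_zero h0 hz)

lemma sum_edgeWeight (X : Fin n → Fin 2) : ∑ e, edgeWeight k X e = 1 := by
  rw [edgeWeight, sum_pinLaw]
  simp [bern]

lemma sbm_eq {M : Matrix (Fin 2) (Fin 2) ℝ} (hM : ∀ x y, M x y = k s(x, y))
    (X : Fin n → Fin 2) (G : SimpleGraph (Fin n)) :
    sbm n p M (X, G) = (∏ i, labelProb p (X i)) * edgeWeight k X (edgeFun G) := by
  unfold sbm
  congr 1
  have h1 : edgeWeight k X (edgeFun G) =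
      ∏ z ∈ pairs Finset.univ, bern (k (z.map X)) (edgeFun G z) := by
    unfold edgeWeight pinLaw
    rw [← Finset.prod_subset (Finset.subset_univ (pairs Finset.univ))]
    · exact Finset.prod_congr rfl fun z hz => if_pos hz
    · intro z _ hz
      have : z.IsDiag := by simpa [pairs] using hz
      rw [if_neg hz, if_pos (edgeFun_diag G this)]
  rw [h1, prod_pairs_univ]
  refine Finset.prod_congr rfl fun i _ => Finset.prod_congr rfl fun j _ => ?_
  simp only [edgeFun, SimpleGraph.mem_edgeSet, Sym2.map_mk, hM]
  split_ifs with h <;> simp [h, bern]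

/-- Conditioning on the label of one vertex. -/
lemma sum_labels_cond {ρ : Fin 2 → ℝ} (hρ : ∑ y, ρ y = 1) (v : Fin n) (x : Fin 2)
    (S : (Fin n → Fin 2) → ℝ) :
    ∑ X : Fin n → Fin 2, (if X v = x then (∏ j, ρ (X j)) * S X else 0) =
      ρ x * ∑ X, (∏ j, ρ (X j)) * S (({v} : Finset (Fin n)).piecewise (fun _ => x) X) := by
  have h1 := sum_resample hρ {v} (g := fun X => if X v = x then 1 else 0)
    (fun X X' h => by simp only [h v (by simp)]) S
  have h2 : ∀ X : Fin n → Fin 2, (if X v = x then (∏ j, ρ (X j)) * S X else 0) =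
      (∏ j, ρ (X j)) * (if X v = x then 1 else 0) * S X := fun X => by
    split_ifs <;> simp
  rw [Finset.sum_congr rfl fun X _ => h2 X, h1]
  have h3 : ∀ X : Fin n → Fin 2, (∏ j, ρ (X j)) * (if X v = x then 1 else 0) *
      ∑ X', (∏ j, ρ (X' j)) * S (({v} : Finset (Fin n)).piecewise X X') =
      (∏ j, ρ (X j)) * (∏ j ∈ {v}, if X j = x then 1 else 0) *
        ∑ X', (∏ j, ρ (X' j)) * S (({v} : Finset (Fin n)).piecewise (fun _ => x) X') := by
    intro X
    rw [Finset.prod_singleton]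
    split_ifs with hX
    · have : ∀ X' : Fin n → Fin 2, ({v} : Finset (Fin n)).piecewise X X' =
          ({v} : Finset (Fin n)).piecewise (fun _ => x) X' := fun X' => by
        funext j
        by_cases hj : j = v
        · subst hj
          simp [hX]
        · simp [hj]
      simp only [this]
    · simp
  rw [Finset.sum_congr rfl fun X _ => h3 X, ← Finset.sum_mul]
  congr 1
  have := sum_labels_prod hρ {v} fun _ y => if y = x then 1 else 0
  simpa using this

end Link

end SBM

namespace SBM

/-! ### The block model as the starting point of the exploration -/

section Link

set_option linter.unusedSectionVars false

variable {n : ℕ} {p : ℝ} {k : Sym2 (Fin 2) → ℝ} {r q : ℝ}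

lemma Sim.comp {X X' A B : Type*} [Fintype A] [Fintype B] {P : X → A → ℝ} {Q : X → B → ℝ} {ε : ℝ}
    (h : Sim P Q ε) (f : X' → X) : Sim (fun x => P (f x)) (fun x => Q (f x)) ε :=
  let ⟨κ, hκ, hb⟩ := h
  ⟨κ, hκ, fun x => hb (f x)⟩

lemma sum_labelProb (p : ℝ) : ∑ y, labelProb p y = 1 := by
  simp [labelProb]

lemma labelProb_pos (hp0 : 0 < p) (hp1 : p < 1) (x : Fin 2) : 0 < labelProb p x := by
  fin_cases x
  · simpa [labelProb] using hp0
  · simpa [labelProb] using hp1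

lemma edgeWeight_nonneg (h0 : ∀ z, 0 ≤ k z) (h1 : ∀ z, k z ≤ 1) (X : Fin n → Fin 2)
    (e : Sym2 (Fin n) → Bool) : 0 ≤ edgeWeight k X e :=
  pinLaw_nonneg _ (fun _ => bern_nonneg (h0 _) (h1 _)) _ _

lemma sbm_nonneg {M : Matrix (Fin 2) (Fin 2) ℝ} (hM : ∀ x y, M x y = k s(x, y))
    (h : Balanced (labelProb p) k r) (ω) : 0 ≤ sbm n p M ω := by
  obtain ⟨X, G⟩ := ω
  rw [sbm_eq hM]
  exact mul_nonneg (Finset.prod_nonneg fun _ _ => h.nonneg _)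
    (edgeWeight_nonneg h.k_nonneg h.k_le _ _)

lemma sum_sbm_graph {M : Matrix (Fin 2) (Fin 2) ℝ} (hM : ∀ x y, M x y = k s(x, y))
    (X : Fin n → Fin 2) (F : (Sym2 (Fin n) → Bool) → ℝ) :
    ∑ G, sbm n p M (X, G) * F (edgeFun G) =
      (∏ i, labelProb p (X i)) * ∑ e, edgeWeight k X e * F e := by
  simp only [sbm_eq hM, mul_assoc, ← Finset.mul_sum]
  rw [sum_edgeFun fun e => edgeWeight k X e * F e]
  intro e he
  rw [edgeWeight_eq_zero X e he, zero_mul]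

lemma prob_label_sbm {M : Matrix (Fin 2) (Fin 2) ℝ} (hM : ∀ x y, M x y = k s(x, y)) (v : Fin n)
    (x : Fin 2) : prob (sbm n p M) {ω | ω.1 v = x} = labelProb p x := by
  classical
  rw [prob_eq_sum, Fintype.sum_prod_type]
  have h1 : ∀ X : Fin n → Fin 2, (∑ G, if X v = x then sbm n p M (X, G) else 0) =
      if X v = x then (∏ i, labelProb p (X i)) * 1 else 0 := by
    intro X
    split_ifs
    · have := sum_sbm_graph (p := p) hM X fun _ => 1
      simpa [sum_edgeWeight] using this
    · simp
  rw [Finset.sum_congr rfl fun X _ => h1 X, sum_labels_cond (sum_labelProb p) v x fun _ => 1]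
  simp [sum_labels (V := Fin n) (sum_labelProb p)]

lemma condLaw_sbm {M : Matrix (Fin 2) (Fin 2) ℝ} (hM : ∀ x y, M x y = k s(x, y))
    (hp0 : 0 < p) (hp1 : p < 1) (v : Fin n) (x : Fin 2) (G : SimpleGraph (Fin n)) :
    condLaw (sbm n p M) (fun ω => ω.1) (fun ω => ω.2) v x G =
      edgeLaw (labelProb p) k Finset.univ {v} (fun _ => false) (fun _ => x) (edgeFun G) := by
  classical
  rw [condLaw, condProb, prob_label_sbm hM, div_eq_iff (labelProb_pos hp0 hp1 x).ne',
    prob_inter_eq_sum, Fintype.sum_prod_type, mul_comm]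
  have h1 : ∀ X : Fin n → Fin 2, (∑ G', if G' = G ∧ X v = x then sbm n p M (X, G') else 0) =
      if X v = x then (∏ i, labelProb p (X i)) * edgeWeight k X (edgeFun G) else 0 := by
    intro X
    rw [Finset.sum_eq_single G]
    · simp [sbm_eq hM]
    · intro G' _ hne
      simp [hne]
    · simp
  rw [Finset.sum_congr rfl fun X _ => h1 X, sum_labels_cond (sum_labelProb p) v x fun X =>
    edgeWeight k X (edgeFun G)]
  rfl

/-- Forgetting the revealed labels leaves the graph. This direction serves the upper bound:
additional labels can only help. -/
lemma sim_avgLaw_sbm {M : Matrix (Fin 2) (Fin 2) ℝ} (hM : ∀ x y, M x y = k s(x, y))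
    (hp0 : 0 < p) (hp1 : p < 1) (q : ℝ) (t : ℕ) (v : Fin n) :
    Sim (fun x => avgLaw (labelProb p) k q t Finset.univ {v} (fun _ => false) fun _ => x)
      (condLaw (sbm n p M) (fun ω => ω.1) (fun ω => ω.2) v) 0 := by
  classical
  refine Sim.of_map_eq (fun o => Function.invFun edgeFun o.1) fun x G => ?_
  set E := edgeLaw (labelProb p) k Finset.univ {v} (fun _ => false) (fun _ => x) with hE
  have h1 : ∀ e : Sym2 (Fin n) → Bool, ∑ τ, avgLaw (labelProb p) k q t Finset.univ {v}
      (fun _ => false) (fun _ => x) (e, τ) = E e := by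
    intro e
    unfold avgLaw graphLaw
    rw [Finset.sum_comm]
    simp only [← Finset.mul_sum, sum_forestLaw (sum_revealLaw q), mul_one]
    rfl
  rw [Fintype.sum_prod_type, condLaw_sbm hM hp0 hp1]
  have h2 : ∀ e : Sym2 (Fin n) → Bool, (∑ τ, if Function.invFun edgeFun e = G then
      avgLaw (labelProb p) k q t Finset.univ {v} (fun _ => false) (fun _ => x) (e, τ) else 0) =
      if Function.invFun edgeFun e = G then E e else 0 := by
    intro e
    split_ifs
    · exact h1 e
    · simp
  rw [Finset.sum_congr rfl fun e _ => h2 e,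
    ← sum_edgeFun fun e => if Function.invFun edgeFun e = G then E e else 0]
  · simp only [Function.leftInverse_invFun edgeFun_injective _]
    simp [hE]
  · intro e he
    have : E e = 0 := Finset.sum_eq_zero fun X _ => by
      have := edgeWeight_eq_zero (k := k) (({v} : Finset (Fin n)).piecewise (fun _ => x) X) e he
      rw [edgeWeight] at this
      rw [this, mul_zero]
    simp [this]

/-- Expanding `∏ j, (q * a j + (1 - q) * b j)` gives a sum over the sets of revealed vertices, where
`a j` and `b j` are the indicators that `τ j` is compatible with `j` being revealed or hidden. -/
lemma sum_reveal (R : Finset (Fin n)) (X : Fin n → Fin 2) (τ : Fin n → Option (Option (Fin 2))) :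
    (∑ A : Finset (Fin n), if (fun j => if j ∈ R then some (if j ∈ A then some (X j) else none)
        else none) = τ then q ^ A.card * (1 - q) ^ (n - A.card) else 0) =
      forestLaw (revealLaw q) R X τ := by
  set a : Fin n → ℝ := fun j => if (if j ∈ R then some (some (X j)) else none) = τ j then 1 else 0
    with ha
  set b : Fin n → ℝ := fun j => if (if j ∈ R then some none else none) = τ j then 1 else 0 with hb
  have h1 : forestLaw (revealLaw q) R X τ = ∏ j, (q * a j + (1 - q) * b j) := by
    refine Finset.prod_congr rfl fun j _ => ?_
    rcases h : τ j with _ | _ | y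
    · by_cases hj : j ∈ R <;> simp [ha, hb, hj, h]
    · by_cases hj : j ∈ R <;> simp [ha, hb, hj, h, revealLaw]
    · by_cases hj : j ∈ R <;> simp [ha, hb, hj, h, revealLaw, eq_comm]
  rw [h1, Fintype.prod_add]
  refine Finset.sum_congr rfl fun A _ => ?_
  simp only [Finset.prod_mul_distrib, Finset.prod_const, Finset.card_compl, Fintype.card_fin]
  split_ifs with h
  · have ha1 : ∏ j ∈ A, a j = 1 := Finset.prod_eq_one fun j hj => by
      simp only [ha, ← h, hj, if_true]
    have hb1 : ∏ j ∈ Aᶜ, b j = 1 := Finset.prod_eq_one fun j hj => by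
      simp only [hb, ← h, Finset.mem_compl.1 hj, if_true, if_false]
    rw [ha1, hb1]
    ring
  · obtain ⟨j, hj⟩ := Function.ne_iff.1 h
    by_cases hjA : j ∈ A
    · have : ∏ j ∈ A, a j = 0 := Finset.prod_eq_zero hjA (by simp_all)
      rw [this]
      ring
    · have : ∏ j ∈ Aᶜ, b j = 0 := Finset.prod_eq_zero (Finset.mem_compl.2 hjA) (by simp_all)
      rw [this]
      ring

lemma sum_reveal_univ (q : ℝ) (n : ℕ) :
    ∑ A : Finset (Fin n), q ^ A.card * (1 - q) ^ (n - A.card) = 1 := by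
  have := Fintype.prod_add (fun _ : Fin n => q) fun _ => 1 - q
  simpa [Finset.card_compl] using this.symm

lemma sbmReveal_nonneg {M : Matrix (Fin 2) (Fin 2) ℝ} (hM : ∀ x y, M x y = k s(x, y))
    (h : Balanced (labelProb p) k r) (h0 : 0 ≤ q) (h1 : q ≤ 1) (ω) : 0 ≤ sbmReveal n p M q ω :=
  mul_nonneg (sbm_nonneg hM h _) (mul_nonneg (pow_nonneg h0 _) (pow_nonneg (sub_nonneg.2 h1) _))

lemma prob_label_sbmReveal {M : Matrix (Fin 2) (Fin 2) ℝ} (hM : ∀ x y, M x y = k s(x, y))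
    (v : Fin n) (x : Fin 2) :
    prob (sbmReveal n p M q) {ω | ω.1.1 v = x} = labelProb p x := by
  classical
  rw [← prob_label_sbm (n := n) (p := p) hM v x, prob_eq_sum, prob_eq_sum, Fintype.sum_prod_type]
  refine Finset.sum_congr rfl fun ω _ => ?_
  simp only [sbmReveal]
  split_ifs
  · rw [← Finset.mul_sum, sum_reveal_univ, mul_one]
  · simp

/-- Only the revealed labels at distance `t` from `v` are kept. This direction serves the lower
bound. -/
lemma sim_sbmReveal_avgLaw {M : Matrix (Fin 2) (Fin 2) ℝ} (hM : ∀ x y, M x y = k s(x, y))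
    (hp0 : 0 < p) (hp1 : p < 1) (q : ℝ) (t : ℕ) (v : Fin n) :
    Sim (condLaw (sbmReveal n p M q) (fun ω => ω.1.1) observeReveal v)
      (fun x => avgLaw (labelProb p) k q t Finset.univ {v} (fun _ => false) fun _ => x) 0 := by
  classical
  set φ : SimpleGraph (Fin n) × (Fin n → Option (Fin 2)) →
      (Sym2 (Fin n) → Bool) × (Fin n → Option (Option (Fin 2))) := fun o =>
    (edgeFun o.1, fun j => if j ∈ ring t Finset.univ {v} (edgeFun o.1) then some (o.2 j) else none)
    with hφ
  refine Sim.of_map_eq φ fun x b => ?_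
  obtain ⟨e, τ⟩ := b
  have h1 := prob_preimage_inter (sbmReveal n p M q) observeReveal
    (fun o => φ o = (e, τ)) fun ω => ω.1.1 v = x
  have h2 : (∑ o, if φ o = (e, τ) then
      condLaw (sbmReveal n p M q) (fun ω => ω.1.1) observeReveal v x o else 0) =
      prob (sbmReveal n p M q) ({ω | φ (observeReveal ω) = (e, τ)} ∩ {ω | ω.1.1 v = x}) /
        labelProb p x := by
    rw [h1, Finset.sum_div]
    refine Finset.sum_congr rfl fun o _ => ?_
    split_ifs
    · rw [condLaw, condProb, prob_label_sbmReveal hM]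
    · simp
  rw [h2, div_eq_iff (labelProb_pos hp0 hp1 x).ne', prob_inter_eq_sum,
    Fintype.sum_prod_type, Fintype.sum_prod_type]
  have h3 : ∀ (X : Fin n → Fin 2) (G : SimpleGraph (Fin n)),
      (∑ A : Finset (Fin n), if φ (observeReveal ((X, G), A)) = (e, τ) ∧ X v = x then
        sbmReveal n p M q ((X, G), A) else 0) =
      if X v = x then sbm n p M (X, G) * (if edgeFun G = e then
        forestLaw (revealLaw q) (ring t Finset.univ {v} e) X τ else 0) else 0 := by
    intro X G
    by_cases hX : X v = x
    · by_cases hG : edgeFun G = e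
      · simp only [hX, hG, if_true, and_true]
        rw [← sum_reveal, Finset.mul_sum]
        refine Finset.sum_congr rfl fun A _ => ?_
        simp only [hφ, observeReveal, hG, Prod.mk.injEq, true_and, sbmReveal, mul_ite, mul_zero]
      · simp [hφ, observeReveal, hG]
    · simp [hX]
  have h4 : ∀ X : Fin n → Fin 2, (∑ G, ∑ A : Finset (Fin n),
      if φ (observeReveal ((X, G), A)) = (e, τ) ∧ X v = x then
        sbmReveal n p M q ((X, G), A) else 0) =
      if X v = x then (∏ j, labelProb p (X j)) *
        graphLaw k q t Finset.univ {v} (fun _ => false) X (e, τ) else 0 := by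
    intro X
    rw [Finset.sum_congr rfl fun G _ => h3 X G]
    split_ifs
    · rw [sum_sbm_graph hM X fun e' => if e' = e then
        forestLaw (revealLaw q) (ring t Finset.univ {v} e) X τ else 0]
      simp only [mul_ite, mul_zero, Finset.sum_ite_eq', Finset.mem_univ, if_true]
      rfl
    · simp
  rw [Finset.sum_congr rfl fun X _ => h4 X, sum_labels_cond (sum_labelProb p) v x, mul_comm]
  rfl

/-- A forest with one root is a tree. -/
lemma sim_forest_tree {A : Type} [Fintype A] [Nonempty A] {P : Fin 2 → A → ℝ} (v : Fin n) :
    Sim (fun x => forestLaw P {v} fun _ => x) P 0 ∧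
      Sim P (fun x => forestLaw P {v} fun _ => x) 0 := by
  classical
  have key : ∀ x (τ : Fin n → Option A), forestLaw P {v} (fun _ => x) τ =
      ∑ a, if (fun j => if j = v then some a else none) = τ then P x a else 0 := by
    intro x τ
    by_cases hτ : ∃ a, (fun j => if j = v then some a else none) = τ
    · obtain ⟨a, rfl⟩ := hτ
      rw [Finset.sum_eq_single a]
      · rw [if_pos rfl, forestLaw, Finset.prod_eq_single v]
        · simp
        · intro j _ hj
          simp [hj]
        · simp
      · intro a' _ ha'
        rw [if_neg]
        intro h
        have := congrFun h v
        simp [ha'] at this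
      · simp
    · rw [Finset.sum_eq_zero fun a _ => if_neg fun h => hτ ⟨a, h⟩]
      by_contra h0
      have h1 := forestLaw_ne_zero h0
      obtain ⟨a, ha⟩ := Option.ne_none_iff_exists'.1 ((h1 v).2 (by simp))
      refine hτ ⟨a, funext fun j => ?_⟩
      by_cases hj : j = v
      · subst hj
        simp [ha]
      · have : τ j = none := by
          by_contra hne
          exact hj (by simpa using (h1 j).1 hne)
        simp [hj, this]
  constructor
  · refine Sim.of_map_eq (fun τ => (τ v).getD (Classical.arbitrary A)) fun x a => ?_
    simp only [key]
    calc _ = ∑ τ : Fin n → Option A, ∑ a', if (fun j => if j = v then some a' else none) = τ then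
          (if a' = a then P x a' else 0) else 0 := by
          refine Finset.sum_congr rfl fun τ _ => ?_
          have hite : ∀ (c : Prop) [Decidable c] (f : A → ℝ),
              (if c then ∑ a, f a else 0) = ∑ a, if c then f a else 0 := fun c _ f => by
            split_ifs <;> simp
          rw [hite]
          refine Finset.sum_congr rfl fun a' _ => ?_
          by_cases h : (fun j => if j = v then some a' else none) = τ
          · subst h
            simp
          · simp [h]
      _ = P x a := by
          rw [Finset.sum_comm]
          simp
  · exact Sim.of_map_eq (fun a j => if j = v then some a else none) fun x τ => (key x τ).symm

/-- Success probability of the optimal test that observes the graph, in terms of trees. -/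
lemma optSuccess_eq {M : Matrix (Fin 2) (Fin 2) ℝ} (hM : ∀ x y, M x y = k s(x, y))
    (h : Balanced (labelProb p) k r) (hp0 : 0 < p) (hp1 : p < 1) :
    optSuccess n p M = 1 / (n : ℝ) * ∑ v,
      l1 (condLaw (sbm n p M) (fun ω => ω.1) (fun ω => ω.2) v 0)
        (condLaw (sbm n p M) (fun ω => ω.1) (fun ω => ω.2) v 1) / 2 :=
  successProb_optTest (sbm_nonneg hM h) _ _ hp0 hp1 fun v x => prob_label_sbm hM v x

lemma optSuccessReveal_eq {M : Matrix (Fin 2) (Fin 2) ℝ} (hM : ∀ x y, M x y = k s(x, y))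
    (h : Balanced (labelProb p) k r) (hp0 : 0 < p) (hp1 : p < 1) (h0 : 0 ≤ q) (h1 : q ≤ 1) :
    optSuccessReveal n p M q = 1 / (n : ℝ) * ∑ v,
      l1 (condLaw (sbmReveal n p M q) (fun ω => ω.1.1) observeReveal v 0)
        (condLaw (sbmReveal n p M q) (fun ω => ω.1.1) observeReveal v 1) / 2 :=
  successProb_optTest (sbmReveal_nonneg hM h h0 h1) _ _ hp0 hp1 fun v x =>
    prob_label_sbmReveal hM v x

end Link

/-! ### Comparison with trees for large `n` -/

section Limits

variable {p C q : ℝ} {k : ℕ → Sym2 (Fin 2) → ℝ} {r : ℕ → ℝ}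
  {M : ℕ → Matrix (Fin 2) (Fin 2) ℝ}

lemma average_le {n : ℕ} (hn : n ≠ 0) {f : Fin n → ℝ} {a : ℝ} (h : ∀ v, f v ≤ a) :
    1 / (n : ℝ) * ∑ v, f v ≤ a := by
  have hn' : (0 : ℝ) < n := by positivity
  rw [one_div, inv_mul_le_iff₀ hn']
  simpa using Finset.sum_le_card_nsmul Finset.univ f a fun v _ => h v

lemma le_average {n : ℕ} (hn : n ≠ 0) {f : Fin n → ℝ} {a : ℝ} (h : ∀ v, a ≤ f v) :
    a ≤ 1 / (n : ℝ) * ∑ v, f v := by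
  have hn' : (0 : ℝ) < n := by positivity
  rw [one_div, le_inv_mul_iff₀ hn']
  simpa using Finset.card_nsmul_le_sum Finset.univ f a fun v _ => h v

/-- The success probability without side information is asymptotically at most the total variation
distance for trees whose leaves are revealed. -/
lemma eventually_optSuccess_le (hp0 : 0 < p) (hp1 : p < 1) (hM : ∀ n x y, M n x y = k n s(x, y))
    (hbal : ∀ᶠ n in atTop, Balanced (labelProb p) (k n) (r n))
    (hk : ∀ n z, k n z ≤ C / n) (hr : ∀ n, r n ≤ C / n) (t : ℕ) {δ : ℝ} (hδ : 0 < δ) :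
    ∀ᶠ n in atTop, optSuccess n p (M n) ≤
      l1 (treeLaw (labelProb p) (k n) (r n) 1 (Fin n) t 0)
        (treeLaw (labelProb p) (k n) (r n) 1 (Fin n) t 1) / 2 + δ := by
  filter_upwards [hbal, eventually_sim_forest_graph hbal hk hr t 1 hδ, eventually_ne_atTop 0]
    with n h hS hn
  rw [optSuccess_eq (hM n) h hp0 hp1]
  refine average_le hn fun v => ?_
  have h1 := (sim_forest_tree (P := treeLaw (labelProb p) (k n) (r n) 1 (Fin n) t) v).2
  have h2 := (hS Finset.univ {v} (fun _ => false) (Finset.subset_univ _) (by simp)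
    (by simp)).comp fun (x : Fin 2) (_ : Fin n) => x
  -- The tree simulates the graph, so its two laws are at least as far apart, up to `2 * δ` in `ℓ¹`,
  -- which is `δ` in total variation.
  have h3 := ((h1.trans h2).trans (sim_avgLaw_sbm (hM n) hp0 hp1 1 t v)).l1_le 0 1
  linarith

/-- The success probability with side information is asymptotically at least the total variation
distance for trees whose leaves are revealed with probability `q`. -/
lemma eventually_le_optSuccessReveal (hp0 : 0 < p) (hp1 : p < 1)
    (hM : ∀ n x y, M n x y = k n s(x, y))
    (hbal : ∀ᶠ n in atTop, Balanced (labelProb p) (k n) (r n))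
    (hk : ∀ n z, k n z ≤ C / n) (hr : ∀ n, r n ≤ C / n) (h0 : 0 ≤ q) (h1 : q ≤ 1) (t : ℕ)
    {δ : ℝ} (hδ : 0 < δ) :
    ∀ᶠ n in atTop, l1 (treeLaw (labelProb p) (k n) (r n) q (Fin n) t 0)
        (treeLaw (labelProb p) (k n) (r n) q (Fin n) t 1) / 2 - δ ≤
      optSuccessReveal n p (M n) q := by
  filter_upwards [hbal, eventually_sim_graph_forest hbal hk hr h0 h1 t 1 hδ, eventually_ne_atTop 0]
    with n h hS hn
  rw [optSuccessReveal_eq (hM n) h hp0 hp1 h0 h1]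
  refine le_average hn fun v => ?_
  have h1 := (sim_forest_tree (P := treeLaw (labelProb p) (k n) (r n) q (Fin n) t) v).1
  have h2 := (hS Finset.univ {v} (fun _ => false) (Finset.subset_univ _) (by simp)
    (by simp)).comp fun (x : Fin 2) (_ : Fin n) => x
  have h3 := (((sim_sbmReveal_avgLaw (hM n) hp0 hp1 q t v).trans h2).trans h1).l1_le 0 1
  linarith

end Limits

end SBM

namespace SBM

/-! ### Expansion of the log-likelihood ratio and its characteristic function -/

section Expansion

open Asymptotics

/-- Log-likelihood ratio of a child with local bias `u`. -/
def llr (p u : ℝ) : ℝ := Real.log (1 - p * u) - Real.log (1 + (1 - p) * u)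

theorem log_one_add_isBigO :
    (fun x : ℝ => Real.log (1 + x) - (x - x ^ 2 / 2)) =O[𝓝 0] fun x => x ^ 3 := by
  refine IsBigO.of_bound 2 ?_
  have : ∀ᶠ x : ℝ in 𝓝 0, |x| < 1 / 2 := by
    have := (continuous_abs (G := ℝ)).tendsto' 0 0 abs_zero
    exact this.eventually (gt_mem_nhds (by norm_num))
  filter_upwards [this] with x hx
  have h := Real.abs_log_sub_add_sum_range_le (x := -x) (by rw [abs_neg]; linarith) 2
  simp only [Finset.sum_range_succ, Finset.sum_range_zero, abs_neg] at h
  have e : Real.log (1 + x) - (x - x ^ 2 / 2) =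
      0 + (-x) ^ (0 + 1) / (((0 : ℕ) : ℝ) + 1) + (-x) ^ (1 + 1) / (((1 : ℕ) : ℝ) + 1) +
        Real.log (1 - -x) := by
    rw [sub_neg_eq_add]; push_cast; ring
  rw [Real.norm_eq_abs, e, norm_pow, Real.norm_eq_abs]
  refine h.trans ?_
  rw [div_le_iff₀ (by linarith)]
  have : 0 ≤ |x| ^ 3 := by positivity
  norm_num
  nlinarith

theorem llr_isBigO (p : ℝ) :
    (fun u : ℝ => llr p u - (-u + (1 - 2 * p) / 2 * u ^ 2)) =O[𝓝 0] fun u => u ^ 3 := by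
  have key : ∀ c : ℝ, (fun u : ℝ => Real.log (1 + c * u) - (c * u - (c * u) ^ 2 / 2))
      =O[𝓝 0] fun u => u ^ 3 := by
    intro c
    have h := log_one_add_isBigO.comp_tendsto
      ((continuous_const_mul c).tendsto' (0 : ℝ) 0 (mul_zero c))
    refine h.trans ?_
    refine IsBigO.of_bound (|c| ^ 3) (Eventually.of_forall fun u => ?_)
    simp [mul_pow]
  refine ((key (-p)).sub (key (1 - p))).congr_left fun u => ?_
  simp only [llr, neg_mul, ← sub_eq_add_neg]
  ring

theorem llr_isBigO_id (p : ℝ) : (fun u : ℝ => llr p u) =O[𝓝 0] fun u => u := by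
  have h3 : (fun u : ℝ => u ^ 3) =O[𝓝 0] fun u : ℝ => u := by
    simpa using (isLittleO_pow_pow (𝕜 := ℝ) (show 1 < 3 by norm_num)).isBigO
  have h2 : (fun u : ℝ => u ^ 2) =O[𝓝 0] fun u : ℝ => u := by
    simpa using (isLittleO_pow_pow (𝕜 := ℝ) (show 1 < 2 by norm_num)).isBigO
  refine (((llr_isBigO p).trans h3).add ((isBigO_refl (fun u : ℝ => u) _).neg_left.add
    (h2.const_mul_left ((1 - 2 * p) / 2)))).congr_left fun u => ?_
  ring

/-- Contribution of a child with local bias `u` to the characteristic function. -/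
def charTerm (p t u : ℝ) : ℂ :=
  ((1 + (1 - p) * u : ℝ) : ℂ) * (Complex.exp ((llr p u : ℂ) * t * Complex.I) - 1)

/-- Tilting by `1 + (1 - p) * u` combines with the quadratic term of `llr` so that `p` disappears at
second order. For a centered `u` the linear term averages out, and the quadratic one is the exponent
of a normal law whose mean is minus half its variance. -/
theorem charTerm_isLittleO (p t : ℝ) :
    (fun u : ℝ => charTerm p t u -
      (-(t * Complex.I) * u - (t * Complex.I + t ^ 2) / 2 * u ^ 2)) =o[𝓝 0]
      fun u : ℝ => u ^ 2 := by
  have h32 : (fun u : ℝ => u ^ 3) =o[𝓝 0] fun u : ℝ => u ^ 2 := isLittleO_pow_pow (by norm_num)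
  refine IsBigO.trans_isLittleO ?_ h32
  have hL : (fun u : ℝ => ((llr p u : ℝ) : ℂ)) =O[𝓝 0] fun u : ℝ => u :=
    (llr_isBigO_id p).norm_left.congr_left (fun u => by simp) |>.of_norm_left
  have hρ : (fun u : ℝ => ((llr p u - (-u + (1 - 2 * p) / 2 * u ^ 2) : ℝ) : ℂ)) =O[𝓝 0]
      fun u : ℝ => u ^ 3 := by
    refine IsBigO.of_norm_left ((llr_isBigO p).norm_left.congr_left fun u => ?_)
    rw [Complex.norm_real]
  have hid : (fun u : ℝ => (u : ℂ)) =O[𝓝 0] fun u : ℝ => u :=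
    IsBigO.of_norm_left ((isBigO_refl (fun u : ℝ => u) (𝓝 0)).norm_left.congr_left fun u => by simp)
  have hone : (fun u : ℝ => ((1 + (1 - p) * u : ℝ) : ℂ)) =O[𝓝 0] fun _ : ℝ => (1 : ℝ) := by
    refine Tendsto.isBigO_one (c := ((1 + (1 - p) * 0 : ℝ) : ℂ)) ℝ ?_
    exact Continuous.tendsto (by fun_prop) 0
  have hz : (fun u : ℝ => (llr p u : ℂ) * t * Complex.I) =O[𝓝 0] fun u : ℝ => u := by
    refine (hL.const_mul_left (t * Complex.I)).congr_left fun u => by ring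
  have hE : (fun u : ℝ => Complex.exp ((llr p u : ℂ) * t * Complex.I) -
      (1 + (llr p u : ℂ) * t * Complex.I + ((llr p u : ℂ) * t * Complex.I) ^ 2 / 2))
      =O[𝓝 0] fun u : ℝ => u ^ 3 := by
    have hz0 : Tendsto (fun u : ℝ => (llr p u : ℂ) * t * Complex.I) (𝓝 0) (𝓝 0) :=
      hz.trans_tendsto tendsto_id
    refine (((Complex.exp_sub_sum_range_isBigO_pow 3).comp_tendsto hz0).congr_left
      fun u => ?_).trans (hz.pow 3)
    simp [Finset.sum_range_succ, Nat.factorial]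
  have hLp : (fun u : ℝ => (llr p u : ℂ) + u) =O[𝓝 0] fun u : ℝ => u ^ 2 := by
    refine ((hρ.trans h32.isBigO).add
      ((hid.pow 2).const_mul_left (((1 - 2 * p) / 2 : ℝ) : ℂ))).congr_left fun u => ?_
    push_cast; ring
  have hLm : (fun u : ℝ => (llr p u : ℂ) - u) =O[𝓝 0] fun u : ℝ => u := hL.sub hid
  have hLL : (fun u : ℝ => ((llr p u : ℂ) + u) * ((llr p u : ℂ) - u)) =O[𝓝 0]
      fun u : ℝ => u ^ 3 := (hLp.mul hLm).congr_right fun u => by ring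
  have hu3 : (fun u : ℝ => (u : ℂ) ^ 3) =O[𝓝 0] fun u : ℝ => u ^ 3 := hid.pow 3
  have h1 := (hone.mul hE).congr_right fun u => one_mul _
  have h2 := ((hone.mul hρ).congr_right fun u => one_mul _).const_mul_left (t * Complex.I)
  have h3 := ((hone.mul hLL).congr_right fun u => one_mul _).const_mul_left
    ((t * Complex.I) ^ 2 / 2)
  have h4 := hu3.const_mul_left
    (t * Complex.I * ((1 - 2 * p) / 2) * (1 - p) - (t : ℂ) ^ 2 * (1 - p) / 2)
  refine (((h1.add h2).add h3).add h4).congr_left fun u => ?_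
  simp only [charTerm]
  push_cast
  generalize Complex.exp ((llr p u : ℂ) * t * Complex.I) = e
  ring_nf
  simp only [Complex.I_sq]
  ring

/-- Telescoping `a ^ n - b ^ n` with `a = 1 + z / n` and `b = exp (z / n)`, where `‖a - b‖ ≤ ‖z / n‖
^ 2`. An explicit bound is needed because `z` varies with `n`. -/
theorem norm_one_add_div_pow_sub_exp_le {n : ℕ} (hn : 0 < n) (z : ℂ) (hz : ‖z‖ ≤ n) :
    ‖(1 + z / n) ^ n - Complex.exp z‖ ≤ ‖z‖ ^ 2 / n * Real.exp ‖z‖ := by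
  have hn' : (0 : ℝ) < n := by exact_mod_cast hn
  set w : ℂ := z / n
  have hw : ‖w‖ = ‖z‖ / n := by simp [w]
  have hw1 : ‖w‖ ≤ 1 := by rw [hw, div_le_one hn']; exact hz
  have hexp : Complex.exp z = Complex.exp w ^ n := by
    rw [← Complex.exp_nat_mul]
    congr 1
    have : (n : ℂ) ≠ 0 := by exact_mod_cast hn.ne'
    exact (mul_div_cancel₀ z this).symm
  have ha : ‖1 + w‖ ≤ Real.exp ‖w‖ := by
    refine (norm_add_le _ _).trans ?_
    rw [norm_one, add_comm]; exact Real.add_one_le_exp _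
  have hb : ‖Complex.exp w‖ ≤ Real.exp ‖w‖ := Complex.norm_exp_le_exp_norm w
  have hab : ‖1 + w - Complex.exp w‖ ≤ ‖w‖ ^ 2 := by
    rw [norm_sub_rev, ← sub_sub]
    exact Complex.norm_exp_sub_one_sub_id_le hw1
  rw [hexp, ← (Commute.all (1 + w) (Complex.exp w)).mul_geom_sum₂ n, norm_mul]
  have hs : ‖∑ i ∈ Finset.range n, (1 + w) ^ i * Complex.exp w ^ (n - 1 - i)‖ ≤
      n * Real.exp ‖z‖ := by
    refine (norm_sum_le _ _).trans ?_
    calc _ ≤ ∑ i ∈ Finset.range n, Real.exp ‖z‖ := by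
          refine Finset.sum_le_sum fun i hi => ?_
          rw [norm_mul, norm_pow, norm_pow]
          calc _ ≤ Real.exp ‖w‖ ^ i * Real.exp ‖w‖ ^ (n - 1 - i) := by gcongr
            _ ≤ Real.exp ‖w‖ ^ n := by
              rw [← pow_add]
              exact pow_le_pow_right₀ (Real.one_le_exp (norm_nonneg _)) (by
                have := Finset.mem_range.1 hi; omega)
            _ = Real.exp ‖z‖ := by
              rw [← Real.exp_nat_mul, hw]; congr 1; field_simp
      _ = _ := by simp
  calc _ ≤ ‖w‖ ^ 2 * (n * Real.exp ‖z‖) := by gcongr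
    _ = _ := by rw [hw]; field_simp

end Expansion

end SBM

namespace SBM

/-! ### Central limit theorem for one level of a tree -/

open MeasureTheory ProbabilityTheory BoundedContinuousFunction

/-- Expectation of `Φ` under the normal law with mean `-μ / 2` and variance `μ`. -/
def gaussMean (Φ : ℝ → ℝ) (μ : ℝ) : ℝ := ∫ z, Φ (√μ * z - μ / 2) ∂(gaussianReal 0 1)

theorem gaussianReal_neg_half {μ : ℝ} (hμ : 0 ≤ μ) :
    gaussianReal (-μ / 2) μ.toNNReal =
      (gaussianReal 0 1).map fun z => √μ * z - μ / 2 := by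
  have h1 := gaussianReal_map_const_mul (μ := 0) (v := 1) (√μ)
  have h2 := gaussianReal_map_sub_const (μ := 0) (v := μ.toNNReal) (μ / 2)
  have hv : NNReal.mk (√μ ^ 2) (sq_nonneg _) * 1 = μ.toNNReal := by
    ext; simp [Real.sq_sqrt hμ, hμ]
  rw [hv, mul_zero] at h1
  rw [← h1, Measure.map_map (by fun_prop) (by fun_prop)] at h2
  rw [show -μ / 2 = 0 - μ / 2 by ring, ← h2]
  rfl

theorem integral_gaussianReal_neg_half {μ : ℝ} (hμ : 0 ≤ μ) (Φ : ℝ →ᵇ ℝ) :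
    ∫ x, Φ x ∂(gaussianReal (-μ / 2) μ.toNNReal) = gaussMean Φ μ := by
  rw [gaussianReal_neg_half hμ, integral_map (by fun_prop)
    Φ.continuous.aestronglyMeasurable]
  rfl

theorem continuous_gaussMean (Φ : ℝ →ᵇ ℝ) : Continuous (gaussMean Φ) := by
  refine continuous_of_dominated (F := fun μ z => Φ (√μ * z - μ / 2)) (bound := fun _ => ‖Φ‖)
    (fun μ => ?_) (fun μ => ?_) (integrable_const _) ?_
  · exact (Φ.continuous.comp (by fun_prop)).aestronglyMeasurable
  · exact Eventually.of_forall fun z => Φ.norm_coe_le_norm _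
  · exact Eventually.of_forall fun z => Φ.continuous.comp (by fun_prop)

/-- One level of a tree: `n` slots, each used with probability `d / n`, and a centered bias `g` of
the observation in a used slot, scaled by `s` with `d * s ^ 2 = lam`. -/
structure Config (p lam : ℝ) where
  A : Type
  [fin : Fintype A]
  R : A → ℝ
  g : A → ℝ
  d : ℝ
  s : ℝ
  n : ℕ
  R_nonneg : ∀ o, 0 ≤ R o
  R_sum : ∑ o, R o = 1
  mean_zero : ∑ o, R o * g o = 0
  g_le : ∀ o, |g o| ≤ 1 / (p * (1 - p))
  small : ∀ o, |s * g o| ≤ 1 / 2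
  one_le_d : 1 ≤ d
  d_le_n : d ≤ n
  d_mul : d * s ^ 2 = lam

attribute [instance] Config.fin

namespace Config

variable {p lam : ℝ} (C : Config p lam)

/-- The parent is in community 1 for `e = 1 - p` and in community 2 for `e = -p`. -/
def slot (e : ℝ) : Option C.A → ℝ
  | none => 1 - C.d / C.n
  | some o => C.d / C.n * (C.R o * (1 + e * (C.s * C.g o)))

/-- Log-likelihood ratio of community 2 against community 1. An unused slot carries no information
because the mean degrees agree. -/
def score : Option C.A → ℝ
  | none => 0
  | some o => llr p (C.s * C.g o)

/-- `chi-square` information of the observation in a used slot. -/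
def chi : ℝ := ∑ o, C.R o * C.g o ^ 2

/-- Expectation of `Φ` of the total log-likelihood ratio. -/
def mean (Φ : ℝ → ℝ) : ℝ :=
  ∑ f : Fin C.n → Option C.A, (∏ j, C.slot (1 - p) (f j)) * Φ (∑ j, C.score (f j))

theorem n_pos : 0 < C.n := by
  have := C.one_le_d.trans C.d_le_n
  exact_mod_cast lt_of_lt_of_le one_pos this

theorem slot_nonneg {e : ℝ} (he : |e| ≤ 1) (a : Option C.A) : 0 ≤ C.slot e a := by
  have hn : (0 : ℝ) < C.n := by exact_mod_cast C.n_pos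
  have hd := C.one_le_d
  cases a with
  | none =>
    simp only [slot, sub_nonneg]
    exact (div_le_one hn).2 C.d_le_n
  | some o =>
    have h1 : |e * (C.s * C.g o)| ≤ 1 := by
      rw [abs_mul]
      have := C.small o
      nlinarith [abs_nonneg e, abs_nonneg (C.s * C.g o)]
    have h2 := (abs_le.1 h1).1
    simp only [slot]
    refine mul_nonneg (by positivity) (mul_nonneg (C.R_nonneg o) (by linarith))

theorem sum_slot (e : ℝ) : ∑ a, C.slot e a = 1 := by
  have : ∑ o, C.R o * (1 + e * (C.s * C.g o)) = 1 := by
    have h : ∀ o, C.R o * (1 + e * (C.s * C.g o)) = C.R o + e * C.s * (C.R o * C.g o) := by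
      intro o; ring
    simp_rw [h, Finset.sum_add_distrib, ← Finset.mul_sum, C.mean_zero, C.R_sum]
    ring
  simp only [Fintype.sum_option, slot, ← Finset.mul_sum, this]
  ring

/-- Law of the total log-likelihood ratio. -/
def law : Measure ℝ :=
  ∑ f : Fin C.n → Option C.A,
    ENNReal.ofReal (∏ j, C.slot (1 - p) (f j)) • Measure.dirac (∑ j, C.score (f j))

variable (hp0 : 0 < p) (hp1 : p < 1)
include hp0 hp1

theorem weight_nonneg (f : Fin C.n → Option C.A) : 0 ≤ ∏ j, C.slot (1 - p) (f j) :=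
  Finset.prod_nonneg fun j _ => C.slot_nonneg (abs_le.2 ⟨by linarith, by linarith⟩) _

theorem isProbabilityMeasure_law : IsProbabilityMeasure C.law := by
  refine ⟨?_⟩
  simp only [law, Measure.coe_finsetSum, Finset.sum_apply, Measure.smul_apply, measure_univ,
    smul_eq_mul, mul_one]
  rw [← ENNReal.ofReal_sum_of_nonneg fun f _ => C.weight_nonneg hp0 hp1 f,
    sum_pi_prod (fun _ => C.slot (1 - p))]
  simp [C.sum_slot]

theorem integral_law {E : Type*} [NormedAddCommGroup E] [NormedSpace ℝ E] [CompleteSpace E]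
    (Φ : ℝ → E) :
    ∫ x, Φ x ∂C.law =
      ∑ f : Fin C.n → Option C.A, (∏ j, C.slot (1 - p) (f j)) • Φ (∑ j, C.score (f j)) := by
  rw [law, integral_finsetSum_measure]
  · refine Finset.sum_congr rfl fun f _ => ?_
    rw [integral_smul_measure, integral_dirac, ENNReal.toReal_ofReal (C.weight_nonneg hp0 hp1 f)]
  · intro f _
    exact (integrable_dirac (by simp)).smul_measure (by simp)

/-- The slots are independent and identically distributed, which gives an `n`-th power. A slot is
used with probability `d / n` and has score `0` otherwise, so the base is `1 + O(1 / n)` for a fixed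
degree. -/
theorem charFun_law (t : ℝ) :
    charFun C.law t =
      (1 + (C.d * ∑ o, (C.R o : ℂ) * charTerm p t (C.s * C.g o)) / C.n) ^ C.n := by
  rw [charFun_apply_real, C.integral_law hp0 hp1]
  have h1 : ∀ f : Fin C.n → Option C.A,
      (∏ j, C.slot (1 - p) (f j)) • Complex.exp (t * ((∑ j, C.score (f j) : ℝ) : ℂ) * Complex.I) =
        ∏ j, ((C.slot (1 - p) (f j) : ℂ) *
          Complex.exp ((C.score (f j) : ℂ) * t * Complex.I)) := by
    intro f
    rw [Finset.prod_mul_distrib, ← Complex.exp_sum, Complex.real_smul]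
    push_cast
    rw [Finset.mul_sum, Finset.sum_mul]
    congr 3
    ext j
    ring
  simp_rw [h1]
  have h0 := Finset.prod_univ_sum (fun _ : Fin C.n => (Finset.univ : Finset (Option C.A)))
    fun _ a => (C.slot (1 - p) a : ℂ) * Complex.exp ((C.score a : ℂ) * t * Complex.I)
  rw [Fintype.piFinset_univ] at h0
  rw [← h0, Finset.prod_const, Finset.card_univ, Fintype.card_fin]
  congr 1
  have h2 : (∑ a, (C.slot (1 - p) a : ℂ)) = 1 := by exact_mod_cast C.sum_slot (1 - p)
  have h3 : ∑ a, (C.slot (1 - p) a : ℂ) * Complex.exp ((C.score a : ℂ) * t * Complex.I) =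
      1 + ∑ a, (C.slot (1 - p) a : ℂ) * (Complex.exp ((C.score a : ℂ) * t * Complex.I) - 1) := by
    simp_rw [mul_sub, mul_one]
    rw [Finset.sum_sub_distrib, h2]
    ring
  rw [h3, Fintype.sum_option]
  simp only [score, slot, charTerm, Complex.ofReal_zero, zero_mul, Complex.exp_zero, sub_self,
    mul_zero, zero_add]
  congr 1
  rw [Finset.mul_sum, Finset.sum_div]
  refine Finset.sum_congr rfl fun o _ => ?_
  push_cast
  ring

omit hp0 hp1 in
theorem chi_nonneg : 0 ≤ C.chi :=
  Finset.sum_nonneg fun o _ => mul_nonneg (C.R_nonneg o) (sq_nonneg _)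

omit hp0 hp1 in
theorem chi_le : C.chi ≤ (1 / (p * (1 - p))) ^ 2 := by
  have : ∑ o, C.R o * (1 / (p * (1 - p))) ^ 2 = (1 / (p * (1 - p))) ^ 2 := by
    rw [← Finset.sum_mul, C.R_sum, one_mul]
  rw [← this]
  refine Finset.sum_le_sum fun o _ => mul_le_mul_of_nonneg_left ?_ (C.R_nonneg o)
  exact sq_le_sq' (abs_le.1 (C.g_le o)).1 (abs_le.1 (C.g_le o)).2

omit hp0 hp1 in
theorem lam_nonneg (C : Config p lam) : 0 ≤ lam := by
  rw [← C.d_mul]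
  exact mul_nonneg (by linarith [C.one_le_d]) (sq_nonneg _)

/-- Averaging the second-order expansion: the linear term drops out by `mean_zero`, and `d * s ^ 2 =
lam` turns the quadratic term into `lam * chi`. -/
theorem norm_charTerm_sum_le {t η δ : ℝ}
    (hη : ∀ u : ℝ, |u| ≤ δ → ‖charTerm p t u -
      (-(t * Complex.I) * u - (t * Complex.I + t ^ 2) / 2 * u ^ 2)‖ ≤ η * u ^ 2)
    (hδ : ∀ o, |C.s * C.g o| ≤ δ) :
    ‖(C.d : ℂ) * ∑ o, (C.R o : ℂ) * charTerm p t (C.s * C.g o) -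
      (-(t * Complex.I + t ^ 2) / 2 * (lam * C.chi : ℝ))‖ ≤ η * (lam * C.chi) := by
  have hd : 0 ≤ C.d := by linarith [C.one_le_d]
  have hz : (∑ o, (C.R o : ℂ) * C.g o) = 0 := by exact_mod_cast C.mean_zero
  have hl : lam * C.chi = C.d * C.s ^ 2 * C.chi := by rw [C.d_mul]
  have hq : (C.d : ℂ) * ∑ o, (C.R o : ℂ) * (-(t * Complex.I) * (C.s * C.g o) -
      (t * Complex.I + t ^ 2) / 2 * (C.s * C.g o) ^ 2) =
      (-(t * Complex.I + t ^ 2) / 2 * (lam * C.chi : ℝ)) := by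
    have h : ∀ o, (C.R o : ℂ) * (-(t * Complex.I) * (C.s * C.g o) -
      (t * Complex.I + t ^ 2) / 2 * (C.s * C.g o) ^ 2) =
        -(t * Complex.I) * C.s * ((C.R o : ℂ) * C.g o) -
          (t * Complex.I + t ^ 2) / 2 * C.s ^ 2 * ((C.R o * C.g o ^ 2 : ℝ) : ℂ) := by
      intro o; push_cast; ring
    simp_rw [h]
    rw [Finset.sum_sub_distrib, ← Finset.mul_sum, ← Finset.mul_sum, hz, hl, chi]
    push_cast
    ring
  rw [← hq, ← mul_sub, ← Finset.sum_sub_distrib, norm_mul, Complex.norm_real, Real.norm_eq_abs,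
    abs_of_nonneg hd]
  have hr : η * (lam * C.chi) = C.d * ∑ o, C.R o * (η * (C.s * C.g o) ^ 2) := by
    have h : ∀ o, C.R o * (η * (C.s * C.g o) ^ 2) = η * C.s ^ 2 * (C.R o * C.g o ^ 2) := by
      intro o; ring
    simp_rw [h]
    rw [← Finset.mul_sum, hl, chi]
    ring
  rw [hr]
  refine mul_le_mul_of_nonneg_left ((norm_sum_le _ _).trans (Finset.sum_le_sum fun o _ => ?_)) hd
  rw [← mul_sub, norm_mul, Complex.norm_real, Real.norm_eq_abs, abs_of_nonneg (C.R_nonneg o)]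
  refine mul_le_mul_of_nonneg_left ?_ (C.R_nonneg o)
  have := hη (C.s * C.g o) (hδ o)
  push_cast at this
  exact this

end Config

section Limit

variable {p lam : ℝ} (hp0 : 0 < p) (hp1 : p < 1)
include hp0 hp1

theorem tendsto_charFun_law (C : ℕ → Config p lam)
    (hd : Tendsto (fun m => (C m).d) atTop atTop) {μ : ℝ}
    (hμ : Tendsto (fun m => lam * (C m).chi) atTop (𝓝 μ)) (t : ℝ) :
    Tendsto (fun m => charFun (C m).law t) atTop
      (𝓝 (Complex.exp (-(t * Complex.I + t ^ 2) / 2 * μ))) := by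
  set z : ℕ → ℂ := fun m =>
    (C m).d * ∑ o, ((C m).R o : ℂ) * charTerm p t ((C m).s * (C m).g o)
  have hz : Tendsto z atTop (𝓝 (-(t * Complex.I + t ^ 2) / 2 * μ)) := by
    have hlin : Tendsto (fun m => -(t * Complex.I + t ^ 2) / 2 * ((lam * (C m).chi : ℝ) : ℂ)) atTop
        (𝓝 (-(t * Complex.I + t ^ 2) / 2 * μ)) :=
      ((Complex.continuous_ofReal.tendsto μ).comp hμ).const_mul _
    have hdiff : Tendsto (fun m => z m - -(t * Complex.I + t ^ 2) / 2 *
        ((lam * (C m).chi : ℝ) : ℂ)) atTop (𝓝 0) := by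
      rw [Metric.tendsto_atTop]
      intro ε hε
      have hM : ∀ᶠ m in atTop, lam * (C m).chi < |μ| + 1 :=
        hμ.eventually (gt_mem_nhds (by linarith [le_abs_self μ]))
      have hη : 0 < ε / (2 * (|μ| + 1)) := by positivity
      have ho := (charTerm_isLittleO p t).def hη
      obtain ⟨δ, hδ, hball⟩ := Metric.eventually_nhds_iff.1 ho
      have hlam : 0 ≤ lam := (C 0).lam_nonneg
      have hs : ∀ᶠ m in atTop, lam * (1 / (p * (1 - p))) ^ 2 / (δ / 2) ^ 2 ≤ (C m).d :=
        hd.eventually_ge_atTop _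
      obtain ⟨N, hN⟩ := eventually_atTop.1 (hM.and hs)
      refine ⟨N, fun m hm => ?_⟩
      obtain ⟨h1, h2⟩ := hN m hm
      rw [dist_zero_right]
      have hb := (C m).norm_charTerm_sum_le hp0 hp1 (t := t) (η := ε / (2 * (|μ| + 1)))
        (δ := δ / 2) (fun u hu => ?_) (fun o => ?_)
      · refine hb.trans_lt ?_
        have : ε / (2 * (|μ| + 1)) * (lam * (C m).chi) ≤ ε / (2 * (|μ| + 1)) * (|μ| + 1) := by
          gcongr
        refine this.trans_lt ?_
        have h0 : (|μ| + 1) ≠ 0 := by positivity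
        have : ε / (2 * (|μ| + 1)) * (|μ| + 1) = ε / 2 := by field_simp
        rw [this]; linarith
      · have := hball (y := u) (by rw [dist_zero_right, Real.norm_eq_abs]; linarith)
        rwa [norm_pow, Real.norm_eq_abs, sq_abs] at this
      -- Since `s ^ 2 = lam / d` and `g` is bounded uniformly, all biases `s * g o` become small as
      -- `d` grows.
      · refine abs_le_of_sq_le_sq ?_ (by positivity)
        have hdm : 0 < (C m).d := by linarith [(C m).one_le_d]
        rw [mul_pow]
        have hg : (C m).g o ^ 2 ≤ (1 / (p * (1 - p))) ^ 2 :=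
          sq_le_sq' (abs_le.1 ((C m).g_le o)).1 (abs_le.1 ((C m).g_le o)).2
        rw [div_le_iff₀ (by positivity)] at h2
        have h3 : (C m).d * ((C m).s ^ 2 * (C m).g o ^ 2) ≤ (C m).d * (δ / 2) ^ 2 := by
          rw [← mul_assoc, (C m).d_mul]
          exact (mul_le_mul_of_nonneg_left hg hlam).trans h2
        exact le_of_mul_le_mul_left h3 hdm
    have := hdiff.add hlin
    simpa using this
  have hn : Tendsto (fun m => ((C m).n : ℝ)) atTop atTop :=
    tendsto_atTop_mono (fun m => (C m).d_le_n) hd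
  have hbd : Tendsto (fun m => ‖z m‖ ^ 2 / ((C m).n : ℝ) * Real.exp ‖z m‖) atTop (𝓝 0) := by
    have h1 := (hz.norm.pow 2).div_atTop hn
    have h2 := (Real.continuous_exp.tendsto _).comp hz.norm
    simpa using h1.mul h2
  have hdiff : Tendsto (fun m => charFun (C m).law t - Complex.exp (z m)) atTop (𝓝 0) := by
    refine squeeze_zero_norm' ?_ hbd
    have hle : ∀ᶠ m in atTop, ‖z m‖ ≤ (C m).n := by
      have h1 := hz.norm.eventually (gt_mem_nhds (lt_add_one _))
      filter_upwards [h1, hn.eventually_ge_atTop _] with m h2 h3 using h2.le.trans h3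
    filter_upwards [hle] with m hm
    rw [(C m).charFun_law hp0 hp1]
    exact norm_one_add_div_pow_sub_exp_le (C m).n_pos (z m) hm
  have := hdiff.add ((Complex.continuous_exp.tendsto _).comp hz)
  simpa using this

theorem tendsto_mean_of_chi (C : ℕ → Config p lam)
    (hd : Tendsto (fun m => (C m).d) atTop atTop) {μ : ℝ} (hμ0 : 0 ≤ μ)
    (hμ : Tendsto (fun m => lam * (C m).chi) atTop (𝓝 μ)) (Φ : ℝ →ᵇ ℝ) :
    Tendsto (fun m => (C m).mean Φ) atTop (𝓝 (gaussMean Φ μ)) := by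
  let P : ℕ → ProbabilityMeasure ℝ := fun m => ⟨(C m).law, (C m).isProbabilityMeasure_law hp0 hp1⟩
  let Q : ProbabilityMeasure ℝ := ⟨gaussianReal (-μ / 2) μ.toNNReal, inferInstance⟩
  have hPQ : Tendsto P atTop (𝓝 Q) := by
    refine ProbabilityMeasure.tendsto_iff_tendsto_charFun.2 fun t => ?_
    have h := tendsto_charFun_law hp0 hp1 C hd hμ t
    have e : charFun (Q : Measure ℝ) t = Complex.exp (-(t * Complex.I + t ^ 2) / 2 * μ) := by
      change charFun (gaussianReal (-μ / 2) μ.toNNReal) t = _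
      rw [charFun_gaussianReal, Real.coe_toNNReal _ hμ0]
      congr 1
      push_cast
      ring
    rw [e]
    exact h
  have h := ProbabilityMeasure.tendsto_iff_forall_integral_tendsto.1 hPQ Φ
  have e : ∫ x, Φ x ∂(Q : Measure ℝ) = gaussMean Φ μ := integral_gaussianReal_neg_half hμ0 Φ
  rw [e] at h
  refine h.congr fun m => ?_
  change ∫ x, Φ x ∂(C m).law = _
  rw [(C m).integral_law hp0 hp1]
  rfl

/-- **Central limit theorem for one level of the tree**, uniformly over the observations. -/
theorem tendsto_mean_sub_gaussMean (Φ : ℝ →ᵇ ℝ) :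
    Tendsto (fun C : Config p lam => C.mean Φ - gaussMean Φ (lam * C.chi))
      (comap Config.d atTop) (𝓝 0) := by
  refine tendsto_of_subseq_tendsto fun C hC => ?_
  have hd : Tendsto (fun m => (C m).d) atTop atTop := tendsto_comap_iff.1 hC
  -- Uniformity over all experiments comes from compactness: `lam * chi` stays in a fixed interval,
  -- and along a convergent subsequence both terms have the same limit.
  obtain ⟨μ, hμ, φ, hφ, hlim⟩ := isCompact_Icc.tendsto_subseq (x := fun m => lam * (C m).chi)
    (s := Set.Icc 0 (lam * (1 / (p * (1 - p))) ^ 2)) fun m =>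
      ⟨mul_nonneg (C m).lam_nonneg ((C m).chi_nonneg),
        mul_le_mul_of_nonneg_left ((C m).chi_le) (C m).lam_nonneg⟩
  refine ⟨φ, ?_⟩
  have h1 := tendsto_mean_of_chi hp0 hp1 (fun m => C (φ m)) (hd.comp hφ.tendsto_atTop) hμ.1
    hlim Φ
  have h2 := ((continuous_gaussMean Φ).tendsto μ).comp hlim
  simpa using h1.sub h2

end Limit

end SBM

namespace SBM

/-! ### One step of the recursion for the information -/

open MeasureTheory ProbabilityTheory BoundedContinuousFunction

/-- Symmetrized `chi-square` divergence of a binary experiment. -/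
def dchi (p : ℝ) {A : Type*} [Fintype A] (P : Fin 2 → A → ℝ) : ℝ :=
  ∑ o, (P 0 o - P 1 o) ^ 2 / (p * P 0 o + (1 - p) * P 1 o)

/-- Edge probability of two communities, relative to the average one. -/
def affinity (p s : ℝ) : Sym2 (Fin 2) → ℝ :=
  Sym2.lift ⟨fun x y => if x = y then (if x = 0 then 1 + (1 - p) * s / p else 1 + p * s / (1 - p))
    else 1 - s, fun x y => by
      by_cases h : x = y
      · subst h; rfl
      · simp [h, Ne.symm h]⟩

theorem affinity_zero_zero (p s : ℝ) : affinity p s s(0, 0) = 1 + (1 - p) * s / p := by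
  simp [affinity]

theorem affinity_zero_one (p s : ℝ) : affinity p s s(0, 1) = 1 - s := by simp [affinity]

theorem affinity_one_zero (p s : ℝ) : affinity p s s(1, 0) = 1 - s := by simp [affinity]

theorem affinity_one_one (p s : ℝ) : affinity p s s(1, 1) = 1 + p * s / (1 - p) := by
  simp [affinity]

/-- Applied to the log-likelihood ratio of community 2 against community 1, its mean given community
1 is the total variation distance. -/
def hinge : ℝ →ᵇ ℝ :=
  BoundedContinuousFunction.ofNormedAddCommGroup (fun x : ℝ => max (1 - Real.exp x) 0)
    (by fun_prop) 1 fun x => by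
      rw [Real.norm_eq_abs, abs_of_nonneg (le_max_right _ _)]
      exact max_le (by linarith [Real.exp_pos x]) zero_le_one

theorem hinge_apply (x : ℝ) : hinge x = max (1 - Real.exp x) 0 := rfl

theorem mix_exp_pos {p : ℝ} (hp0 : 0 < p) (hp1 : p < 1) (x : ℝ) :
    0 < p + (1 - p) * Real.exp x :=
  add_pos hp0 (mul_pos (by linarith) (Real.exp_pos x))

/-- Likelihood of community 1 relative to the mixture. Its mean given community 1, minus 1, is `(1 -
p) ^ 2` times the divergence `dchi`. -/
def invMix {p : ℝ} (hp0 : 0 < p) (hp1 : p < 1) : ℝ →ᵇ ℝ :=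
  BoundedContinuousFunction.ofNormedAddCommGroup (fun x : ℝ => 1 / (p + (1 - p) * Real.exp x))
    (continuous_const.div (by fun_prop) fun x => (mix_exp_pos hp0 hp1 x).ne') (1 / p) fun x => by
      rw [Real.norm_eq_abs, abs_of_pos (one_div_pos.2 (mix_exp_pos hp0 hp1 x))]
      refine one_div_le_one_div_of_le hp0 ?_
      have := mul_pos (sub_pos.2 hp1) (Real.exp_pos x)
      linarith

theorem invMix_apply {p : ℝ} (hp0 : 0 < p) (hp1 : p < 1) (x : ℝ) :
    invMix hp0 hp1 x = 1 / (p + (1 - p) * Real.exp x) := rfl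

theorem cavityG_eq {p : ℝ} (hp0 : 0 < p) (hp1 : p < 1) (lam μ : ℝ) :
    cavityG p lam μ = lam / (1 - p) ^ 2 * (gaussMean (invMix hp0 hp1) μ - 1) := by
  rw [cavityG, gaussMean, integral_sub _ (integrable_const 1), integral_const]
  · simp [invMix_apply]
  · refine Integrable.of_bound (C := ‖invMix hp0 hp1‖)
      (((invMix hp0 hp1).continuous.comp (g := invMix hp0 hp1)
        (f := fun z => √μ * z - μ / 2) (by fun_prop)).aestronglyMeasurable)
      (Eventually.of_forall fun z => (invMix hp0 hp1).norm_coe_le_norm _)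

theorem continuous_cavityG {p : ℝ} (hp0 : 0 < p) (hp1 : p < 1) (lam : ℝ) :
    Continuous (cavityG p lam) := by
  have : cavityG p lam = fun μ => lam / (1 - p) ^ 2 * (gaussMean (invMix hp0 hp1) μ - 1) :=
    funext fun μ => cavityG_eq hp0 hp1 lam μ
  rw [this]
  exact ((continuous_gaussMean _).sub continuous_const).const_mul _

namespace Config

variable {p lam : ℝ} (C : Config p lam) (hp0 : 0 < p) (hp1 : p < 1)
include hp0 hp1

theorem one_add_pos {e : ℝ} (he : |e| ≤ 1) (o : C.A) : 0 < 1 + e * (C.s * C.g o) := by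
  have h1 : |e * (C.s * C.g o)| ≤ 1 / 2 := by
    rw [abs_mul]
    have := C.small o
    nlinarith [abs_nonneg e, abs_nonneg (C.s * C.g o)]
  have := (abs_le.1 h1).1
  linarith

theorem slot_neg_eq (a : Option C.A) :
    C.slot (-p) a = C.slot (1 - p) a * Real.exp (C.score a) := by
  cases a with
  | none => simp [slot, score]
  | some o =>
    have h1 := C.one_add_pos hp0 hp1 (e := 1 - p) (abs_le.2 ⟨by linarith, by linarith⟩) o
    have h2 := C.one_add_pos hp0 hp1 (e := -p) (abs_le.2 ⟨by linarith, by linarith⟩) o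
    rw [neg_mul, ← sub_eq_add_neg] at h2
    simp only [slot, score, llr]
    rw [Real.exp_sub, Real.exp_log h1, Real.exp_log h2]
    rw [mul_assoc, mul_assoc, mul_div_cancel₀ _ h1.ne']
    ring

theorem prod_slot_neg_eq (f : Fin C.n → Option C.A) :
    ∏ j, C.slot (-p) (f j) =
      (∏ j, C.slot (1 - p) (f j)) * Real.exp (∑ j, C.score (f j)) := by
  rw [Real.exp_sum, ← Finset.prod_mul_distrib]
  exact Finset.prod_congr rfl fun j _ => C.slot_neg_eq hp0 hp1 _

omit hp0 hp1 in
theorem sum_prod_slot (e : ℝ) : ∑ f : Fin C.n → Option C.A, ∏ j, C.slot e (f j) = 1 := by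
  rw [sum_pi_prod (fun _ => C.slot e)]
  simp [C.sum_slot]

theorem mean_hinge :
    C.mean hinge = (∑ f : Fin C.n → Option C.A,
      |∏ j, C.slot (1 - p) (f j) - ∏ j, C.slot (-p) (f j)|) / 2 := by
  have h : ∀ f : Fin C.n → Option C.A,
      (∏ j, C.slot (1 - p) (f j)) * hinge (∑ j, C.score (f j)) =
        (|∏ j, C.slot (1 - p) (f j) - ∏ j, C.slot (-p) (f j)| +
          ∏ j, C.slot (1 - p) (f j) - ∏ j, C.slot (-p) (f j)) / 2 := by
    intro f
    have hw := C.weight_nonneg hp0 hp1 f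
    rw [C.prod_slot_neg_eq hp0 hp1, hinge_apply]
    generalize Real.exp (∑ j, C.score (f j)) = L
    generalize ∏ j, C.slot (1 - p) (f j) = w at *
    rcases le_total L 1 with h | h
    · rw [max_eq_left (by linarith), abs_of_nonneg (by nlinarith)]
      ring
    · rw [max_eq_right (by linarith), abs_of_nonpos (by nlinarith)]
      ring
  rw [mean]
  simp_rw [h]
  rw [← Finset.sum_div, Finset.sum_sub_distrib, Finset.sum_add_distrib, C.sum_prod_slot,
    C.sum_prod_slot]
  ring

theorem mean_invMix :
    C.mean (invMix hp0 hp1) - 1 = (1 - p) ^ 2 * ∑ f : Fin C.n → Option C.A,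
      (∏ j, C.slot (1 - p) (f j) - ∏ j, C.slot (-p) (f j)) ^ 2 /
        (p * ∏ j, C.slot (1 - p) (f j) + (1 - p) * ∏ j, C.slot (-p) (f j)) := by
  have h : ∀ f : Fin C.n → Option C.A,
      (1 - p) ^ 2 * ((∏ j, C.slot (1 - p) (f j) - ∏ j, C.slot (-p) (f j)) ^ 2 /
        (p * ∏ j, C.slot (1 - p) (f j) + (1 - p) * ∏ j, C.slot (-p) (f j))) =
      (∏ j, C.slot (1 - p) (f j)) * invMix hp0 hp1 (∑ j, C.score (f j)) -
        (2 - p) * (∏ j, C.slot (1 - p) (f j)) + (1 - p) * ∏ j, C.slot (-p) (f j) := by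
    intro f
    rw [C.prod_slot_neg_eq hp0 hp1, invMix_apply]
    have hD := mix_exp_pos hp0 hp1 (∑ j, C.score (f j))
    generalize Real.exp (∑ j, C.score (f j)) = L at *
    generalize ∏ j, C.slot (1 - p) (f j) = w
    rcases eq_or_ne w 0 with rfl | hw
    · simp
    · have : p * w + (1 - p) * (w * L) = w * (p + (1 - p) * L) := by ring
      rw [this]
      field_simp
      ring
  rw [mean, Finset.mul_sum]
  simp_rw [h]
  rw [Finset.sum_add_distrib, Finset.sum_sub_distrib, ← Finset.mul_sum, ← Finset.mul_sum,
    C.sum_prod_slot, C.sum_prod_slot]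
  ring

end Config

/-- An experiment observed in the slots of a tree of average degree `d`. -/
def experimentConfig {p lam : ℝ} (hp0 : 0 < p) (hp1 : p < 1) {d s : ℝ} {n : ℕ} (hd1 : 1 ≤ d)
    (hdn : d ≤ n) (hds : d * s ^ 2 = lam) (hdl : 4 * lam * (1 / (p * (1 - p))) ^ 2 ≤ d)
    {A : Type} [Fintype A] (P : Fin 2 → A → ℝ) (hP : ∀ x o, 0 ≤ P x o)
    (hsum : ∀ x, ∑ o, P x o = 1) : Config p lam :=
  have hq : 0 < 1 - p := sub_pos.2 hp1
  -- Where the mixture vanishes, so do both likelihoods; the default value `x / 0 = 0` is then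
  -- harmless.
  have hcancel : ∀ o, (p * P 0 o + (1 - p) * P 1 o) *
      ((P 0 o - P 1 o) / (p * P 0 o + (1 - p) * P 1 o)) = P 0 o - P 1 o := fun o => by
    rcases eq_or_ne (p * P 0 o + (1 - p) * P 1 o) 0 with h | h
    · have h0 := mul_nonneg hp0.le (hP 0 o)
      have h1 := mul_nonneg hq.le (hP 1 o)
      have e0 : p * P 0 o = 0 := by linarith
      have e1 : (1 - p) * P 1 o = 0 := by linarith
      rw [h, (mul_eq_zero.1 e0).resolve_left hp0.ne', (mul_eq_zero.1 e1).resolve_left hq.ne']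
      simp
    · exact mul_div_cancel₀ _ h
  have hg : ∀ o, |(P 0 o - P 1 o) / (p * P 0 o + (1 - p) * P 1 o)| ≤ 1 / (p * (1 - p)) := fun o => by
    have h0 := hP 0 o
    have h1 := hP 1 o
    have hR : 0 ≤ p * P 0 o + (1 - p) * P 1 o := by positivity
    rw [abs_div, abs_of_nonneg hR]
    refine div_le_of_le_mul₀ hR (by positivity) ?_
    rw [one_div_mul_eq_div, le_div_iff₀ (by positivity)]
    have : |P 0 o - P 1 o| ≤ P 0 o + P 1 o := abs_le.2 ⟨by linarith, by linarith⟩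
    calc |P 0 o - P 1 o| * (p * (1 - p)) ≤ (P 0 o + P 1 o) * (p * (1 - p)) := by gcongr
      _ ≤ _ := by nlinarith [mul_nonneg hp0.le h0, mul_nonneg hq.le h1,
        mul_nonneg (sq_nonneg p) h0, mul_nonneg (sq_nonneg (1 - p)) h1]
  { A := A
    R := fun o => p * P 0 o + (1 - p) * P 1 o
    g := fun o => (P 0 o - P 1 o) / (p * P 0 o + (1 - p) * P 1 o)
    d := d
    s := s
    n := n
    R_nonneg := fun o => add_nonneg (mul_nonneg hp0.le (hP 0 o)) (mul_nonneg hq.le (hP 1 o))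
    R_sum := by
      rw [Finset.sum_add_distrib, ← Finset.mul_sum, ← Finset.mul_sum, hsum, hsum]; ring
    mean_zero := by
      simp_rw [hcancel]
      rw [Finset.sum_sub_distrib, hsum, hsum, sub_self]
    g_le := hg
    small := fun o => by
      refine abs_le_of_sq_le_sq ?_ (by norm_num)
      have h1 := sq_le_sq' (abs_le.1 (hg o)).1 (abs_le.1 (hg o)).2
      set g := (P 0 o - P 1 o) / (p * P 0 o + (1 - p) * P 1 o)
      -- The factor 4 in `hdl` is chosen for the bound `1 / 2` here, which keeps all tilted
      -- densities positive.
      have h2 : d * (s * g) ^ 2 ≤ d * (1 / 2) ^ 2 := by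
        calc d * (s * g) ^ 2 = d * s ^ 2 * g ^ 2 := by ring
          _ ≤ d * s ^ 2 * (1 / (p * (1 - p))) ^ 2 := by gcongr
          _ ≤ _ := by rw [hds]; linarith
      exact le_of_mul_le_mul_left h2 (by linarith)
    one_le_d := hd1
    d_le_n := hdn
    d_mul := hds }

/-- Edge probabilities of the block model with average degree `d` and signal `s`. -/
def edgeProb (p d s : ℝ) (n : ℕ) (z : Sym2 (Fin 2)) : ℝ := d / n * affinity p s z

theorem experiment_aux {p : ℝ} (hp0 : 0 < p) (hp1 : p < 1) {u v : ℝ} (hu : 0 ≤ u) (hv : 0 ≤ v)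
    (e s : ℝ) : (p * u + (1 - p) * v) *
      (1 + e * (s * ((u - v) / (p * u + (1 - p) * v)))) =
        p * u + (1 - p) * v + e * s * (u - v) := by
  have hq : 0 < 1 - p := sub_pos.2 hp1
  rcases eq_or_ne (p * u + (1 - p) * v) 0 with h | h
  · have h0 := mul_nonneg hp0.le hu
    have h1 := mul_nonneg hq.le hv
    have e0 : p * u = 0 := by linarith
    have e1 : (1 - p) * v = 0 := by linarith
    rw [h, (mul_eq_zero.1 e0).resolve_left hp0.ne', (mul_eq_zero.1 e1).resolve_left hq.ne']
    simp
  · field_simp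

section Step

variable {p lam : ℝ} (hp0 : 0 < p) (hp1 : p < 1) {d s : ℝ} {n : ℕ} (hd1 : 1 ≤ d)
    (hdn : d ≤ n) (hds : d * s ^ 2 = lam) (hdl : 4 * lam * (1 / (p * (1 - p))) ^ 2 ≤ d)
    {A : Type} [Fintype A] (P : Fin 2 → A → ℝ) (hP : ∀ x o, 0 ≤ P x o)
    (hsum : ∀ x, ∑ o, P x o = 1)

theorem slotLaw_zero (a : Option A) :
    slotLaw (labelProb p) (edgeProb p d s n) (d / n) P 0 a =
      (experimentConfig hp0 hp1 hd1 hdn hds hdl P hP hsum).slot (1 - p) a := by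
  cases a with
  | none => rfl
  | some o =>
    have h := experiment_aux hp0 hp1 (hP 0 o) (hP 1 o) (1 - p) s
    simp only [Config.slot, experimentConfig] at *
    rw [h]
    simp only [slotLaw, Fin.sum_univ_two, edgeProb, affinity_zero_zero, affinity_zero_one,
      labelProb, Matrix.cons_val_zero, Matrix.cons_val_one]
    field_simp
    ring

theorem slotLaw_one (a : Option A) :
    slotLaw (labelProb p) (edgeProb p d s n) (d / n) P 1 a =
      (experimentConfig hp0 hp1 hd1 hdn hds hdl P hP hsum).slot (-p) a := by
  cases a with
  | none => rfl
  | some o =>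
    have h := experiment_aux hp0 hp1 (hP 0 o) (hP 1 o) (-p) s
    have hq : 1 - p ≠ 0 := (sub_pos.2 hp1).ne'
    simp only [Config.slot, experimentConfig] at *
    rw [h]
    simp only [slotLaw, Fin.sum_univ_two, edgeProb, affinity_one_zero, affinity_one_one,
      labelProb, Matrix.cons_val_zero, Matrix.cons_val_one]
    field_simp
    ring

theorem stepLaw_zero (f : Fin n → Option A) :
    stepLaw (labelProb p) (edgeProb p d s n) (d / n) P 0 f =
      ∏ j, (experimentConfig hp0 hp1 hd1 hdn hds hdl P hP hsum).slot (1 - p) (f j) :=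
  Finset.prod_congr rfl fun j _ => slotLaw_zero hp0 hp1 hd1 hdn hds hdl P hP hsum (f j)

theorem stepLaw_one (f : Fin n → Option A) :
    stepLaw (labelProb p) (edgeProb p d s n) (d / n) P 1 f =
      ∏ j, (experimentConfig hp0 hp1 hd1 hdn hds hdl P hP hsum).slot (-p) (f j) :=
  Finset.prod_congr rfl fun j _ => slotLaw_one hp0 hp1 hd1 hdn hds hdl P hP hsum (f j)

theorem chi_experimentConfig :
    (experimentConfig hp0 hp1 hd1 hdn hds hdl P hP hsum).chi = dchi p P := by
  refine Finset.sum_congr rfl fun o _ => ?_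
  simp only [experimentConfig]
  rcases eq_or_ne (p * P 0 o + (1 - p) * P 1 o) 0 with h | h
  · simp [h]
  · field_simp

theorem mean_hinge_experimentConfig :
    (experimentConfig hp0 hp1 hd1 hdn hds hdl P hP hsum).mean hinge =
      l1 (stepLaw (V := Fin n) (labelProb p) (edgeProb p d s n) (d / n) P 0)
        (stepLaw (V := Fin n) (labelProb p) (edgeProb p d s n) (d / n) P 1) / 2 := by
  rw [Config.mean_hinge _ hp0 hp1, l1]
  congr 1
  refine Finset.sum_congr rfl fun f _ => ?_
  exact (congrArg₂ (fun a b => |a - b|) (stepLaw_zero hp0 hp1 hd1 hdn hds hdl P hP hsum f)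
    (stepLaw_one hp0 hp1 hd1 hdn hds hdl P hP hsum f)).symm

theorem mean_invMix_experimentConfig :
    (experimentConfig hp0 hp1 hd1 hdn hds hdl P hP hsum).mean (invMix hp0 hp1) - 1 =
      (1 - p) ^ 2 *
        dchi p (stepLaw (V := Fin n) (labelProb p) (edgeProb p d s n) (d / n) P) := by
  rw [Config.mean_invMix _ hp0 hp1, dchi]
  congr 1
  refine Finset.sum_congr rfl fun f _ => ?_
  exact (congrArg₂ (fun a b => (a - b) ^ 2 / (p * a + (1 - p) * b))
    (stepLaw_zero hp0 hp1 hd1 hdn hds hdl P hP hsum f)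
    (stepLaw_one hp0 hp1 hd1 hdn hds hdl P hP hsum f)).symm

end Step

/-- Total variation distance and `chi-square` divergence after one level of a tree of large average
degree, uniformly over the observed experiment. -/
theorem eventually_stepLaw_close {p lam : ℝ} (hp0 : 0 < p) (hp1 : p < 1) {ε : ℝ} (hε : 0 < ε) :
    ∀ᶠ d : ℝ in atTop, ∀ s : ℝ, d * s ^ 2 = lam → ∀ n : ℕ, d ≤ n →
      ∀ (A : Type) [Fintype A] (P : Fin 2 → A → ℝ), (∀ x o, 0 ≤ P x o) → (∀ x, ∑ o, P x o = 1) →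
        |l1 (stepLaw (V := Fin n) (labelProb p) (edgeProb p d s n) (d / n) P 0)
          (stepLaw (V := Fin n) (labelProb p) (edgeProb p d s n) (d / n) P 1) / 2 -
            gaussMean hinge (lam * dchi p P)| ≤ ε ∧
        |lam * dchi p (stepLaw (V := Fin n) (labelProb p) (edgeProb p d s n) (d / n) P) -
            cavityG p lam (lam * dchi p P)| ≤ ε := by
  have h1 := tendsto_mean_sub_gaussMean (lam := lam) hp0 hp1 hinge
  have h2 := (tendsto_mean_sub_gaussMean (lam := lam) hp0 hp1 (invMix hp0 hp1)).const_mul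
    (lam / (1 - p) ^ 2)
  rw [mul_zero] at h2
  have h3 := (h1.norm.eventually_le_const (u := ε) (by simpa using hε)).and
    (h2.norm.eventually_le_const (u := ε) (by simpa using hε))
  rw [eventually_comap] at h3
  filter_upwards [h3, eventually_ge_atTop 1,
    eventually_ge_atTop (4 * lam * (1 / (p * (1 - p))) ^ 2)] with d hd hd1 hdl s hds n hdn A _ P hP
    hsum
  -- The central limit theorem holds along the filter of all configurations with large `d`, hence
  -- for every `s`, `n` and experiment at once.
  have := hd (experimentConfig hp0 hp1 hd1 hdn hds hdl P hP hsum) rfl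
  rw [mean_hinge_experimentConfig, chi_experimentConfig, Real.norm_eq_abs, Real.norm_eq_abs] at this
  refine ⟨this.1, ?_⟩
  have hq : 1 - p ≠ 0 := (sub_pos.2 hp1).ne'
  have e : lam * dchi p (stepLaw (V := Fin n) (labelProb p) (edgeProb p d s n) (d / n) P) =
      lam / (1 - p) ^ 2 *
        ((experimentConfig hp0 hp1 hd1 hdn hds hdl P hP hsum).mean (invMix hp0 hp1) - 1) := by
    rw [mean_invMix_experimentConfig]
    field_simp
  rw [e, cavityG_eq hp0 hp1, ← mul_sub, sub_sub_sub_cancel_right]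
  exact this.2

end SBM

namespace SBM

/-! ### Gaussian formulas, monotonicity and bounds for `cavityG` -/

open MeasureTheory ProbabilityTheory BoundedContinuousFunction

theorem integral_exp_mul_stdGaussian (s : ℝ) :
    ∫ z, Real.exp (s * z) ∂(gaussianReal 0 1) = Real.exp (s ^ 2 / 2) := by
  have h := congrFun (mgf_fun_id_gaussianReal (μ := 0) (v := 1)) s
  simpa [mgf] using h

theorem integrable_exp_mul_sub (s c : ℝ) :
    Integrable (fun z => Real.exp (s * z - c)) (gaussianReal 0 1) := by
  simp_rw [Real.exp_sub]
  exact (integrable_exp_mul_gaussianReal s).div_const _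

theorem integral_exp_mul_sub (s c : ℝ) :
    ∫ z, Real.exp (s * z - c) ∂(gaussianReal 0 1) = Real.exp (s ^ 2 / 2 - c) := by
  simp_rw [Real.exp_sub]
  rw [integral_div, integral_exp_mul_stdGaussian]

/-- Completing the square: the exponential is the density of the shifted normal law. -/
theorem gaussian_exp_shift (s : ℝ) {A : Set ℝ} (hA : MeasurableSet A) :
    ∫ z in A, Real.exp (s * z - s ^ 2 / 2) ∂(gaussianReal 0 1) = (gaussianReal s 1).real A := by
  rw [← integral_indicator hA, integral_gaussianReal_eq_integral_smul one_ne_zero,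
    ← integral_indicator_one hA, integral_gaussianReal_eq_integral_smul one_ne_zero]
  congr 1
  ext z
  by_cases hz : z ∈ A
  · simp only [Set.indicator_of_mem hz, smul_eq_mul, Pi.one_apply, mul_one, gaussianPDFReal,
      NNReal.coe_one]
    rw [mul_assoc, ← Real.exp_add]
    congr 2
    ring
  · simp [Set.indicator_of_notMem hz]

theorem stdGaussian_real_Iio_neg (x : ℝ) :
    (gaussianReal 0 1).real (Set.Iio (-x)) = 1 - (gaussianReal 0 1).real (Set.Iio x) := by
  have hneg : (gaussianReal 0 1).map (fun z => -z) = gaussianReal 0 1 := by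
    rw [gaussianReal_map_neg, neg_zero]
  have h1 : (gaussianReal 0 1).real (Set.Iio (-x)) = (gaussianReal 0 1).real (Set.Ioi x) := by
    conv_lhs => rw [← hneg, map_measureReal_apply (by fun_prop) measurableSet_Iio]
    congr 1
    ext z
    simp
  have : NullSingletonClass (gaussianReal 0 1) := nullSingletonClass_gaussianReal one_ne_zero
  rw [h1, ← Set.compl_Iic, probReal_compl_eq_one_sub measurableSet_Iic]
  congr 1
  exact measureReal_congr Iio_ae_eq_Iic.symm

/-- The hinge is nonzero exactly for `z < √μ / 2`. The exponential term there is a probability for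
the normal law shifted by `√μ`, which symmetry converts into a probability for the standard one. -/
theorem gaussMean_hinge {μ : ℝ} (hμ : 0 < μ) :
    gaussMean hinge μ = 2 * (gaussianReal 0 1).real (Set.Iio (√μ / 2)) - 1 := by
  set s := √μ with hs
  have hs0 : 0 < s := Real.sqrt_pos.2 hμ
  have hsq : s ^ 2 = μ := Real.sq_sqrt hμ.le
  have h : ∀ z, hinge (s * z - μ / 2) =
      (Set.Iio (s / 2)).indicator (fun z => 1 - Real.exp (s * z - s ^ 2 / 2)) z := by
    intro z
    rw [hinge_apply, ← hsq]
    by_cases hz : z < s / 2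
    · rw [Set.indicator_of_mem (show z ∈ Set.Iio (s / 2) from hz), max_eq_left]
      rw [sub_nonneg, Real.exp_le_one_iff]
      nlinarith
    · rw [Set.indicator_of_notMem (show z ∉ Set.Iio (s / 2) from hz), max_eq_right]
      rw [sub_nonpos, Real.one_le_exp_iff]
      nlinarith
  have hshift : (gaussianReal s 1).real (Set.Iio (s / 2)) =
      (gaussianReal 0 1).real (Set.Iio (-(s / 2))) := by
    have hm := gaussianReal_map_add_const (μ := 0) (v := 1) s
    rw [zero_add] at hm
    rw [← hm, map_measureReal_apply (by fun_prop) measurableSet_Iio]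
    congr 1
    ext z
    simp only [Set.mem_preimage, Set.mem_Iio]
    constructor <;> intro <;> linarith
  rw [gaussMean]
  simp_rw [← hs, h]
  rw [integral_indicator measurableSet_Iio, integral_sub (integrable_const _).integrableOn
    (integrable_exp_mul_sub s _).integrableOn, gaussian_exp_shift s measurableSet_Iio,
    integral_const, hshift, stdGaussian_real_Iio_neg]
  simp
  ring

theorem gaussianSuccess_eq {α : ℝ} (hα : 0 < α) : gaussianSuccess α = gaussMean hinge α := by
  rw [gaussMean_hinge hα, gaussianSuccess]
  set s := √α with hs
  have hs0 : 0 < s := Real.sqrt_pos.2 hα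
  have hsq : s ^ 2 = α := Real.sq_sqrt hα.le
  have hm : gaussianReal (α / 2) α.toNNReal = (gaussianReal 0 1).map fun z => α / 2 - s * z := by
    have h1 := gaussianReal_map_const_mul (μ := 0) (v := 1) s
    have h2 := gaussianReal_map_const_sub (μ := 0) (v := α.toNNReal) (α / 2)
    have hv : NNReal.mk (s ^ 2) (sq_nonneg _) * 1 = α.toNNReal := by
      ext; simp [hsq, hα.le]
    rw [hv, mul_zero] at h1
    rw [← h1, Measure.map_map (by fun_prop) (by fun_prop), sub_zero] at h2
    exact h2.symm
  rw [hm, map_measureReal_apply (by fun_prop) measurableSet_Ioi]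
  congr 3
  ext z
  simp only [Set.mem_preimage, Set.mem_Ioi, Set.mem_Iio, ← hsq]
  constructor <;> intro h <;> nlinarith

theorem gaussMean_hinge_mono {μ ν : ℝ} (hμ : 0 < μ) (hμν : μ ≤ ν) :
    gaussMean hinge μ ≤ gaussMean hinge ν := by
  rw [gaussMean_hinge hμ, gaussMean_hinge (hμ.trans_le hμν)]
  have : (gaussianReal 0 1).real (Set.Iio (√μ / 2)) ≤ (gaussianReal 0 1).real (Set.Iio (√ν / 2)) :=
    measureReal_mono (Set.Iio_subset_Iio (by have := Real.sqrt_le_sqrt hμν; linarith))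
  linarith

/-- The normal law with mean `-(μ + δ) / 2` and variance `μ + δ` is a convolution. -/
theorem gaussMean_add {μ δ : ℝ} (hμ : 0 ≤ μ) (hδ : 0 ≤ δ) (Φ : ℝ →ᵇ ℝ) :
    gaussMean Φ (μ + δ) =
      ∫ x, gaussMean (fun y => Φ (x + y)) δ ∂(gaussianReal (-μ / 2) μ.toNNReal) := by
  have hc := gaussianReal_conv_gaussianReal (m₁ := -μ / 2) (m₂ := -δ / 2) (v₁ := μ.toNNReal)
    (v₂ := δ.toNNReal)
  rw [← Real.toNNReal_add hμ hδ, show -μ / 2 + -δ / 2 = -(μ + δ) / 2 by ring] at hc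
  rw [← integral_gaussianReal_neg_half (add_nonneg hμ hδ), ← hc, Measure.conv,
    integral_map (by fun_prop) Φ.continuous.aestronglyMeasurable, integral_prod]
  · refine integral_congr_ae (Eventually.of_forall fun x => ?_)
    exact integral_gaussianReal_neg_half hδ (Φ.compContinuous ⟨fun y => x + y, by fun_prop⟩)
  · refine Integrable.of_bound (C := ‖Φ‖) ?_ (Eventually.of_forall fun z => Φ.norm_coe_le_norm _)
    exact (Φ.continuous.comp (by fun_prop)).aestronglyMeasurable

section Cavity

variable {p : ℝ} (hp0 : 0 < p) (hp1 : p < 1)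
include hp0 hp1

/-- `w ↦ 1 / (p + (1 - p) * w)` is convex on `w > 0`; this is the tangent line at `w = exp x`. -/
theorem invMix_tangent (x y : ℝ) :
    invMix hp0 hp1 x - (1 - p) * Real.exp x / (p + (1 - p) * Real.exp x) ^ 2 * (Real.exp y - 1) ≤
      invMix hp0 hp1 (x + y) := by
  have h1 := mix_exp_pos hp0 hp1 x
  have h2 := mix_exp_pos hp0 hp1 (x + y)
  rw [invMix_apply, invMix_apply, ← sub_nonneg]
  have e : 1 / (p + (1 - p) * Real.exp (x + y)) - (1 / (p + (1 - p) * Real.exp x) -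
      (1 - p) * Real.exp x / (p + (1 - p) * Real.exp x) ^ 2 * (Real.exp y - 1)) =
      ((1 - p) * Real.exp x * (Real.exp y - 1)) ^ 2 /
        ((p + (1 - p) * Real.exp x) ^ 2 * (p + (1 - p) * Real.exp (x + y))) := by
    field_simp
    rw [Real.exp_add]
    ring
  rw [e]
  positivity

/-- Raising the variance multiplies `exp x` by an independent lognormal factor of mean 1, and the
integrand is convex in `exp x`, so this is Jensen's inequality. -/
theorem gaussMean_invMix_mono {μ ν : ℝ} (hμ : 0 ≤ μ) (hμν : μ ≤ ν) :
    gaussMean (invMix hp0 hp1) μ ≤ gaussMean (invMix hp0 hp1) ν := by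
  obtain ⟨δ, hδ, rfl⟩ : ∃ δ, 0 ≤ δ ∧ ν = μ + δ := ⟨ν - μ, by linarith, by ring⟩
  rw [gaussMean_add hμ hδ, ← integral_gaussianReal_neg_half hμ]
  have hb : ∀ x, Integrable (fun z => invMix hp0 hp1 (x + (√δ * z - δ / 2))) (gaussianReal 0 1) := by
    intro x
    refine Integrable.of_bound (C := ‖invMix hp0 hp1‖) ?_
      (Eventually.of_forall fun z => (invMix hp0 hp1).norm_coe_le_norm _)
    exact ((invMix hp0 hp1).continuous.comp (by fun_prop)).aestronglyMeasurable
  refine integral_mono (BoundedContinuousFunction.integrable _ _) ?_ fun x => ?_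
  · refine Integrable.of_bound (C := ‖invMix hp0 hp1‖) ?_ (Eventually.of_forall fun x => ?_)
    · refine Continuous.aestronglyMeasurable ?_
      refine continuous_of_dominated (F := fun x z => invMix hp0 hp1 (x + (√δ * z - δ / 2)))
        (bound := fun _ => ‖invMix hp0 hp1‖) (fun x => (hb x).aestronglyMeasurable) (fun x => ?_)
        (integrable_const _) ?_
      · exact Eventually.of_forall fun z => (invMix hp0 hp1).norm_coe_le_norm _
      · exact Eventually.of_forall fun z => (invMix hp0 hp1).continuous.comp (by fun_prop)
    · refine (norm_integral_le_of_norm_le_const (C := ‖invMix hp0 hp1‖)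
        (Eventually.of_forall fun z => (invMix hp0 hp1).norm_coe_le_norm _)).trans ?_
      simp
  · set c := (1 - p) * Real.exp x / (p + (1 - p) * Real.exp x) ^ 2
    have hI : ∫ z, (invMix hp0 hp1 x - c * (Real.exp (√δ * z - δ / 2) - 1)) ∂(gaussianReal 0 1) =
        invMix hp0 hp1 x := by
      have hi : Integrable (fun z => Real.exp (√δ * z - δ / 2) - 1) (gaussianReal 0 1) :=
        (integrable_exp_mul_sub (√δ) (δ / 2)).sub (integrable_const (1 : ℝ))
      rw [integral_sub (integrable_const _) (hi.const_mul c), integral_const_mul,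
        integral_sub (integrable_exp_mul_sub (√δ) (δ / 2)) (integrable_const _),
        integral_exp_mul_sub, Real.sq_sqrt hδ]
      simp
    change invMix hp0 hp1 x ≤ gaussMean _ δ
    rw [← hI]
    refine integral_mono ?_ (hb x) fun z => invMix_tangent hp0 hp1 x _
    exact (integrable_const _).sub
      (((integrable_exp_mul_sub (√δ) (δ / 2)).sub (integrable_const _)).const_mul c)

theorem cavityG_mono {lam : ℝ} (hlam : 0 ≤ lam) {μ ν : ℝ} (hμ : 0 ≤ μ) (hμν : μ ≤ ν) :
    cavityG p lam μ ≤ cavityG p lam ν := by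
  rw [cavityG_eq hp0 hp1, cavityG_eq hp0 hp1]
  have := gaussMean_invMix_mono hp0 hp1 hμ hμν
  gcongr

theorem cavityG_le {lam : ℝ} (hlam : 0 ≤ lam) (μ : ℝ) :
    cavityG p lam μ ≤ lam / (p * (1 - p)) := by
  have hq : 0 < 1 - p := sub_pos.2 hp1
  have h : gaussMean (invMix hp0 hp1) μ ≤ 1 / p := by
    have : ∫ _ : ℝ, 1 / p ∂(gaussianReal 0 1) = 1 / p := by simp
    rw [← this]
    refine integral_mono ?_ (integrable_const _) fun z => ?_
    · refine Integrable.of_bound (C := ‖invMix hp0 hp1‖) ?_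
        (Eventually.of_forall fun z => (invMix hp0 hp1).norm_coe_le_norm _)
      exact ((invMix hp0 hp1).continuous.comp (by fun_prop)).aestronglyMeasurable
    · refine one_div_le_one_div_of_le hp0 ?_
      have := mul_pos hq (Real.exp_pos (√μ * z - μ / 2))
      linarith
  rw [cavityG_eq hp0 hp1]
  calc lam / (1 - p) ^ 2 * (gaussMean (invMix hp0 hp1) μ - 1)
      ≤ lam / (1 - p) ^ 2 * (1 / p - 1) := by gcongr
    _ = lam / (p * (1 - p)) := by field_simp

/-- A lower bound with slope `lam` at `0`. It integrates the cubic minorant `1 - x + x ^ 2 - x ^ 3 ≤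
1 / (1 + x)` at `x = (1 - p) * (E - 1)`, where `E` is lognormal with moments `1`, `exp μ` and `exp
(3 * μ)` of orders 1, 2 and 3. -/
theorem le_cavityG {lam : ℝ} (hlam : 0 ≤ lam) {μ : ℝ} (hμ : 0 ≤ μ) :
    lam * ((Real.exp μ - 1) * (1 - 3 * (Real.exp μ - 1) - (Real.exp μ - 1) ^ 2)) ≤
      cavityG p lam μ := by
  have hq : 0 < 1 - p := sub_pos.2 hp1
  set E : ℝ → ℝ := fun z => Real.exp (√μ * z - μ / 2)
  have hk : ∀ k : ℕ, ∀ z, E z ^ k = Real.exp (k * √μ * z - k * (μ / 2)) := by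
    intro k z
    rw [← Real.exp_nat_mul]
    congr 1
    ring
  have hEi : ∀ k : ℕ, Integrable (fun z => E z ^ k) (gaussianReal 0 1) := by
    intro k
    simp_rw [hk]
    exact integrable_exp_mul_sub _ _
  have hE : ∀ k : ℕ, ∫ z, E z ^ k ∂(gaussianReal 0 1) =
      Real.exp ((k : ℝ) ^ 2 * μ / 2 - k * (μ / 2)) := by
    intro k
    simp_rw [hk]
    rw [integral_exp_mul_sub, mul_pow, Real.sq_sqrt hμ]
  set q := 1 - p with hqdef
  have hpoly : ∀ z, (1 + q + q ^ 2 + q ^ 3) - (q + 2 * q ^ 2 + 3 * q ^ 3) * E z ^ 1 +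
      (q ^ 2 + 3 * q ^ 3) * E z ^ 2 - q ^ 3 * E z ^ 3 ≤ invMix hp0 hp1 (√μ * z - μ / 2) := by
    intro z
    rw [invMix_apply]
    have hD := mix_exp_pos hp0 hp1 (√μ * z - μ / 2)
    change _ ≤ 1 / (p + q * E z)
    change 0 < p + q * E z at hD
    rw [le_div_iff₀ hD, show p = 1 - q by rw [hqdef]; ring]
    -- The minorant times `1 + x` equals `1 - x ^ 4`.
    nlinarith [sq_nonneg (q ^ 2 * (E z - 1) ^ 2)]
  have hint : (1 + q + q ^ 2 + q ^ 3) - (q + 2 * q ^ 2 + 3 * q ^ 3) * 1 +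
      (q ^ 2 + 3 * q ^ 3) * Real.exp μ - q ^ 3 * Real.exp μ ^ 3 ≤
        gaussMean (invMix hp0 hp1) μ := by
    have h1 : ∫ z, E z ^ 1 ∂(gaussianReal 0 1) = 1 := by
      rw [hE]; norm_num
    have h2 : ∫ z, E z ^ 2 ∂(gaussianReal 0 1) = Real.exp μ := by
      rw [hE]; congr 1; push_cast; ring
    have h3 : ∫ z, E z ^ 3 ∂(gaussianReal 0 1) = Real.exp μ ^ 3 := by
      rw [hE, ← Real.exp_nat_mul]; congr 1; push_cast; ring
    have i1 := (hEi 1).const_mul (q + 2 * q ^ 2 + 3 * q ^ 3)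
    have i2 := (hEi 2).const_mul (q ^ 2 + 3 * q ^ 3)
    have i3 := (hEi 3).const_mul (q ^ 3)
    have i0 : Integrable (fun _ : ℝ => 1 + q + q ^ 2 + q ^ 3) (gaussianReal 0 1) :=
      integrable_const _
    have i01 : Integrable (fun z => (1 + q + q ^ 2 + q ^ 3) -
        (q + 2 * q ^ 2 + 3 * q ^ 3) * E z ^ 1) (gaussianReal 0 1) := i0.sub i1
    have i012 : Integrable (fun z => (1 + q + q ^ 2 + q ^ 3) -
        (q + 2 * q ^ 2 + 3 * q ^ 3) * E z ^ 1 + (q ^ 2 + 3 * q ^ 3) * E z ^ 2)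
        (gaussianReal 0 1) := i01.add i2
    have e : ∫ z, ((1 + q + q ^ 2 + q ^ 3) - (q + 2 * q ^ 2 + 3 * q ^ 3) * E z ^ 1 +
      (q ^ 2 + 3 * q ^ 3) * E z ^ 2 - q ^ 3 * E z ^ 3) ∂(gaussianReal 0 1) =
        (1 + q + q ^ 2 + q ^ 3) - (q + 2 * q ^ 2 + 3 * q ^ 3) * 1 +
      (q ^ 2 + 3 * q ^ 3) * Real.exp μ - q ^ 3 * Real.exp μ ^ 3 := by
      rw [integral_sub i012 i3, integral_add i01 i2, integral_sub i0 i1,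
        integral_const_mul, integral_const_mul, integral_const_mul, h1, h2, h3]
      simp
    rw [← e]
    refine integral_mono (i012.sub i3) ?_ hpoly
    refine Integrable.of_bound (C := ‖invMix hp0 hp1‖) ?_
      (Eventually.of_forall fun z => (invMix hp0 hp1).norm_coe_le_norm _)
    exact ((invMix hp0 hp1).continuous.comp (by fun_prop)).aestronglyMeasurable
  rw [cavityG_eq hp0 hp1, div_mul_eq_mul_div, le_div_iff₀ (by positivity), mul_assoc]
  refine mul_le_mul_of_nonneg_left ?_ hlam
  have hx : 0 ≤ Real.exp μ - 1 := by linarith [Real.one_le_exp hμ]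
  have hp3 : 0 ≤ p * q ^ 2 * (3 * (Real.exp μ - 1) ^ 2 + (Real.exp μ - 1) ^ 3) := by positivity
  rw [show p = 1 - q by rw [hqdef]; ring] at hp3
  nlinarith

end Cavity

end SBM

namespace SBM

/-! ### Fixed points and iteration of monotone maps -/

section Iterates

/-- A continuous monotone self-map of `[0, ∞)` that is bounded by `B` and exceeds the identity near
`0` has a smallest and a largest positive fixed point. -/
theorem exists_isLeast_isGreatest_fixed {G : ℝ → ℝ} {B η : ℝ} (hG : Continuous G)
    (hB : ∀ x, G x ≤ B) (hη : 0 < η) (hlt : ∀ x, 0 < x → x ≤ η → x < G x) :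
    (∃ α, IsLeast {x | 0 < x ∧ G x = x} α) ∧ ∃ α, IsGreatest {x | 0 < x ∧ G x = x} α := by
  have hset : {x | 0 < x ∧ G x = x} = Set.Icc η B ∩ {x | G x = x} := by
    ext x
    constructor
    · rintro ⟨h0, hx⟩
      refine ⟨⟨?_, hx ▸ hB x⟩, hx⟩
      by_contra h
      exact (hlt x h0 (not_le.1 h).le).ne' hx
    · rintro ⟨⟨h1, _⟩, hx⟩
      exact ⟨hη.trans_le h1, hx⟩
  have hcpt : IsCompact {x | 0 < x ∧ G x = x} := by
    rw [hset]
    exact isCompact_Icc.inter_right (isClosed_eq hG continuous_id)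
  have hηB : η ≤ B := (hlt η hη le_rfl).le.trans (hB η)
  have hne : {x | 0 < x ∧ G x = x}.Nonempty := by
    rw [hset]
    obtain ⟨x, hx, h⟩ := intermediate_value_Icc' hηB (f := fun x => G x - x)
      (by fun_prop) (show (0 : ℝ) ∈ Set.Icc _ _ from
        ⟨by linarith [hB B], by linarith [hlt η hη le_rfl]⟩)
    exact ⟨x, hx, by simpa [sub_eq_zero] using h⟩
  exact ⟨hcpt.exists_isLeast hne, hcpt.exists_isGreatest hne⟩

variable {G : ℝ → ℝ} (hG : Continuous G) (hmono : ∀ x y, 0 ≤ x → x ≤ y → G x ≤ G y)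
include hG hmono

/-- Started at an upper bound, the iterates decrease, and by monotonicity they stay above every
fixed point; their limit is a fixed point. -/
theorem tendsto_iterate_isGreatest {B α : ℝ} (hB : ∀ x, G x ≤ B)
    (hα : IsGreatest {x | 0 < x ∧ G x = x} α) : Tendsto (fun t => G^[t] B) atTop (𝓝 α) := by
  obtain ⟨⟨h0, hfix⟩, hmax⟩ := hα
  have hge : ∀ t, α ≤ G^[t] B := by
    intro t
    induction t with
    | zero => exact hfix ▸ hB α
    | succ t ih =>
      rw [Function.iterate_succ_apply']
      calc α = G α := hfix.symm
        _ ≤ _ := hmono _ _ h0.le ih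
  have hanti : Antitone fun t => G^[t] B := by
    refine antitone_nat_of_succ_le fun t => ?_
    induction t with
    | zero => exact hB B
    | succ t ih =>
      have := hmono _ _ (h0.le.trans (hge (t + 1))) ih
      simpa only [Function.iterate_succ_apply'] using this
  have hlim := tendsto_atTop_ciInf hanti ⟨α, by rintro _ ⟨t, rfl⟩; exact hge t⟩
  set L := ⨅ t, G^[t] B
  have hL : G L = L := isFixedPt_of_tendsto_iterate hlim hG.continuousAt
  have hαL : α ≤ L := ge_of_tendsto' hlim hge
  rwa [le_antisymm (hmax ⟨h0.trans_le hαL, hL⟩) hαL] at hlim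

/-- The sequence is the orbit of `min b α`: below the smallest positive fixed point `G` dominates
the identity, so this orbit increases to `α`. The orbit of `b` itself need not converge to `α`. -/
theorem exists_tendsto_le_iterate {η α b : ℝ} (hη : 0 < η)
    (hlt : ∀ x, 0 < x → x ≤ η → x < G x) (hα : IsLeast {x | 0 < x ∧ G x = x} α) (hb : 0 < b) :
    ∃ ν : ℕ → ℝ, (∀ t, 0 < ν t) ∧ (∀ t, ν t ≤ G^[t] b) ∧ Tendsto ν atTop (𝓝 α) := by
  obtain ⟨⟨h0, hfix⟩, hmin⟩ := hα
  have hinc : ∀ x, 0 < x → x ≤ α → x ≤ G x := by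
    intro x hx hxα
    by_contra! h
    have hy0 : 0 < min η x := lt_min hη hx
    have hy := hlt (min η x) hy0 (min_le_left _ _)
    -- A value of `G` below the identity would force a positive fixed point in `[min η x, x]`;
    -- minimality of `α` leaves only `z = x`, which is excluded.
    obtain ⟨z, hz, hz'⟩ := intermediate_value_Icc' (min_le_right η x) (f := fun x => G x - x)
      (by fun_prop) (show (0 : ℝ) ∈ Set.Icc _ _ from ⟨by linarith, by linarith⟩)
    have hzfix : G z = z := by simpa [sub_eq_zero] using hz'
    have : α ≤ z := hmin ⟨hy0.trans_le hz.1, hzfix⟩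
    have hzx : z = x := le_antisymm hz.2 (hxα.trans this)
    rw [← hzx, hzfix] at h
    exact h.false
  set c := min b α
  have hc0 : 0 < c := lt_min hb h0
  have hbd : ∀ t, 0 < G^[t] c ∧ G^[t] c ≤ α := by
    intro t
    induction t with
    | zero => exact ⟨hc0, min_le_right _ _⟩
    | succ t ih =>
      rw [Function.iterate_succ_apply']
      refine ⟨ih.1.trans_le (hinc _ ih.1 ih.2), ?_⟩
      calc _ ≤ G α := hmono _ _ ih.1.le ih.2
        _ = α := hfix
  have hm : Monotone fun t => G^[t] c := by
    refine monotone_nat_of_le_succ fun t => ?_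
    rw [Function.iterate_succ_apply']
    exact hinc _ (hbd t).1 (hbd t).2
  refine ⟨fun t => G^[t] c, fun t => (hbd t).1, fun t => ?_, ?_⟩
  · change G^[t] c ≤ G^[t] b
    induction t with
    | zero => exact min_le_left _ _
    | succ t ih =>
      rw [Function.iterate_succ_apply', Function.iterate_succ_apply']
      exact hmono _ _ (hbd t).1.le ih
  · have hlim := tendsto_atTop_ciSup hm ⟨α, by rintro _ ⟨t, rfl⟩; exact (hbd t).2⟩
    set L := ⨆ t, G^[t] c
    have hL : G L = L := isFixedPt_of_tendsto_iterate hlim hG.continuousAt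
    have hLα : L ≤ α := le_of_tendsto' hlim fun t => (hbd t).2
    have hL0 : 0 < L := hc0.trans_le (ge_of_tendsto' hlim fun t => hm (Nat.zero_le t))
    rwa [le_antisymm hLα (hmin ⟨hL0, hL⟩)] at hlim

end Iterates

theorem exists_lt_cavityG {p lam : ℝ} (hp0 : 0 < p) (hp1 : p < 1) (hlam : 1 < lam) :
    ∃ η, 0 < η ∧ ∀ x, 0 < x → x ≤ η → x < cavityG p lam x := by
  have hlim : Tendsto (fun x => lam * (1 - 3 * (Real.exp x - 1) - (Real.exp x - 1) ^ 2)) (𝓝 0)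
      (𝓝 lam) := by
    have : Continuous fun x => lam * (1 - 3 * (Real.exp x - 1) - (Real.exp x - 1) ^ 2) := by
      fun_prop
    exact this.tendsto' _ _ (by simp)
  obtain ⟨δ, hδ, h⟩ := Metric.eventually_nhds_iff.1 (hlim.eventually (lt_mem_nhds hlam))
  refine ⟨δ / 2, by positivity, fun x hx hxδ => ?_⟩
  have h1 := h (y := x) (by rw [dist_zero_right, Real.norm_eq_abs, abs_of_pos hx]; linarith)
  have h2 := le_cavityG hp0 hp1 (zero_le_one.trans hlam.le) hx.le
  have h3 : x ≤ Real.exp x - 1 := by linarith [Real.add_one_le_exp x]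
  nlinarith

end SBM

namespace SBM

/-! ### Iteration over the depth of the tree -/

section Tree

variable {p lam : ℝ} (hp0 : 0 < p) (hp1 : p < 1)
include hp0 hp1

theorem affinity_bounds {s : ℝ} (hs : |s| ≤ p * (1 - p)) (z : Sym2 (Fin 2)) :
    0 ≤ affinity p s z ∧ affinity p s z ≤ 2 := by
  have hq : 0 < 1 - p := sub_pos.2 hp1
  have h1 : |(1 - p) * s / p| ≤ 1 := by
    rw [abs_div, abs_mul, abs_of_pos hq, abs_of_pos hp0, div_le_one hp0]
    nlinarith [abs_nonneg s]
  have h2 : |p * s / (1 - p)| ≤ 1 := by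
    rw [abs_div, abs_mul, abs_of_pos hq, abs_of_pos hp0, div_le_one hq]
    nlinarith [abs_nonneg s]
  have h3 : |s| ≤ 1 := by nlinarith
  rw [abs_le] at h1 h2 h3
  induction z with
  | _ x y =>
    fin_cases x <;> fin_cases y <;>
      simp only [Fin.zero_eta, Fin.mk_one, affinity_zero_zero, affinity_zero_one, affinity_one_zero,
        affinity_one_one] <;> constructor <;> linarith

theorem balanced_edgeProb {d s : ℝ} {n : ℕ} (hd : 0 < d) (hs : |s| ≤ p * (1 - p))
    (hn : 2 * d ≤ n) : Balanced (labelProb p) (edgeProb p d s n) (d / n) := by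
  have hn0 : (0 : ℝ) < n := by linarith
  have hq : 0 < 1 - p := sub_pos.2 hp1
  refine ⟨fun y => (labelProb_pos hp0 hp1 y).le, sum_labelProb p, fun z => ?_, fun z => ?_,
    fun x => ?_⟩
  · exact mul_nonneg (by positivity) (affinity_bounds hp0 hp1 hs z).1
  · have h := (affinity_bounds hp0 hp1 hs z).2
    calc d / n * affinity p s z ≤ d / n * 2 := by gcongr
      _ ≤ 1 := by rw [div_mul_eq_mul_div, div_le_one hn0]; linarith
  · fin_cases x <;>
      simp only [Fin.sum_univ_two, edgeProb, affinity_zero_zero, affinity_zero_one,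
        affinity_one_zero, affinity_one_one, labelProb, Matrix.cons_val_zero, Matrix.cons_val_one,
        Fin.zero_eta, Fin.mk_one] <;> field_simp <;> ring

theorem dchi_revealLaw (q : ℝ) : dchi p (revealLaw q) = q / (p * (1 - p)) := by
  have hq : 1 - p ≠ 0 := (sub_pos.2 hp1).ne'
  have e : dchi p (revealLaw q) = q ^ 2 / (p * q) + q ^ 2 / ((1 - p) * q) := by
    simp [dchi, Fintype.sum_option, Fin.sum_univ_two, revealLaw]
  rw [e]
  rcases eq_or_ne q 0 with rfl | h
  · simp
  · field_simp
    ring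

theorem eventually_abs_le_of_mul_sq :
    ∀ᶠ d : ℝ in atTop, ∀ s : ℝ, d * s ^ 2 = lam → |s| ≤ p * (1 - p) := by
  have hpq : 0 < p * (1 - p) := mul_pos hp0 (sub_pos.2 hp1)
  filter_upwards [eventually_gt_atTop 0, eventually_ge_atTop (lam / (p * (1 - p)) ^ 2)]
    with d hd0 hd s hds
  refine abs_le_of_sq_le_sq ?_ hpq.le
  rw [div_le_iff₀ (by positivity), ← hds] at hd
  exact le_of_mul_le_mul_left hd hd0

/-- Each level applies `cavityG` up to a small error, and continuity of `cavityG` carries the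
earlier error along. The depth is fixed before `d` grows, so no rate is needed. -/
theorem eventually_dchi_treeLaw_close {q : ℝ} (h0 : 0 ≤ q) (h1 : q ≤ 1) (t : ℕ) {ε : ℝ}
    (hε : 0 < ε) :
    ∀ᶠ d : ℝ in atTop, ∀ s : ℝ, d * s ^ 2 = lam → ∀ n : ℕ, 2 * d ≤ n →
      |lam * dchi p (treeLaw (labelProb p) (edgeProb p d s n) (d / n) q (Fin n) t) -
        (cavityG p lam)^[t] (lam * (q / (p * (1 - p))))| ≤ ε := by
  induction t generalizing ε with
  | zero =>
    refine Eventually.of_forall fun d s _ n _ => ?_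
    have := dchi_revealLaw hp0 hp1 q
    change |lam * dchi p (revealLaw q) - lam * (q / (p * (1 - p)))| ≤ ε
    rw [this]
    simpa using hε.le
  | succ t ih =>
    have hcont := (continuous_cavityG hp0 hp1 lam).tendsto
      ((cavityG p lam)^[t] (lam * (q / (p * (1 - p)))))
    obtain ⟨δ, hδ, hclose⟩ := Metric.tendsto_nhds_nhds.1 hcont (ε / 2) (by positivity)
    filter_upwards [ih (half_pos hδ), eventually_stepLaw_close hp0 hp1 (half_pos hε),
      eventually_abs_le_of_mul_sq hp0 hp1, eventually_gt_atTop 0] with d hd hstep hs hd0 s hds n hn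
    have hbal := balanced_edgeProb hp0 hp1 hd0 (hs s hds) hn
    have e1 := (hstep s hds n (by linarith) (Obs (Fin n) t) _ (treeLaw_nonneg (V := Fin n) hbal h0 h1 t)
      (sum_treeLaw (V := Fin n) hbal t)).2
    have e2 := hclose (x := lam * dchi p
      (treeLaw (labelProb p) (edgeProb p d s n) (d / n) q (Fin n) t)) (by
        rw [Real.dist_eq]; linarith [hd s hds n hn])
    rw [Real.dist_eq] at e2
    rw [Function.iterate_succ_apply']
    exact (abs_sub_le _ _ _).trans ((add_le_add e1 e2.le).trans (by linarith))

/-- The lower `t` levels only matter through their chi-square information; the top level converts it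
into a total variation distance, hence `t + 1` against `t`. -/
theorem eventually_l1_treeLaw_close {q : ℝ} (h0 : 0 ≤ q) (h1 : q ≤ 1) (t : ℕ) {ε : ℝ}
    (hε : 0 < ε) :
    ∀ᶠ d : ℝ in atTop, ∀ s : ℝ, d * s ^ 2 = lam → ∀ n : ℕ, 2 * d ≤ n →
      |l1 (treeLaw (labelProb p) (edgeProb p d s n) (d / n) q (Fin n) (t + 1) 0)
          (treeLaw (labelProb p) (edgeProb p d s n) (d / n) q (Fin n) (t + 1) 1) / 2 -
        gaussMean hinge ((cavityG p lam)^[t] (lam * (q / (p * (1 - p)))))| ≤ ε := by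
  have hcont := (continuous_gaussMean hinge).tendsto
    ((cavityG p lam)^[t] (lam * (q / (p * (1 - p)))))
  obtain ⟨δ, hδ, hclose⟩ := Metric.tendsto_nhds_nhds.1 hcont (ε / 2) (by positivity)
  filter_upwards [eventually_dchi_treeLaw_close hp0 hp1 h0 h1 t (half_pos hδ),
    eventually_stepLaw_close hp0 hp1 (half_pos hε),
    eventually_abs_le_of_mul_sq hp0 hp1, eventually_gt_atTop 0] with d hd hstep hs hd0 s hds n hn
  have hbal := balanced_edgeProb hp0 hp1 hd0 (hs s hds) hn
  have e1 := (hstep s hds n (by linarith) (Obs (Fin n) t) _ (treeLaw_nonneg (V := Fin n) hbal h0 h1 t)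
    (sum_treeLaw (V := Fin n) hbal t)).1
  have e2 := hclose (x := lam * dchi p
    (treeLaw (labelProb p) (edgeProb p d s n) (d / n) q (Fin n) t)) (by
      rw [Real.dist_eq]; linarith [hd s hds n hn])
  rw [Real.dist_eq] at e2
  exact (abs_sub_le _ _ _).trans ((add_le_add e1 e2.le).trans (by linarith))

omit hp1 in
theorem connectivity_eq (hp1 : p < 1) {d a b c : ℝ} (hab : p * a + (1 - p) * b = 1)
    (hbc : p * b + (1 - p) * c = 1) (n : ℕ) (x y : Fin 2) :
    connectivity d a b c n x y = edgeProb p d (1 - b) n s(x, y) := by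
  have hq : 1 - p ≠ 0 := (sub_pos.2 hp1).ne'
  have ha : a = 1 + (1 - p) * (1 - b) / p := by field_simp; linarith
  have hc : c = 1 + p * (1 - b) / (1 - p) := by field_simp; linarith
  fin_cases x <;> fin_cases y <;>
    simp [connectivity, edgeProb, affinity_zero_zero, affinity_zero_one, affinity_one_zero,
      affinity_one_one, ← ha, ← hc]

end Tree

/-! ### Conclusion for the block model -/

section Model

variable {p lam : ℝ} {a b c : ℝ → ℝ} (hp0 : 0 < p) (hp1 : p < 1)
    (hab : ∀ d : ℝ, 0 < d → p * a d + (1 - p) * b d = 1)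
    (hbc : ∀ d : ℝ, 0 < d → p * b d + (1 - p) * c d = 1)
    (hb : ∀ d : ℝ, 0 < d → d * (1 - b d) ^ 2 = lam)
include hp0 hp1 hab hbc hb

/-- The case `q = 1`: the starting value is exactly the upper bound for `cavityG` from `cavityG_le`.
-/
theorem eventually_optSuccess_le_gaussMean (t : ℕ) {ε : ℝ} (hε : 0 < ε) :
    ∀ᶠ d : ℝ in atTop, ∀ᶠ n : ℕ in atTop,
      optSuccess n p (connectivity d (a d) (b d) (c d) n) ≤
        gaussMean hinge ((cavityG p lam)^[t] (lam / (p * (1 - p)))) + ε := by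
  filter_upwards [eventually_l1_treeLaw_close (lam := lam) hp0 hp1 zero_le_one le_rfl t
    (half_pos hε), eventually_abs_le_of_mul_sq hp0 hp1, eventually_gt_atTop 0] with d hd hs hd0
  have hn : ∀ᶠ n : ℕ in atTop, 2 * d ≤ n := tendsto_natCast_atTop_atTop.eventually_ge_atTop _
  have h := eventually_optSuccess_le (C := 2 * d) (k := edgeProb p d (1 - b d))
    (r := fun n => d / n) hp0 hp1
    (fun n x y => connectivity_eq hp0 hp1 (hab d hd0) (hbc d hd0) n x y)
    (hn.mono fun n hn => balanced_edgeProb hp0 hp1 hd0 (hs _ (hb d hd0)) hn)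
    (fun n z => by
      rw [mul_comm 2 d, mul_div_right_comm]
      exact mul_le_mul_of_nonneg_left (affinity_bounds hp0 hp1 (hs _ (hb d hd0)) z).2
        (by positivity))
    (fun n => by gcongr; linarith) (t + 1) (half_pos hε)
  filter_upwards [h, hn] with n h1 h2
  have h3 := (abs_le.1 (hd _ (hb d hd0) n h2)).2
  rw [mul_one_div] at h3
  linarith

theorem eventually_gaussMean_le_optSuccessReveal {q : ℝ} (h0 : 0 ≤ q) (h1 : q ≤ 1) (t : ℕ) {ε : ℝ}
    (hε : 0 < ε) :
    ∀ᶠ d : ℝ in atTop, ∀ᶠ n : ℕ in atTop,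
      gaussMean hinge ((cavityG p lam)^[t] (lam * (q / (p * (1 - p))))) - ε ≤
        optSuccessReveal n p (connectivity d (a d) (b d) (c d) n) q := by
  filter_upwards [eventually_l1_treeLaw_close (lam := lam) hp0 hp1 h0 h1 t
    (half_pos hε), eventually_abs_le_of_mul_sq hp0 hp1, eventually_gt_atTop 0] with d hd hs hd0
  have hn : ∀ᶠ n : ℕ in atTop, 2 * d ≤ n := tendsto_natCast_atTop_atTop.eventually_ge_atTop _
  have h := eventually_le_optSuccessReveal (C := 2 * d) (k := edgeProb p d (1 - b d))
    (r := fun n => d / n) hp0 hp1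
    (fun n x y => connectivity_eq hp0 hp1 (hab d hd0) (hbc d hd0) n x y)
    (hn.mono fun n hn => balanced_edgeProb hp0 hp1 hd0 (hs _ (hb d hd0)) hn)
    (fun n z => by
      rw [mul_comm 2 d, mul_div_right_comm]
      exact mul_le_mul_of_nonneg_left (affinity_bounds hp0 hp1 (hs _ (hb d hd0)) z).2
        (by positivity))
    (fun n => by gcongr; linarith) h0 h1 (t + 1) (half_pos hε)
  filter_upwards [h, hn] with n h1 h2
  have h3 := (abs_le.1 (hd _ (hb d hd0) n h2)).1
  linarith

variable (hlam : 1 < lam)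
include hlam

theorem upperBound_isGreatest {α : ℝ} (hα : IsGreatest {μ : ℝ | 0 < μ ∧ cavityG p lam μ = μ} α) :
    UpperBound p a b c α := by
  have hl0 : 0 ≤ lam := by linarith
  have hlim := ((continuous_gaussMean hinge).tendsto α).comp
    (tendsto_iterate_isGreatest (continuous_cavityG hp0 hp1 lam)
      (fun x y hx hxy => cavityG_mono hp0 hp1 hl0 hx hxy) (cavityG_le hp0 hp1 hl0) hα)
  rw [UpperBound, gaussianSuccess_eq hα.1.1]
  by_contra! h
  obtain ⟨z, hz1, hz2⟩ := EReal.lt_iff_exists_real_btwn.1 h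
  have hz : gaussMean hinge α < z := by exact_mod_cast hz1
  obtain ⟨w, hw1, hw2⟩ := exists_between hz
  -- The depth `t` is chosen last, as a function of the gap to be contradicted, and the error `z -
  -- w` absorbs the limits in `n` and `d`.
  obtain ⟨t, ht⟩ := (hlim.eventually (gt_mem_nhds hw1)).exists
  have hev := eventually_optSuccess_le_gaussMean hp0 hp1 hab hbc hb t (sub_pos.2 hw2)
  refine absurd hz2 (not_lt.2 (limsup_le_of_le (h := hev.mono fun d hd =>
    limsup_le_of_le (h := hd.mono fun n hn => ?_))))
  rw [EReal.coe_le_coe_iff]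
  simp only [Function.comp_apply] at ht
  linarith

theorem lowerBound_isLeast {α : ℝ} (hα : IsLeast {μ : ℝ | 0 < μ ∧ cavityG p lam μ = μ} α) :
    LowerBound p a b c α := by
  intro q hq0 hq1
  have hl0 : 0 ≤ lam := by linarith
  have hpq : 0 < p * (1 - p) := mul_pos hp0 (sub_pos.2 hp1)
  obtain ⟨η, hη, hlt⟩ := exists_lt_cavityG hp0 hp1 hlam
  obtain ⟨ν, hν0, hν, hνα⟩ := exists_tendsto_le_iterate (continuous_cavityG hp0 hp1 lam)
      (fun x y hx hxy => cavityG_mono hp0 hp1 hl0 hx hxy) hη hlt hα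
      (b := lam * (q / (p * (1 - p)))) (mul_pos (by linarith) (div_pos hq0 hpq))
  have hlim := ((continuous_gaussMean hinge).tendsto α).comp hνα
  rw [gaussianSuccess_eq hα.1.1]
  by_contra! h
  obtain ⟨z, hz1, hz2⟩ := EReal.lt_iff_exists_real_btwn.1 h
  have hz : z < gaussMean hinge α := by exact_mod_cast hz2
  obtain ⟨w, hw1, hw2⟩ := exists_between hz
  obtain ⟨t, ht⟩ := (hlim.eventually (lt_mem_nhds hw2)).exists
  -- The iterates need not converge to `α`; they lie above `ν`, and the success probability
  -- increases with the information.
  have hmono := gaussMean_hinge_mono (hν0 t) (hν t)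
  have hev := eventually_gaussMean_le_optSuccessReveal hp0 hp1 hab hbc hb hq0.le hq1.le t
    (sub_pos.2 hw1)
  refine absurd hz1 (not_lt.2 (le_liminf_of_le (h := hev.mono fun d hd =>
    le_liminf_of_le (h := hd.mono fun n hn => ?_))))
  rw [EReal.coe_le_coe_iff]
  simp only [Function.comp_apply] at ht
  linarith

end Model

end SBM

end

theorem proposition1 (p lam : ℝ) (hp0 : 0 < p) (hp : p ≤ 1 / 2) (hlam : 1 < lam)
    (a b c : ℝ → ℝ)
    (hab : ∀ d : ℝ, 0 < d → p * a d + (1 - p) * b d = 1)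
    (hbc : ∀ d : ℝ, 0 < d → p * b d + (1 - p) * c d = 1)
    (hb : ∀ d : ℝ, 0 < d → d * (1 - b d) ^ 2 = lam) :
    (∀ α : ℝ, 0 < α →
      (∀ μ : ℝ, 0 ≤ μ → (cavityG p lam μ = μ ↔ μ = 0 ∨ μ = α)) →
        UpperBound p a b c α ∧ LowerBound p a b c α) ∧
    (∃ αmin αmax : ℝ,
      IsLeast {μ : ℝ | 0 < μ ∧ cavityG p lam μ = μ} αmin ∧
      IsGreatest {μ : ℝ | 0 < μ ∧ cavityG p lam μ = μ} αmax ∧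
      UpperBound p a b c αmax ∧ LowerBound p a b c αmin) := by
  have hp1 : p < 1 := by linarith
  refine ⟨fun α hα hfix => ?_, ?_⟩
  · have hset : {μ : ℝ | 0 < μ ∧ cavityG p lam μ = μ} = {α} := by
      ext μ
      constructor
      · rintro ⟨h0, hμ⟩
        exact ((hfix μ h0.le).1 hμ).resolve_left h0.ne'
      · rintro rfl
        exact ⟨hα, (hfix μ hα.le).2 (Or.inr rfl)⟩
    exact ⟨SBM.upperBound_isGreatest hp0 hp1 hab hbc hb hlam (hset ▸ isGreatest_singleton),
      SBM.lowerBound_isLeast hp0 hp1 hab hbc hb hlam (hset ▸ isLeast_singleton)⟩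
  · obtain ⟨η, hη, hlt⟩ := SBM.exists_lt_cavityG hp0 hp1 hlam
    obtain ⟨⟨αmin, hmin⟩, αmax, hmax⟩ := SBM.exists_isLeast_isGreatest_fixed
      (SBM.continuous_cavityG hp0 hp1 lam) (SBM.cavityG_le hp0 hp1 (by linarith)) hη hlt
    exact ⟨αmin, αmax, hmin, hmax, SBM.upperBound_isGreatest hp0 hp1 hab hbc hb hlam hmax,
      SBM.lowerBound_isLeast hp0 hp1 hab hbc hb hlam hmin⟩
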